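/- Let $K$ be a commutative ring and let $\Gamma$ be a loop-free quiver, possibly infinite, with vertex set $I$ and with a finite number $|i\to j|$ of arrows from $i$ to $j$ for all $i,j\in I$. Put $i\cdot j:=|i\to j|+|j\to i|$, and, for $i\neq j$, $Q_{ij}(u,v):=(-1)^{|i\to j|}(u-v)^{i\cdot j}$ and $d(i,j):=i\cdot j$; put $Q_{ii}:=0$ and $d(i,i):=-2$. For $n\ge 0$ let $\mathfrak S_n$ act on $I^n$ by place permutation, and let $r_a=(a,a+1)$. For an $\mathfrak S_n$-orbit $\alpha\subseteq I^n$, the quiver Hecke algebra $H_\alpha(\Gamma)$ is the unital associative $K$-algebra generated by $y_1,\dots,y_n$, $\psi_1,\dots,\psi_{n-1}$ and $e(\boldsymbol i)$, $\boldsymbol i\in\alpha$, with the relations (for all $\boldsymbol i,\boldsymbol j\in\alpha$ and all indices for which they make sense) $$\sum_{\boldsymbol i\in\alpha}e(\boldsymbol i)=1,\quad e(\boldsymbol i)e(\boldsymbol j)=\delta_{\boldsymbol i\boldsymbol j}e(\boldsymbol i),\quad y_ay_b=y_by_a,\quad y_ae(\boldsymbol i)=e(\boldsymbol i)y_a,\quad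 \psi_ae(\boldsymbol i)=e(r_a\cdot\boldsymbol i)\psi_a,$$ $$(\psi_ay_b-y_{r_a(b)}\psi_a)e(\boldsymbol i)=\begin{cases}-e(\boldsymbol i)&\text{if } b=a,\ i_a=i_{a+1},\\ e(\boldsymbol i)&\text{if } b=a+1,\ i_a=i_{a+1},\\ 0&\text{otherwise,}\end{cases}$$ $$\psi_a\psi_b=\psi_b\psi_a\ \text{ if } |a-b|>1,\qquad \psi_a^2e(\boldsymbol i)=Q_{i_ai_{a+1}}(y_a,y_{a+1})e(\boldsymbol i),$$ $$(\psi_{b+1}\psi_b\psi_{b+1}-\psi_b\psi_{b+1}\psi_b)e(\boldsymbol i)=\begin{cases}\dfrac{Q_{i_bi_{b+1}}(y_b,y_{b+1})-Q_{i_bi_{b+1}}(y_{b+2},y_{b+1})}{y_b-y_{b+2}}\,e(\boldsymbol i)&\text{if } i_b=i_{b+2},\\ 0&\text{otherwise.}\end{cases}$$ It is $\mathbb Z$-graded by $\deg e(\boldsymbol i)=0$, $\deg y_a=2$, $\deg\psi_be(\boldsymbol i)=d(i_b,i_{b+1})$. For a finitely supported family $\Lambda=(\Lambda_i)_{i\in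 I}$ of non-negative integers, the cyclotomic quiver Hecke algebra $H^\Lambda_\alpha(\Gamma)$ is the (graded) quotient of $H_\alpha(\Gamma)$ by the two-sided ideal generated by the elements $y_1^{\Lambda_{i_1}}e(\boldsymbol i)$, $\boldsymbol i\in\alpha$ (no relation is added if $n=0$). Put $H_n(\Gamma):=\bigoplus_\alpha H_\alpha(\Gamma)$ and $H_n^\Lambda(\Gamma):=\bigoplus_\alpha H_\alpha^\Lambda(\Gamma)$, where $\alpha$ runs over all $\mathfrak S_n$-orbits in $I^n$; these are graded $K$-algebras with componentwise product, without unit in general if $I$ is infinite. Let $d\ge1$ and let $\Gamma=\bigsqcup_{j=1}^d\Gamma^{(j)}$ be a decomposition of $\Gamma$ as a disjoint union of full subquivers, with no arrows between $\Gamma^{(j)}$ and $\Gamma^{(j')}$ if $j\ne j'$; for $\Lambda$ as above let $\Lambda^{(j)}$ be its restriction to the vertex set of $\Gamma^{(j)}$. **Corollary.** For every $n\ge0$ there is an isomorphism of graded (possibly non-unital) $K$-algebras $$H_n(\Gamma)\simeq\bigoplus_{\substack{n_1,\dots,n_d\ge0\\ n_1+\dots+n_d=n}}\mathrm{Mat}_{\binom{n}{n_1,\dots,n_d}}\Bigl(\bigotimes_{j=1}^dH_{n_j}(\Gamma^{(j)})\Bigr),$$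 and for every finitely supported family $\Lambda$ of non-negative integers there is an isomorphism of graded (possibly non-unital) $K$-algebras $$H_n^\Lambda(\Gamma)\simeq\bigoplus_{\substack{n_1,\dots,n_d\ge0\\ n_1+\dots+n_d=n}}\mathrm{Mat}_{\binom{n}{n_1,\dots,n_d}}\Bigl(\bigotimes_{j=1}^dH_{n_j}^{\Lambda^{(j)}}(\Gamma^{(j)})\Bigr).$$ Here the tensor products are over $K$ with their total grading, $\binom{n}{n_1,\dots,n_d}=\frac{n!}{n_1!\cdots n_d!}$, and a matrix is homogeneous of degree $k$ if all its coefficients are. -/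

import Mathlib

open scoped TensorProduct

/-! ### Quivers -/

namespace Quiver

universe u w

/-- The full subquiver on a set `s` of vertices: all arrows of `Γ` between vertices of `s`. -/
abbrev fullSub {I : Type u} (Γ : Quiver.{w} I) (s : Set I) : Quiver.{w} s :=
  ⟨fun i j => Γ.Hom i.1 j.1⟩

/-- The number `|i → j|` of arrows from `i` to `j` (assumed finite in all uses). -/
noncomputable def arrowCount {I : Type u} (Γ : Quiver.{w} I) (i j : I) : ℕ :=
  Nat.card (Γ.Hom i j)

/-- `i · j = |i → j| + |j → i|`. -/
noncomputable def dot {I : Type u} (Γ : Quiver.{w} I) (i j : I) : ℕ :=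
  Γ.arrowCount i j + Γ.arrowCount j i

open Classical in
/-- The integer `d(i, j)`: it is `i · j` if `i ≠ j`, and `-2` if `i = j`. -/
noncomputable def dDeg {I : Type u} (Γ : Quiver.{w} I) (i j : I) : ℤ :=
  if i = j then -2 else (Γ.dot i j : ℤ)

open Classical in
/-- The polynomial `Q_{ij}(u, v) = (-1)^{|i → j|} (u - v)^{i · j}` if `i ≠ j` and `0` if `i = j`,
evaluated at two elements of a ring. -/
noncomputable def polyQ {I : Type u} (Γ : Quiver.{w} I) (i j : I) {A : Type*} [Ring A]
    (u v : A) : A :=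
  if i = j then 0 else (-1) ^ Γ.arrowCount i j * (u - v) ^ Γ.dot i j

open Classical in
/-- The polynomial `(Q_{ij}(u, v) - Q_{ij}(w, v)) / (u - w)` in three variables, evaluated at three
elements of a ring; see `polyQ_sub_polyQ`. -/
noncomputable def dividedQ {I : Type u} (Γ : Quiver.{w} I) (i j : I) {A : Type*} [Ring A]
    (u v w : A) : A :=
  if i = j then 0 else
    (-1) ^ Γ.arrowCount i j *
      ∑ s ∈ Finset.range (Γ.dot i j), (u - v) ^ s * (w - v) ^ (Γ.dot i j - 1 - s)

/-- `dividedQ` is the divided difference of `polyQ`. In a polynomial ring in `u, v, w` the element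
`u - w` is not a zero divisor, so this characterises the polynomial `dividedQ`. -/
theorem polyQ_sub_polyQ {I : Type u} (Γ : Quiver.{w} I) (i j : I) {A : Type*} [CommRing A]
    (u v w : A) :
    Γ.dividedQ i j u v w * (u - w) = Γ.polyQ i j u v - Γ.polyQ i j w v := by
  unfold dividedQ polyQ
  split_ifs with h
  · simp
  · have h1 := geom_sum₂_mul (u - v) (w - v) (Γ.dot i j)
    rw [← mul_sub, ← h1]
    ring

end Quiver

/-! ### The quiver Hecke algebra -/

namespace QuiverHecke

universe u v w

/-- The generators `y_a` (`1 ≤ a ≤ n`), `ψ_b` (`1 ≤ b ≤ n - 1`) and `e(i)` (`i ∈ α`);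
the indices `a` and `b` are shifted so as to start at `0`. -/
inductive Gen {I : Type u} {n : ℕ} (α : Set (Fin n → I)) : Type u
  | y (a : Fin n) : Gen α
  | psi (b : Fin (n - 1)) : Gen α
  | e (i : α) : Gen α

/-- The place `b` among the `n` places, for `b` the index of a generator `ψ_b`. -/
def lo {n : ℕ} (b : Fin (n - 1)) : Fin n := ⟨b, by omega⟩

/-- The place `b + 1` among the `n` places, for `b` the index of a generator `ψ_b`. -/
def hi {n : ℕ} (b : Fin (n - 1)) : Fin n := ⟨b + 1, by omega⟩

/-- The transposition `r_b = (b, b + 1)`. -/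
def r {n : ℕ} (b : Fin (n - 1)) : Equiv.Perm (Fin n) := Equiv.swap (lo b) (hi b)

section Relations

variable (K : Type v) [CommRing K] {I : Type u} (Γ : Quiver.{w} I) {n : ℕ} (α : Set (Fin n → I))

/-- The generator `y_a` in the free algebra. -/
abbrev fy (a : Fin n) : FreeAlgebra K (Gen α) := FreeAlgebra.ι K (Gen.y a)

/-- The generator `ψ_b` in the free algebra. -/
abbrev fpsi (b : Fin (n - 1)) : FreeAlgebra K (Gen α) := FreeAlgebra.ι K (Gen.psi b)

/-- The generator `e(i)` in the free algebra. -/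
abbrev fe (i : α) : FreeAlgebra K (Gen α) := FreeAlgebra.ι K (Gen.e i)

/-- The defining relations of the quiver Hecke algebra. The tuple `r_b · i` is `i ∘ r_b`; it lies
in `α` when `α` is stable under place permutations, which is the case of interest. -/
inductive Rel [Finite α] : FreeAlgebra K (Gen α) → FreeAlgebra K (Gen α) → Prop
  | sum_e : Rel (∑ᶠ i : α, fe K α i) 1
  | e_mul_self (i : α) : Rel (fe K α i * fe K α i) (fe K α i)
  | e_mul_ne (i j : α) (h : i ≠ j) : Rel (fe K α i * fe K α j) 0
  | y_mul_y (a b : Fin n) : Rel (fy K α a * fy K α b) (fy K α b * fy K α a)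
  | y_mul_e (a : Fin n) (i : α) : Rel (fy K α a * fe K α i) (fe K α i * fy K α a)
  | psi_mul_e (b : Fin (n - 1)) (i j : α) (h : j.1 = i.1 ∘ r b) :
      Rel (fpsi K α b * fe K α i) (fe K α j * fpsi K α b)
  | psi_mul_y_lo (b : Fin (n - 1)) (i : α) (h : i.1 (lo b) = i.1 (hi b)) :
      Rel ((fpsi K α b * fy K α (lo b) - fy K α (hi b) * fpsi K α b) * fe K α i) (-fe K α i)
  | psi_mul_y_hi (b : Fin (n - 1)) (i : α) (h : i.1 (lo b) = i.1 (hi b)) :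
      Rel ((fpsi K α b * fy K α (hi b) - fy K α (lo b) * fpsi K α b) * fe K α i) (fe K α i)
  | psi_mul_y (b : Fin (n - 1)) (a : Fin n) (i : α)
      (h : ¬((a = lo b ∨ a = hi b) ∧ i.1 (lo b) = i.1 (hi b))) :
      Rel ((fpsi K α b * fy K α a - fy K α (r b a) * fpsi K α b) * fe K α i) 0
  | psi_mul_psi (a b : Fin (n - 1)) (h : (a : ℕ) + 1 < b ∨ (b : ℕ) + 1 < a) :
      Rel (fpsi K α a * fpsi K α b) (fpsi K α b * fpsi K α a)
  | psi_sq (b : Fin (n - 1)) (i : α) :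
      Rel (fpsi K α b * fpsi K α b * fe K α i)
        (Γ.polyQ (i.1 (lo b)) (i.1 (hi b)) (fy K α (lo b)) (fy K α (hi b)) * fe K α i)
  | braid_eq (b c : Fin (n - 1)) (hc : (c : ℕ) = b + 1) (i : α) (h : i.1 (lo b) = i.1 (hi c)) :
      Rel ((fpsi K α c * fpsi K α b * fpsi K α c - fpsi K α b * fpsi K α c * fpsi K α b) *
          fe K α i)
        (Γ.dividedQ (i.1 (lo b)) (i.1 (hi b)) (fy K α (lo b)) (fy K α (hi b)) (fy K α (hi c)) *
          fe K α i)
  | braid_ne (b c : Fin (n - 1)) (hc : (c : ℕ) = b + 1) (i : α) (h : i.1 (lo b) ≠ i.1 (hi c)) :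
      Rel ((fpsi K α c * fpsi K α b * fpsi K α c - fpsi K α b * fpsi K α c * fpsi K α b) *
          fe K α i) 0

/-- The quiver Hecke algebra `H_α(Γ)` of a finite set `α ⊆ Iⁿ` that is stable under place
permutations. -/
abbrev Alg [Finite α] : Type (max u v) := RingQuot (Rel K Γ α)

/-- The element of `H_α(Γ)` given by a generator. -/
noncomputable def gen [Finite α] (g : Gen α) : Alg K Γ α :=
  RingQuot.mkAlgHom K (Rel K Γ α) (FreeAlgebra.ι K g)

/-- `IsMonomial K Γ α k x`: the element `x` of `H_α(Γ)` is a product of the elements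
`e(i)` (degree `0`), `y_a` (degree `2`) and `ψ_b e(i)` (degree `d(i_b, i_{b+1})`), with total
degree `k`. -/
inductive IsMonomial [Finite α] : ℤ → Alg K Γ α → Prop
  | e (i : α) : IsMonomial 0 (gen K Γ α (Gen.e i))
  | y (a : Fin n) : IsMonomial 2 (gen K Γ α (Gen.y a))
  | psi (b : Fin (n - 1)) (i : α) :
      IsMonomial (Γ.dDeg (i.1 (lo b)) (i.1 (hi b)))
        (gen K Γ α (Gen.psi b) * gen K Γ α (Gen.e i))
  | mul (k l : ℤ) (x y : Alg K Γ α) :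
      IsMonomial k x → IsMonomial l y → IsMonomial (k + l) (x * y)

/-- The homogeneous component of degree `k` of `H_α(Γ)`. -/
noncomputable def grade [Finite α] (k : ℤ) : Submodule K (Alg K Γ α) :=
  Submodule.span K {x | IsMonomial K Γ α k x}

/-- The cyclotomic relations `y_1^{Λ_{i_1}} e(i) = 0`, for `i = (i_1, …, i_n) ∈ α`. There is no such
relation if `n = 0`. -/
inductive CycRel [Finite α] (Λ : I → ℕ) : Alg K Γ α → Alg K Γ α → Prop
  | cyc (h : 0 < n) (i : α) :
      CycRel Λ (gen K Γ α (Gen.y ⟨0, h⟩) ^ Λ (i.1 ⟨0, h⟩) * gen K Γ α (Gen.e i)) 0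

/-- The cyclotomic quiver Hecke algebra `H_α^Λ(Γ)`: the quotient of `H_α(Γ)` by the two-sided ideal
generated by the cyclotomic relations. -/
abbrev CycAlg [Finite α] (Λ : I → ℕ) : Type (max u v) := RingQuot (CycRel K Γ α Λ)

/-- The homogeneous component of degree `k` of `H_α^Λ(Γ)`: the image of that of `H_α(Γ)`. -/
noncomputable def cycGrade [Finite α] (Λ : I → ℕ) (k : ℤ) : Submodule K (CycAlg K Γ α Λ) :=
  (grade K Γ α k).map (RingQuot.mkAlgHom K (CycRel K Γ α Λ)).toLinearMap

end Relations

/-! ### Direct sums, tensor products and matrices of graded (possibly non-unital) algebras -/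

section Constructions

variable (K : Type v) [CommRing K]

/-- The direct sum `⨁ i, A i` of a family of (possibly non-unital) `K`-algebras, with componentwise
product: the families with finite support. It has a unit only if all but finitely many `A i`
vanish. -/
def directSumAlg {ι : Type*} (A : ι → Type*) [∀ i, NonUnitalSemiring (A i)] [∀ i, Module K (A i)] :
    NonUnitalSubalgebra K (∀ i, A i) where
  carrier := {f | {i | f i ≠ 0}.Finite}
  add_mem' {f g} hf hg := by
    refine (Set.Finite.union hf hg).subset fun i hi => ?_
    by_contra h
    simp only [Set.mem_union, Set.mem_ofPred_eq, not_or, not_not] at h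
    exact hi (by simp [h.1, h.2])
  zero_mem' := by simp
  mul_mem' {f g} hf hg := by
    refine Set.Finite.subset hf fun i hi h => hi ?_
    simp [h]
  smul_mem' c f hf := by
    refine Set.Finite.subset hf fun i hi h => hi ?_
    simp [h]

/-- The grading of a direct sum: an element has degree `k` if all its components do. -/
def directSumGrade {ι : Type*} {A : ι → Type*} [∀ i, NonUnitalSemiring (A i)] [∀ i, Module K (A i)]
    (𝒜 : ∀ i, ℤ → Submodule K (A i)) (k : ℤ) : Submodule K (directSumAlg K A) where
  carrier := {f | ∀ i, f.1 i ∈ 𝒜 i k}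
  add_mem' hf hg i := (𝒜 i k).add_mem (hf i) (hg i)
  zero_mem' i := (𝒜 i k).zero_mem
  smul_mem' c _ hf i := (𝒜 i k).smul_mem c (hf i)

/-- The grading of a tensor product: the component of degree `k` is spanned by the pure tensors of
homogeneous elements whose degrees add up to `k`. -/
noncomputable def tensorGrade {ι : Type*} [Fintype ι] {A : ι → Type*} [∀ i, NonUnitalSemiring (A i)]
    [∀ i, Module K (A i)] (𝒜 : ∀ i, ℤ → Submodule K (A i)) (k : ℤ) :
    Submodule K (⨂[K] i, A i) :=
  Submodule.span K {x | ∃ (m : ι → ℤ) (a : ∀ i, A i),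
    (∀ i, a i ∈ 𝒜 i (m i)) ∧ ∑ i, m i = k ∧ x = PiTensorProduct.tprod K a}

/-- The grading of a matrix algebra: a matrix has degree `k` if all its coefficients do. -/
def matrixGrade (m : Type*) {A : Type*} [NonUnitalNonAssocSemiring A] [Module K A]
    (𝒜 : ℤ → Submodule K A) (k : ℤ) : Submodule K (Matrix m m A) where
  carrier := {M | ∀ i j, M i j ∈ 𝒜 k}
  add_mem' hf hg i j := (𝒜 k).add_mem (hf i j) (hg i j)
  zero_mem' _ _ := (𝒜 k).zero_mem
  smul_mem' c _ hf i j := (𝒜 k).smul_mem c (hf i j)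

/-- There is an isomorphism of graded (possibly non-unital) `K`-algebras: a `K`-linear
multiplicative bijection under which the homogeneous components of each degree correspond. -/
def GradedIso {A B : Type*} [NonUnitalNonAssocSemiring A] [Module K A]
    [NonUnitalNonAssocSemiring B] [Module K B]
    (𝒜 : ℤ → Submodule K A) (ℬ : ℤ → Submodule K B) : Prop :=
  ∃ f : A →ₙₐ[K] B, Function.Bijective f ∧ ∀ (k : ℤ) (x : A), x ∈ 𝒜 k ↔ f x ∈ ℬ k

end Constructions

/-! ### The algebras `H_n(Γ)` and `H_n^Λ(Γ)` -/

section Total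

/-- The set of orbits of the symmetric group on `Iⁿ`, acting by place permutation. -/
abbrev Orbit (I : Type u) (n : ℕ) : Type u :=
  MulAction.orbitRel.Quotient (Equiv.Perm (Fin n))ᵈᵐᵃ (Fin n → I)

instance finite_orbit {I : Type u} {n : ℕ} (ω : Orbit I n) : Finite ω.orbit := by
  induction ω using Quotient.inductionOn' with
  | h a =>
    rw [MulAction.orbitRel.Quotient.orbit_mk]
    have : Finite (Equiv.Perm (Fin n))ᵈᵐᵃ := Finite.of_equiv _ DomMulAct.mk
    exact (Finite.finite_mulAction_orbit a).to_subtype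

/-- Orbits are stable under place permutations. -/
theorem orbit_stable {I : Type u} {n : ℕ} (ω : Orbit I n) (i : Fin n → I) (hi : i ∈ ω.orbit)
    (w : Equiv.Perm (Fin n)) : i ∘ w ∈ ω.orbit := by
  rw [MulAction.orbitRel.Quotient.mem_orbit] at hi ⊢
  rw [← hi]
  exact Quotient.sound' ⟨DomMulAct.mk w, rfl⟩

variable (K : Type v) [CommRing K] {I : Type u} (Γ : Quiver.{w} I)

/-- `H_n(Γ) = ⨁_α H_α(Γ)`, the sum over all orbits `α` of the symmetric group on `Iⁿ`. -/
abbrev TotalAlg (n : ℕ) : NonUnitalSubalgebra K (∀ ω : Orbit I n, Alg K Γ ω.orbit) :=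
  directSumAlg K fun ω : Orbit I n => Alg K Γ ω.orbit

/-- The grading of `H_n(Γ)`. -/
noncomputable def totalGrade (n : ℕ) : ℤ → Submodule K (TotalAlg K Γ n) :=
  directSumGrade K fun ω : Orbit I n => grade K Γ ω.orbit

/-- `H_n^Λ(Γ) = ⨁_α H_α^Λ(Γ)`, the sum over all orbits `α` of the symmetric group on `Iⁿ`. -/
abbrev CycTotalAlg (Λ : I → ℕ) (n : ℕ) :
    NonUnitalSubalgebra K (∀ ω : Orbit I n, CycAlg K Γ ω.orbit Λ) :=
  directSumAlg K fun ω : Orbit I n => CycAlg K Γ ω.orbit Λ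

/-- The grading of `H_n^Λ(Γ)`. -/
noncomputable def cycTotalGrade (Λ : I → ℕ) (n : ℕ) : ℤ → Submodule K (CycTotalAlg K Γ Λ n) :=
  directSumGrade K fun ω : Orbit I n => cycGrade K Γ ω.orbit Λ

end Total

/-! ### The right-hand sides -/

section Decomposition

/-- The vertex set `I^(j)` of the `j`-th part, for a partition of `I` given by `p : I → Fin d`. -/
abbrev part {I : Type u} {d : ℕ} (p : I → Fin d) (j : Fin d) : Set I := {i | p i = j}

/-- The tuples `(n_1, …, n_d)` of natural numbers with sum `n`. -/
abbrev Comp (d n : ℕ) : Type := {ν : Fin d → ℕ // ∑ j, ν j = n}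

/-- The index set of size `n! / (n_1! ⋯ n_d!)` for the matrices. -/
abbrev MatIdx {d n : ℕ} (ν : Comp d n) : Type := Fin (Nat.multinomial Finset.univ ν.1)

variable (K : Type v) [CommRing K]

/-- For algebras `B j m` (`1 ≤ j ≤ d`, `m ≥ 0`), the algebra
`⨁_{n_1 + … + n_d = n} Mat_{n! / (n_1! ⋯ n_d!)} (⨂_j B j n_j)`. -/
abbrev MatSum {d : ℕ} (B : Fin d → ℕ → Type*) [∀ j m, NonUnitalSemiring (B j m)]
    [∀ j m, Module K (B j m)] [∀ j m, SMulCommClass K (B j m) (B j m)]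
    [∀ j m, IsScalarTower K (B j m) (B j m)] (n : ℕ) :=
  directSumAlg K fun ν : Comp d n =>
    Matrix (MatIdx ν) (MatIdx ν) (⨂[K] j : Fin d, B j (ν.1 j))

/-- The grading of `MatSum` induced by gradings of the algebras `B j m`. -/
noncomputable def matSumGrade {d : ℕ} {B : Fin d → ℕ → Type*} [∀ j m, NonUnitalSemiring (B j m)]
    [∀ j m, Module K (B j m)] [∀ j m, SMulCommClass K (B j m) (B j m)]
    [∀ j m, IsScalarTower K (B j m) (B j m)] (ℬ : ∀ j m, ℤ → Submodule K (B j m)) (n : ℕ) :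
    ℤ → Submodule K (MatSum K B n) :=
  directSumGrade K fun ν : Comp d n => matrixGrade K (MatIdx ν) <|
    tensorGrade K fun j : Fin d => ℬ j (ν.1 j)

variable {I : Type u} (Γ : Quiver.{w} I) {d : ℕ} (p : I → Fin d)

/-- The grading of `⨁_{n_1 + … + n_d = n} Mat_{n! / (n_1! ⋯ n_d!)} (⨂_j H_{n_j}(Γ^(j)))`. -/
noncomputable def decompGrade (n : ℕ) :
    ℤ → Submodule K (MatSum K (fun j m => TotalAlg K (Γ.fullSub (part p j)) m) n) :=
  matSumGrade K (fun j m => totalGrade K (Γ.fullSub (part p j)) m) n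

/-- The grading of `⨁_{n_1 + … + n_d = n} Mat_{n! / (n_1! ⋯ n_d!)} (⨂_j H_{n_j}^{Λ^(j)}(Γ^(j)))`,
where `Λ^(j)` is the restriction of `Λ` to `I^(j)`. -/
noncomputable def cycDecompGrade (Λ : I → ℕ) (n : ℕ) :
    ℤ → Submodule K (MatSum K
      (fun j m => CycTotalAlg K (Γ.fullSub (part p j)) (fun i : part p j => Λ i.1) m) n) :=
  matSumGrade K
    (fun j m => cycTotalGrade K (Γ.fullSub (part p j)) (fun i : part p j => Λ i.1) m) n

end Decomposition

end QuiverHecke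

/-! Call the part containing a vertex its colour. If two neighbouring letters of a tuple have
different colours, no arrow joins them, so `Q = 1` and `ψ_b` has degree `0` there: it squares to the
identity, passes every `y_a` without correction, and satisfies the braid relation exactly unless all
three letters have one colour. Letters of different colours can thus be moved past each other by
invertible elements of degree `0`, and only the interaction of letters of equal colour remains.

An orbit of tuples amounts to a composition `ν` of `n` and an orbit of words of length `ν j` in each
part (`orbitEquiv`), and a tuple in it amounts to a shuffle and a family of words. Summing the
idempotents with a given shuffle `s` gives orthogonal idempotents `shuffleE s` with sum `1`. Let
`s₀` be the shuffle with sorted colours. Products of the `ψ_b` along a sorting of `s` give `tau s`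
and `tauInv s`, which identify `shuffleE s` with `shuffleE s₀`. Hence a block is a matrix algebra,
with rows indexed by the `n! / ∏ (ν j)!` shuffles, over the corner at `s₀`. There each colour
occupies an interval of places, and the corner is the tensor product of the algebras of the parts.

The proof compares maps defined by generators and relations; no basis is needed.
`BlockRep.isRep_matrix` checks the relations for explicit matrices over the tensor product and
yields a homomorphism `Φ`. `IsRep.isRep_corner` and `IsRep.cornerGen_comm` yield a homomorphism `ι`
from the tensor product to the corner. The linear map `matrixToAlg`, which sends `M` to `∑ tau s * ι
(M s t) * tauInv t`, is compatible with left multiplication by generators thanks to `y_mul_tau`,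
`psi_mul_tau_of_ne` and `psi_mul_tau_of_eq`, so it is a left inverse of `Φ`; surjectivity of `Φ` is
checked on generators. Both maps preserve degrees because `tau` and `tauInv` have degree `0`.

All this is done for quotients `q j` and `qB` of the algebras, so it covers the cyclotomic case once
the cyclotomic relations are matched: the letter at the first place is the first letter of its word,
and conversely `tau` can carry the first letter of any word to the first place. At the end the
blocks are assembled, matrices and tensor products being distributed over direct sums. -/

namespace QuiverHecke

universe u v w

/-! ### Shuffles -/

section Shuffle

variable {d n : ℕ} {ν : Fin d → ℕ}

/-- The ways to interleave `d` words of lengths `ν 0, …, ν (d - 1)` into a word of length `n`: the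
place `a` holds the letter number `(s a).2` of the word number `(s a).1`. -/
abbrev Shuffle (n : ℕ) (ν : Fin d → ℕ) : Type :=
  {s : Fin n ≃ Σ j, Fin (ν j) // ∀ j, StrictMono fun r => s.symm ⟨j, r⟩}

noncomputable instance : Fintype (Shuffle n ν) := Fintype.ofFinite _

noncomputable instance : DecidableEq (Shuffle n ν) := Classical.decEq _

namespace Shuffle

/-- The colour of a place: the number of the word its letter comes from. -/
def color (s : Shuffle n ν) (a : Fin n) : Fin d := (s.1 a).1

/-- The letters of one word occupy the places of their colour in increasing order, and a strictly
monotone enumeration is determined by its range. -/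
theorem ext_color {s t : Shuffle n ν} (h : ∀ a, s.color a = t.color a) : s = t := by
  have key : ∀ j, (fun r => s.1.symm ⟨j, r⟩) = fun r => t.1.symm ⟨j, r⟩ := by
    intro j
    refine (StrictMono.range_inj (s.2 j) (t.2 j)).1 ?_
    have : ∀ s : Shuffle n ν, Set.range (fun r => s.1.symm ⟨j, r⟩) = {a | s.color a = j} := by
      intro s
      ext a
      constructor
      · rintro ⟨r, rfl⟩
        simp [color]
      · rintro rfl
        exact ⟨(s.1 a).2, by simp [color]⟩
    rw [this, this]
    ext a
    simp [h]
  apply Subtype.ext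
  rw [← Equiv.symm_bijective.injective.eq_iff]
  ext1 ⟨j, r⟩
  exact congrFun (key j) r

/-- Sorting the places of each word separately does it. Together with `sort_injective` this is the
factorisation of a permutation through coset representatives of a Young subgroup, the shuffles being
the representatives. -/
theorem exists_sort (e : Fin n ≃ Σ j, Fin (ν j)) :
    ∃ (s : Shuffle n ν) (π : ∀ j, Equiv.Perm (Fin (ν j))),
      e = s.1.trans (Equiv.sigmaCongrRight π) := by
  let π : ∀ j, Equiv.Perm (Fin (ν j)) := fun j => Tuple.sort fun r => e.symm ⟨j, r⟩
  refine ⟨⟨e.trans (Equiv.sigmaCongrRight π).symm, fun j => ?_⟩, π, ?_⟩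
  · refine Monotone.strictMono_of_injective
      (Tuple.monotone_sort fun r => e.symm ⟨j, r⟩) fun r r' h => ?_
    have := e.symm.injective h
    simpa using this
  · rw [Equiv.trans_assoc]
    simp

theorem sort_injective :
    Function.Injective fun x : Shuffle n ν × (∀ j, Equiv.Perm (Fin (ν j))) =>
      x.1.1.trans (Equiv.sigmaCongrRight x.2) := by
  rintro ⟨s, π⟩ ⟨t, ρ⟩ h
  have h' : ∀ a, (⟨(s.1 a).1, π _ (s.1 a).2⟩ : Σ j, Fin (ν j)) = ⟨(t.1 a).1, ρ _ (t.1 a).2⟩ :=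
    fun a => congrArg (fun e => e a) h
  have hst : s = t := ext_color fun a => congrArg (fun x => x.1) (h' a)
  subst hst
  refine Prod.ext rfl ?_
  funext j
  ext1 r
  have := h' (s.1.symm ⟨j, r⟩)
  rw [Equiv.apply_symm_apply] at this
  simpa using this

/-- The factorisation counts the `n!` bijections as the number of shuffles times `∏ (ν j)!`. -/
theorem card_eq (hν : ∑ j, ν j = n) :
    Fintype.card (Shuffle n ν) = Nat.multinomial Finset.univ ν := by
  have h1 : Fintype.card (Shuffle n ν × (∀ j, Equiv.Perm (Fin (ν j)))) =
      Fintype.card (Fin n ≃ Σ j, Fin (ν j)) := by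
    refine Fintype.card_of_bijective ⟨sort_injective, fun e => ?_⟩
    obtain ⟨s, π, h⟩ := exists_sort e
    exact ⟨(s, π), h.symm⟩
  have e : Fin n ≃ Σ j, Fin (ν j) := Fintype.equivOfCardEq (by simp [hν])
  rw [Fintype.card_equiv e, Fintype.card_prod, Fintype.card_pi] at h1
  simp only [Fintype.card_perm, Fintype.card_fin] at h1
  have h2 := Nat.multinomial_spec Finset.univ ν
  rw [hν, ← h1, mul_comm] at h2
  exact (Nat.eq_of_mul_eq_mul_right (Finset.prod_pos fun j _ => Nat.factorial_pos _) h2).symm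

theorem exists_color_eq (e : Fin n ≃ Σ j, Fin (ν j)) :
    ∃ s : Shuffle n ν, ∀ a, s.color a = (e a).1 := by
  obtain ⟨s, π, rfl⟩ := exists_sort e
  exact ⟨s, fun a => rfl⟩

theorem exists_monotone (hν : ∑ j, ν j = n) : ∃ s : Shuffle n ν, Monotone s.color := by
  have e : Fin n ≃ Σ j, Fin (ν j) := Fintype.equivOfCardEq (by simp [hν])
  obtain ⟨s, hs⟩ := exists_color_eq ((Tuple.sort fun a => (e a).1).trans e)
  refine ⟨s, ?_⟩
  rw [show s.color = _ from funext hs]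
  exact Tuple.monotone_sort fun a => (e a).1

/-- The two colour words are rearrangements of each other, and a tuple has only one monotone
rearrangement. -/
theorem eq_of_monotone {s t : Shuffle n ν} (hs : Monotone s.color) (ht : Monotone t.color) :
    s = t := by
  refine ext_color fun a => ?_
  have h := Tuple.unique_monotone (f := s.color) (σ := 1) (τ := t.1.trans s.1.symm)
    (by simpa using hs) (by
      have : s.color ∘ t.1.trans s.1.symm = t.color := by
        funext a
        simp [color]
      rwa [this])
  simpa [color] using congrFun h a

theorem symm_lt_symm {s : Shuffle n ν} {j : Fin d} {r r' : Fin (ν j)} :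
    s.1.symm ⟨j, r⟩ < s.1.symm ⟨j, r'⟩ ↔ r < r' :=
  (s.2 j).lt_iff_lt

/-- Needed for the cyclotomic relations, which concern the first place only. A swap brings colour
`j` to the first place; the letter there has number `0`, since a letter with a smaller number would
need a smaller place. -/
theorem exists_apply_zero (hν : ∑ j, ν j = n) (hn : 0 < n) (j : Fin d) (hj : 0 < ν j) :
    ∃ s : Shuffle n ν, s.1 ⟨0, hn⟩ = ⟨j, ⟨0, hj⟩⟩ := by
  have e : Fin n ≃ Σ j, Fin (ν j) := Fintype.equivOfCardEq (by simp [hν])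
  obtain ⟨s, hs⟩ :=
    exists_color_eq ((Equiv.swap ⟨0, hn⟩ (e.symm ⟨j, ⟨0, hj⟩⟩)).trans e)
  refine ⟨s, ?_⟩
  have h1 : s.color ⟨0, hn⟩ = j := by rw [hs]; simp
  obtain ⟨r, hr⟩ : ∃ r, s.1 ⟨0, hn⟩ = ⟨j, r⟩ := by
    subst h1
    exact ⟨_, rfl⟩
  rw [hr]
  congr 1
  by_contra hne
  have : (⟨0, hj⟩ : Fin (ν j)) < r := by
    rw [Fin.lt_def]
    have : (r : ℕ) ≠ 0 := fun h => hne (Fin.ext h)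
    simp only
    omega
  rw [← symm_lt_symm (s := s), ← hr, Equiv.symm_apply_apply, Fin.lt_def] at this
  simp at this

end Shuffle

/-! ### Adjacent transpositions of places -/

theorem lo_lt_hi (b : Fin (n - 1)) : lo b < hi b := by simp [lo, hi, Fin.lt_def]

theorem lo_ne_hi (b : Fin (n - 1)) : lo b ≠ hi b := (lo_lt_hi b).ne

@[simp] theorem r_lo (b : Fin (n - 1)) : r b (lo b) = hi b := Equiv.swap_apply_left _ _

@[simp] theorem r_hi (b : Fin (n - 1)) : r b (hi b) = lo b := Equiv.swap_apply_right _ _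

theorem r_of_ne {b : Fin (n - 1)} {a : Fin n} (h1 : a ≠ lo b) (h2 : a ≠ hi b) : r b a = a :=
  Equiv.swap_apply_of_ne_of_ne h1 h2

@[simp] theorem r_r (b : Fin (n - 1)) (a : Fin n) : r b (r b a) = a := Equiv.swap_apply_self _ _ _

theorem r_symm (b : Fin (n - 1)) : (r b).symm = r b := Equiv.symm_swap _ _

theorem hi_eq_lo {b c : Fin (n - 1)} (h : (c : ℕ) = b + 1) : hi b = lo c :=
  Fin.ext h.symm

theorem lo_ne_hi_succ {b c : Fin (n - 1)} (h : (c : ℕ) = b + 1) : lo b ≠ hi c := by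
  simp only [ne_eq, Fin.ext_iff, lo, hi, h]
  omega

theorem r_braid {b c : Fin (n - 1)} (h : (c : ℕ) = b + 1) :
    r c * r b * r c = r b * r c * r b := by
  have h1 : lo b ≠ lo c := hi_eq_lo h ▸ lo_ne_hi b
  unfold r
  rw [hi_eq_lo h, Equiv.swap_mul_swap_mul_swap h1 (lo_ne_hi_succ h), Equiv.swap_comm (lo b) (lo c),
    Equiv.swap_comm (lo c) (hi c),
    Equiv.swap_mul_swap_mul_swap (lo_ne_hi c).symm (lo_ne_hi_succ h).symm, Equiv.swap_comm]

/-- The swapped pair is the only one whose order is reversed, so exchanging neighbours of different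
colours preserves the order inside every word. -/
theorem r_lt_r {b : Fin (n - 1)} {a a' : Fin n} (h : a < a') (hne : ¬(a = lo b ∧ a' = hi b)) :
    r b a < r b a' := by
  unfold r
  rw [Equiv.swap_apply_def, Equiv.swap_apply_def]
  simp only [Fin.ext_iff, lo, hi, Fin.lt_def] at *
  split_ifs <;> simp <;> omega

namespace Shuffle

/-- The shuffle with the letters at the places `b` and `b + 1` interchanged if they have different
colours. -/
def step (b : Fin (n - 1)) (s : Shuffle n ν) : Shuffle n ν :=
  if h : s.color (lo b) = s.color (hi b) then s else
    ⟨(r b).trans s.1, fun j x y hxy => by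
      simp only [Equiv.symm_trans_apply, r_symm]
      refine r_lt_r (s.2 j hxy) fun h' => h ?_
      rw [← h'.1, ← h'.2]
      simp [color]⟩

theorem step_of_eq {b : Fin (n - 1)} {s : Shuffle n ν} (h : s.color (lo b) = s.color (hi b)) :
    s.step b = s := dif_pos h

theorem step_val {b : Fin (n - 1)} {s : Shuffle n ν} (h : s.color (lo b) ≠ s.color (hi b)) :
    (s.step b).1 = (r b).trans s.1 := by
  rw [step, dif_neg h]

theorem step_apply {b : Fin (n - 1)} {s : Shuffle n ν} (h : s.color (lo b) ≠ s.color (hi b))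
    (a : Fin n) : (s.step b).1 a = s.1 (r b a) := by
  rw [step_val h]; rfl

/-- The action of `r b` on colours needs no case distinction. -/
theorem color_step (b : Fin (n - 1)) (s : Shuffle n ν) (a : Fin n) :
    (s.step b).color a = s.color (r b a) := by
  by_cases h : s.color (lo b) = s.color (hi b)
  · rw [step_of_eq h]
    by_cases h1 : a = lo b
    · rw [h1, r_lo, h]
    by_cases h2 : a = hi b
    · rw [h2, r_hi, h]
    rw [r_of_ne h1 h2]
  · simp [color, step_apply h]

-- Since colours determine a shuffle, `color_step` lets the steps inherit the relations of the
-- transpositions `r b`: here the quadratic one, then commutation and braid.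
@[simp] theorem step_step (b : Fin (n - 1)) (s : Shuffle n ν) : (s.step b).step b = s :=
  ext_color fun a => by simp [color_step]

theorem step_comm {a b : Fin (n - 1)} (h : (a : ℕ) + 1 < b ∨ (b : ℕ) + 1 < a) (s : Shuffle n ν) :
    (s.step a).step b = (s.step b).step a :=
  ext_color fun x => by
    simp only [color_step]
    congr 1
    refine DFunLike.congr_fun (Equiv.Perm.Disjoint.commute (?_ : (r a).Disjoint (r b))).eq x
    refine Equiv.Perm.disjoint_swap_swap ?_
    simp only [List.nodup_cons, List.mem_cons, Fin.ext_iff, lo, hi, List.not_mem_nil, or_false,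
      not_or, List.nodup_nil, not_false_eq_true, and_true]
    omega

theorem step_braid {b c : Fin (n - 1)} (h : (c : ℕ) = b + 1) (s : Shuffle n ν) :
    ((s.step c).step b).step c = ((s.step b).step c).step b :=
  ext_color fun x => by
    simp only [color_step]
    congr 1
    exact DFunLike.congr_fun (r_braid h) x

/-- Neighbouring letters of the same colour are consecutive. -/
theorem exists_consecutive {b : Fin (n - 1)} {s : Shuffle n ν}
    (h : s.color (lo b) = s.color (hi b)) :
    ∃ (j : Fin d) (c : Fin (ν j - 1)), s.1 (lo b) = ⟨j, lo c⟩ ∧ s.1 (hi b) = ⟨j, hi c⟩ := by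
  obtain ⟨j, x, hx⟩ : ∃ j x, s.1 (lo b) = ⟨j, x⟩ := ⟨_, _, rfl⟩
  obtain ⟨y, hy⟩ : ∃ y, s.1 (hi b) = ⟨j, y⟩ := by
    have : s.color (hi b) = j := by rw [← h, color, hx]
    subst this
    exact ⟨_, rfl⟩
  have h1 : s.1.symm ⟨j, x⟩ = lo b := by rw [← hx, Equiv.symm_apply_apply]
  have h2 : s.1.symm ⟨j, y⟩ = hi b := by rw [← hy, Equiv.symm_apply_apply]
  have hxy : x < y := by
    rw [← symm_lt_symm (s := s), h1, h2]
    exact lo_lt_hi b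
  -- A letter of the same word between these two would have to sit strictly between two neighbouring
  -- places.
  have h3 : (y : ℕ) = x + 1 := by
    by_contra hne
    have hz : (x : ℕ) + 1 < y := by
      have := Fin.lt_def.1 hxy
      omega
    let z : Fin (ν j) := ⟨x + 1, by omega⟩
    have hxz : s.1.symm ⟨j, x⟩ < s.1.symm ⟨j, z⟩ := symm_lt_symm.2 (by simp [z, Fin.lt_def])
    have hzy : s.1.symm ⟨j, z⟩ < s.1.symm ⟨j, y⟩ := symm_lt_symm.2 (by simpa [z, Fin.lt_def])
    rw [h1] at hxz
    rw [h2] at hzy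
    simp only [lo, hi, Fin.lt_def] at hxz hzy
    omega
  refine ⟨j, ⟨x, by omega⟩, ?_, ?_⟩
  · rw [hx]; rfl
  · rw [hy]
    congr 1
    exact Fin.ext h3

/-- In a sorted shuffle, consecutive letters are neighbours. -/
theorem exists_neighbour {s : Shuffle n ν} (hs : Monotone s.color) (j : Fin d)
    (c : Fin (ν j - 1)) :
    ∃ b : Fin (n - 1), s.1 (lo b) = ⟨j, lo c⟩ ∧ s.1 (hi b) = ⟨j, hi c⟩ := by
  have h1 : s.1.symm ⟨j, lo c⟩ < s.1.symm ⟨j, hi c⟩ := symm_lt_symm.2 (lo_lt_hi c)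
  have h2 : (s.1.symm ⟨j, hi c⟩ : ℕ) = s.1.symm ⟨j, lo c⟩ + 1 := by
    by_contra hne
    rw [Fin.lt_def] at h1
    let a : Fin n := ⟨s.1.symm ⟨j, lo c⟩ + 1, by omega⟩
    have ha1 : s.1.symm ⟨j, lo c⟩ < a := by simp [a, Fin.lt_def]
    have ha2 : a < s.1.symm ⟨j, hi c⟩ := by
      simp only [a, Fin.lt_def]
      omega
    have hj1 := hs ha1.le
    have hj2 := hs ha2.le
    simp only [color, Equiv.apply_symm_apply] at hj1 hj2
    -- Monotonicity squeezes the colour of the intermediate place `a` to `j`, so its letter would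
    -- lie strictly between the numbers `c` and `c + 1`.
    obtain ⟨z, hz⟩ : ∃ z, s.1 a = ⟨j, z⟩ := by
      have : (s.1 a).1 = j := le_antisymm hj2 hj1
      exact ⟨this ▸ (s.1 a).2, Sigma.ext this (by simp)⟩
    have ha : a = s.1.symm ⟨j, z⟩ := by rw [← hz, Equiv.symm_apply_apply]
    rw [ha] at ha1 ha2
    rw [symm_lt_symm] at ha1 ha2
    simp only [lo, hi, Fin.lt_def] at ha1 ha2
    omega
  refine ⟨⟨s.1.symm ⟨j, lo c⟩, by omega⟩, ?_, ?_⟩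
  · rw [← Equiv.eq_symm_apply]
    rfl
  · rw [← Equiv.eq_symm_apply]
    exact Fin.ext h2.symm

theorem monotone_of_no_descent {s : Shuffle n ν}
    (h : ∀ b : Fin (n - 1), s.color (lo b) ≤ s.color (hi b)) : Monotone s.color := by
  cases n with
  | zero => exact fun a => a.elim0
  | succ m =>
    rw [Fin.monotone_iff_le_succ]
    intro i
    exact h ⟨i, by omega⟩

/-- The lexicographic order of colour words serves as the induction measure, in the role of the
length of a permutation: `lo b` is the first place that changes when a descent is removed. -/
theorem step_lex_lt {b : Fin (n - 1)} {s : Shuffle n ν} (h : s.color (hi b) < s.color (lo b)) :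
    toLex (s.step b).color < toLex s.color := by
  refine ⟨lo b, fun a ha => ?_, ?_⟩
  · simp only [Pi.toLex_apply]
    rw [color_step, r_of_ne ha.ne (ha.trans (lo_lt_hi b)).ne]
  · simp only [Pi.toLex_apply]
    rw [color_step, r_lo]
    exact h

instance : WellFoundedRelation (Shuffle n ν) :=
  ⟨fun s t => toLex s.color < toLex t.color, InvImage.wf _ wellFounded_lt⟩

theorem lex_induction {P : Shuffle n ν → Prop}
    (h : ∀ s, (∀ t : Shuffle n ν, toLex t.color < toLex s.color → P t) → P s)
    (s : Shuffle n ν) : P s :=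
  WellFoundedRelation.wf.induction s h

end Shuffle

end Shuffle

end QuiverHecke

/-! ### The polynomials `Q`: ring homomorphisms, full subquivers, pairs of vertices without arrows
-/

namespace Quiver

universe u w

variable {I : Type u} (Γ : Quiver.{w} I)

theorem map_polyQ (i j : I) {A B F : Type*} [Ring A] [Ring B] [FunLike F A B]
    [RingHomClass F A B] (f : F) (u v : A) : f (Γ.polyQ i j u v) = Γ.polyQ i j (f u) (f v) := by
  unfold polyQ
  split_ifs <;> simp

theorem map_dividedQ (i j : I) {A B F : Type*} [Ring A] [Ring B] [FunLike F A B]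
    [RingHomClass F A B] (f : F) (u v w : A) :
    f (Γ.dividedQ i j u v w) = Γ.dividedQ i j (f u) (f v) (f w) := by
  unfold dividedQ
  split_ifs <;> simp

theorem polyQ_fullSub (s : Set I) (i j : s) {A : Type*} [Ring A] (u v : A) :
    (Γ.fullSub s).polyQ i j u v = Γ.polyQ i.1 j.1 u v := by
  unfold polyQ
  split_ifs with h1 h2 h2
  · rfl
  · exact absurd (congrArg Subtype.val h1) h2
  · exact absurd (Subtype.ext h2) h1
  · rfl

theorem dividedQ_fullSub (s : Set I) (i j : s) {A : Type*} [Ring A] (u v w : A) :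
    (Γ.fullSub s).dividedQ i j u v w = Γ.dividedQ i.1 j.1 u v w := by
  unfold dividedQ
  split_ifs with h1 h2 h2
  · rfl
  · exact absurd (congrArg Subtype.val h1) h2
  · exact absurd (Subtype.ext h2) h1
  · rfl

theorem dDeg_fullSub (s : Set I) (i j : s) : (Γ.fullSub s).dDeg i j = Γ.dDeg i.1 j.1 := by
  unfold dDeg
  split_ifs with h1 h2 h2
  · rfl
  · exact absurd (congrArg Subtype.val h1) h2
  · exact absurd (Subtype.ext h2) h1
  · rfl

section NoArrows

variable {Γ} {i j : I} (hij : i ≠ j) (h1 : IsEmpty (Γ.Hom i j)) (h2 : IsEmpty (Γ.Hom j i))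

include h1 h2 in
theorem dot_eq_zero_of_isEmpty : Γ.dot i j = 0 := by
  simp [dot, arrowCount]

include hij h1 h2

/-- Both exponents are zero. This and the next two facts are the only input from the absence of
arrows between the parts. -/
theorem polyQ_of_isEmpty {A : Type*} [Ring A] (u v : A) : Γ.polyQ i j u v = 1 := by
  rw [polyQ, if_neg hij, dot_eq_zero_of_isEmpty h1 h2]
  simp [arrowCount]

theorem dividedQ_of_isEmpty {A : Type*} [Ring A] (u v w : A) : Γ.dividedQ i j u v w = 0 := by
  rw [dividedQ, if_neg hij, dot_eq_zero_of_isEmpty h1 h2]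
  simp

theorem dDeg_of_isEmpty : Γ.dDeg i j = 0 := by
  rw [dDeg, if_neg hij, dot_eq_zero_of_isEmpty h1 h2]
  rfl

end NoArrows

end Quiver

namespace QuiverHecke

universe u v w

/-! ### Families that satisfy the relations of the quiver Hecke algebra -/

section IsRep

theorem map_finsum_of_finite {ι A B F : Type*} [Finite ι] [AddCommMonoid A] [AddCommMonoid B]
    [FunLike F A B] [AddMonoidHomClass F A B] (f : F) (x : ι → A) :
    f (∑ᶠ i, x i) = ∑ᶠ i, f (x i) := by
  have := Fintype.ofFinite ι
  simp only [finsum_eq_sum_of_fintype, map_sum]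

variable (K : Type v) [CommRing K] {I : Type u} (Γ : Quiver.{w} I) {n : ℕ} (α : Set (Fin n → I))
  [Finite α]

/-- The elements `y`, `ψ`, `e` of a ring satisfy the relations of the quiver Hecke algebra. -/
structure IsRep {C : Type*} [Ring C] (y : Fin n → C) (ψ : Fin (n - 1) → C) (e : α → C) : Prop where
  sum_e : ∑ᶠ i : α, e i = 1
  e_mul_self (i : α) : e i * e i = e i
  e_mul_ne (i j : α) (h : i ≠ j) : e i * e j = 0
  y_mul_y (a b : Fin n) : y a * y b = y b * y a
  y_mul_e (a : Fin n) (i : α) : y a * e i = e i * y a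
  psi_mul_e (b : Fin (n - 1)) (i j : α) (h : j.1 = i.1 ∘ r b) : ψ b * e i = e j * ψ b
  psi_mul_y_lo (b : Fin (n - 1)) (i : α) (h : i.1 (lo b) = i.1 (hi b)) :
    (ψ b * y (lo b) - y (hi b) * ψ b) * e i = -e i
  psi_mul_y_hi (b : Fin (n - 1)) (i : α) (h : i.1 (lo b) = i.1 (hi b)) :
    (ψ b * y (hi b) - y (lo b) * ψ b) * e i = e i
  psi_mul_y (b : Fin (n - 1)) (a : Fin n) (i : α)
    (h : ¬((a = lo b ∨ a = hi b) ∧ i.1 (lo b) = i.1 (hi b))) :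
    (ψ b * y a - y (r b a) * ψ b) * e i = 0
  psi_mul_psi (a b : Fin (n - 1)) (h : (a : ℕ) + 1 < b ∨ (b : ℕ) + 1 < a) :
    ψ a * ψ b = ψ b * ψ a
  psi_sq (b : Fin (n - 1)) (i : α) :
    ψ b * ψ b * e i = Γ.polyQ (i.1 (lo b)) (i.1 (hi b)) (y (lo b)) (y (hi b)) * e i
  braid_eq (b c : Fin (n - 1)) (hc : (c : ℕ) = b + 1) (i : α) (h : i.1 (lo b) = i.1 (hi c)) :
    (ψ c * ψ b * ψ c - ψ b * ψ c * ψ b) * e i =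
      Γ.dividedQ (i.1 (lo b)) (i.1 (hi b)) (y (lo b)) (y (hi b)) (y (hi c)) * e i
  braid_ne (b c : Fin (n - 1)) (hc : (c : ℕ) = b + 1) (i : α) (h : i.1 (lo b) ≠ i.1 (hi c)) :
    (ψ c * ψ b * ψ c - ψ b * ψ c * ψ b) * e i = 0

theorem isRep_gen : IsRep Γ α (fun a => gen K Γ α (Gen.y a)) (fun b => gen K Γ α (Gen.psi b))
    (fun i => gen K Γ α (Gen.e i)) := by
  have key : ∀ {x z}, Rel K Γ α x z →
      RingQuot.mkAlgHom K (Rel K Γ α) x = RingQuot.mkAlgHom K (Rel K Γ α) z := fun h => RingQuot.mkAlgHom_rel K h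
  constructor
  · have := key Rel.sum_e
    rwa [map_finsum_of_finite, map_one] at this
  · intro i; simpa only [gen, map_mul] using key (Rel.e_mul_self i)
  · intro i j h; simpa only [gen, map_mul, map_zero] using key (Rel.e_mul_ne i j h)
  · intro a b; simpa only [gen, map_mul] using key (Rel.y_mul_y a b)
  · intro a i; simpa only [gen, map_mul] using key (Rel.y_mul_e a i)
  · intro b i j h; simpa only [gen, map_mul] using key (Rel.psi_mul_e b i j h)
  · intro b i h
    simpa only [gen, map_mul, map_sub, map_neg] using key (Rel.psi_mul_y_lo b i h)
  · intro b i h; simpa only [gen, map_mul, map_sub] using key (Rel.psi_mul_y_hi b i h)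
  · intro b a i h
    simpa only [gen, map_mul, map_sub, map_zero] using key (Rel.psi_mul_y b a i h)
  · intro a b h; simpa only [gen, map_mul] using key (Rel.psi_mul_psi a b h)
  · intro b i
    simpa only [gen, map_mul, Quiver.map_polyQ] using key (Rel.psi_sq b i)
  · intro b c hc i h
    simpa only [gen, map_mul, map_sub, Quiver.map_dividedQ] using key (Rel.braid_eq b c hc i h)
  · intro b c hc i h
    simpa only [gen, map_mul, map_sub, map_zero] using key (Rel.braid_ne b c hc i h)

variable {K Γ α} {C : Type*} [Ring C]

section

variable {y : Fin n → C} {ψ : Fin (n - 1) → C} {e : α → C}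

theorem IsRep.map (h : IsRep Γ α y ψ e) {D F : Type*} [Ring D] [FunLike F C D] [RingHomClass F C D]
    (f : F) : IsRep Γ α (fun a => f (y a)) (fun b => f (ψ b)) (fun i => f (e i)) where
  sum_e := by
    have := congrArg f h.sum_e
    rwa [map_finsum_of_finite, map_one] at this
  e_mul_self i := by rw [← map_mul, h.e_mul_self]
  e_mul_ne i j hij := by rw [← map_mul, h.e_mul_ne i j hij, map_zero]
  y_mul_y a b := by rw [← map_mul, h.y_mul_y, map_mul]
  y_mul_e a i := by rw [← map_mul, h.y_mul_e, map_mul]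
  psi_mul_e b i j hij := by rw [← map_mul, h.psi_mul_e b i j hij, map_mul]
  psi_mul_y_lo b i hi := by
    simpa only [map_mul, map_sub, map_neg] using congrArg f (h.psi_mul_y_lo b i hi)
  psi_mul_y_hi b i hi := by
    simpa only [map_mul, map_sub] using congrArg f (h.psi_mul_y_hi b i hi)
  psi_mul_y b a i hi := by
    simpa only [map_mul, map_sub, map_zero] using congrArg f (h.psi_mul_y b a i hi)
  psi_mul_psi a b hab := by rw [← map_mul, h.psi_mul_psi a b hab, map_mul]
  psi_sq b i := by
    simpa only [map_mul, Quiver.map_polyQ] using congrArg f (h.psi_sq b i)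
  braid_eq b c hc i hi := by
    simpa only [map_mul, map_sub, Quiver.map_dividedQ] using congrArg f (h.braid_eq b c hc i hi)
  braid_ne b c hc i hi := by
    simpa only [map_mul, map_sub, map_zero] using congrArg f (h.braid_ne b c hc i hi)

/-- The values of a homomorphism on the generators. -/
def genFun (y : Fin n → C) (ψ : Fin (n - 1) → C) (e : α → C) : Gen α → C
  | Gen.y a => y a
  | Gen.psi b => ψ b
  | Gen.e i => e i

variable [Algebra K C]

variable (K) in
/-- The homomorphism defined by a family that satisfies the relations. -/
noncomputable def IsRep.lift (h : IsRep Γ α y ψ e) : Alg K Γ α →ₐ[K] C :=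
  RingQuot.liftAlgHom K ⟨FreeAlgebra.lift K (genFun y ψ e), by
    intro x z hxz
    cases hxz
    case sum_e =>
      rw [map_finsum_of_finite, map_one, ← h.sum_e]
      simp only [FreeAlgebra.lift_ι_apply, genFun]
    all_goals simp only [map_mul, map_sub, map_neg, map_zero, Quiver.map_polyQ,
      Quiver.map_dividedQ, FreeAlgebra.lift_ι_apply, genFun]
    case e_mul_self i => exact h.e_mul_self i
    case e_mul_ne i j hij => exact h.e_mul_ne i j hij
    case y_mul_y a b => exact h.y_mul_y a b
    case y_mul_e a i => exact h.y_mul_e a i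
    case psi_mul_e b i j hij => exact h.psi_mul_e b i j hij
    case psi_mul_y_lo b i hi => exact h.psi_mul_y_lo b i hi
    case psi_mul_y_hi b i hi => exact h.psi_mul_y_hi b i hi
    case psi_mul_y b a i hi => exact h.psi_mul_y b a i hi
    case psi_mul_psi a b hab => exact h.psi_mul_psi a b hab
    case psi_sq b i => exact h.psi_sq b i
    case braid_eq b c hc i hi => exact h.braid_eq b c hc i hi
    case braid_ne b c hc i hi => exact h.braid_ne b c hc i hi⟩

theorem IsRep.lift_gen (h : IsRep Γ α y ψ e) (g : Gen α) :
    h.lift K (gen K Γ α g) = genFun y ψ e g := by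
  rw [IsRep.lift, gen, RingQuot.liftAlgHom_mkAlgHom_apply, FreeAlgebra.lift_ι_apply]

@[simp] theorem IsRep.lift_y (h : IsRep Γ α y ψ e) (a : Fin n) :
    h.lift K (gen K Γ α (Gen.y a)) = y a := h.lift_gen _

@[simp] theorem IsRep.lift_e (h : IsRep Γ α y ψ e) (i : α) :
    h.lift K (gen K Γ α (Gen.e i)) = e i := h.lift_gen _

end

/-- The quiver Hecke algebra is generated by its generators. -/
theorem adjoin_gen : Algebra.adjoin K (Set.range (gen K Γ α)) = ⊤ := by
  have h : Set.range (gen K Γ α) =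
      RingQuot.mkAlgHom K (Rel K Γ α) '' Set.range (FreeAlgebra.ι K) := by
    rw [← Set.range_comp]
    rfl
  rw [h, ← AlgHom.map_adjoin, FreeAlgebra.adjoin_range_ι, Algebra.map_top,
    AlgHom.range_eq_top]
  exact RingQuot.mkAlgHom_surjective K _

end IsRep

/-! ### Tuples that are shuffles of words in the parts -/

section Words

variable {I : Type u} {d n : ℕ} {p : I → Fin d} {ν : Fin d → ℕ}
  {α : ∀ j, Set (Fin (ν j) → part p j)}

/-- The letter of a family of words at a given position. -/
def letter (k : ∀ j, α j) (x : Σ j, Fin (ν j)) : I := ((k x.1).1 x.2).1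

theorem letter_mk (k : ∀ j, α j) (j : Fin d) (x : Fin (ν j)) : letter k ⟨j, x⟩ = ((k j).1 x).1 := rfl

theorem p_letter (k : ∀ j, α j) (x : Σ j, Fin (ν j)) : p (letter k x) = x.1 :=
  ((k x.1).1 x.2).2

/-- The tuple obtained by shuffling a family of words. -/
def tuple (s : Shuffle n ν) (k : ∀ j, α j) : Fin n → I := fun a => letter k (s.1 a)

theorem p_tuple (s : Shuffle n ν) (k : ∀ j, α j) (a : Fin n) : p (tuple s k a) = s.color a :=
  p_letter _ _

/-- The set `β` consists of the shuffles of words in the sets `α j`. -/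
structure IsShuffleSet (β : Set (Fin n → I)) (α : ∀ j, Set (Fin (ν j) → part p j)) : Prop where
  sum_eq : ∑ j, ν j = n
  mem_iff (i : Fin n → I) : i ∈ β ↔ ∃ (s : Shuffle n ν) (k : ∀ j, α j), tuple s k = i
  stable (j : Fin d) (i : Fin (ν j) → part p j) (hi : i ∈ α j) (w : Equiv.Perm (Fin (ν j))) :
    i ∘ w ∈ α j

/-- The parts containing the letters give the colours, hence the shuffle; the words can then be read
off along it. -/
theorem tuple_injective :
    Function.Injective fun x : Shuffle n ν × (∀ j, α j) => tuple x.1 x.2 := by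
  rintro ⟨s, k⟩ ⟨t, l⟩ h
  have h' : ∀ a, tuple s k a = tuple t l a := fun a => congrFun h a
  have hst : s = t := Shuffle.ext_color fun a => by
    rw [← p_tuple s k, ← p_tuple t l, h']
  subst hst
  refine Prod.ext rfl ?_
  funext j
  refine Subtype.ext (funext fun x => Subtype.ext ?_)
  have := h' (s.1.symm ⟨j, x⟩)
  simp only [tuple, Equiv.apply_symm_apply] at this
  exact this

namespace IsShuffleSet

variable {β : Set (Fin n → I)} (h : IsShuffleSet β α)

/-- A tuple in `β` amounts to a shuffle and a family of words. -/
noncomputable def idx : Shuffle n ν × (∀ j, α j) ≃ β :=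
  Equiv.ofBijective (fun x => ⟨tuple x.1 x.2, (h.mem_iff _).2 ⟨x.1, x.2, rfl⟩⟩)
    ⟨fun _ _ hxy => tuple_injective (congrArg Subtype.val hxy), fun i => by
      obtain ⟨s, k, hi⟩ := (h.mem_iff _).1 i.2
      exact ⟨(s, k), Subtype.ext hi⟩⟩

@[simp] theorem idx_val (x : Shuffle n ν × (∀ j, α j)) : (h.idx x).1 = tuple x.1 x.2 := rfl

theorem idx_surj (i : β) : ∃ s k, i = h.idx (s, k) :=
  ⟨(h.idx.symm i).1, (h.idx.symm i).2, (h.idx.apply_symm_apply i).symm⟩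

include h in
theorem finite_words [Finite β] (s : Shuffle n ν) : Finite (∀ j, α j) :=
  Finite.of_injective (fun k => h.idx (s, k)) fun _ _ hkl =>
    congrArg Prod.snd (h.idx.injective hkl)

/-- The family of words with the letters `c` and `c + 1` of the `j`-th word interchanged. -/
noncomputable def swapWord (j : Fin d) (c : Fin (ν j - 1)) (k : ∀ j, α j) : ∀ j, α j :=
  Function.update k j ⟨(k j).1 ∘ r c, h.stable j _ (k j).2 _⟩

@[simp] theorem swapWord_same (j : Fin d) (c : Fin (ν j - 1)) (k : ∀ j, α j) :
    (h.swapWord j c k j).1 = (k j).1 ∘ r c := by simp [swapWord]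

theorem swapWord_ne {j j' : Fin d} (hj : j' ≠ j) (c : Fin (ν j - 1)) (k : ∀ j, α j) :
    h.swapWord j c k j' = k j' := Function.update_of_ne hj _ _

@[simp] theorem swapWord_swapWord (j : Fin d) (c : Fin (ν j - 1)) (k : ∀ j, α j) :
    h.swapWord j c (h.swapWord j c k) = k := by
  funext j'
  by_cases hj : j' = j
  · subst hj
    refine Subtype.ext (funext fun x => ?_)
    simp
  · rw [h.swapWord_ne hj, h.swapWord_ne hj]

/-- A transposition acts on tuples in two ways: across colours it changes the shuffle and keeps the
words, as here; inside a colour it keeps the shuffle and changes one word, as in `idx_swapWord`. -/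
theorem idx_step {b : Fin (n - 1)} {s : Shuffle n ν} (hs : s.color (lo b) ≠ s.color (hi b))
    (k : ∀ j, α j) : (h.idx (s.step b, k)).1 = (h.idx (s, k)).1 ∘ r b := by
  funext a
  simp [tuple, Shuffle.step_apply hs]

end IsShuffleSet

theorem Shuffle.apply_r {s : Shuffle n ν} {b : Fin (n - 1)} {j : Fin d} {c : Fin (ν j - 1)}
    (h1 : s.1 (lo b) = ⟨j, lo c⟩) (h2 : s.1 (hi b) = ⟨j, hi c⟩) {a : Fin n} {x : Fin (ν j)}
    (ha : s.1 a = ⟨j, x⟩) : s.1 (r b a) = ⟨j, r c x⟩ := by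
  by_cases ha1 : a = lo b
  · subst ha1
    have : x = lo c := by rw [h1] at ha; simpa using ha.symm
    rw [r_lo, h2, this, r_lo]
  by_cases ha2 : a = hi b
  · subst ha2
    have : x = hi c := by rw [h2] at ha; simpa using ha.symm
    rw [r_hi, h1, this, r_hi]
  rw [r_of_ne ha1 ha2, ha, r_of_ne]
  · rintro rfl
    exact ha1 (s.1.injective (ha.trans h1.symm))
  · rintro rfl
    exact ha2 (s.1.injective (ha.trans h2.symm))

theorem Shuffle.apply_r_of_ne {s : Shuffle n ν} {b : Fin (n - 1)} {j : Fin d} {c : Fin (ν j - 1)}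
    (h1 : s.1 (lo b) = ⟨j, lo c⟩) (h2 : s.1 (hi b) = ⟨j, hi c⟩) {a : Fin n}
    (ha : s.color a ≠ j) : s.1 (r b a) = s.1 a := by
  rw [r_of_ne]
  · rintro rfl
    exact ha (by rw [Shuffle.color, h1])
  · rintro rfl
    exact ha (by rw [Shuffle.color, h2])

theorem IsShuffleSet.idx_swapWord {β : Set (Fin n → I)} (h : IsShuffleSet β α)
    {s : Shuffle n ν} {b : Fin (n - 1)} {j : Fin d} {c : Fin (ν j - 1)}
    (h1 : s.1 (lo b) = ⟨j, lo c⟩) (h2 : s.1 (hi b) = ⟨j, hi c⟩) (k : ∀ j, α j) :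
    (h.idx (s, h.swapWord j c k)).1 = (h.idx (s, k)).1 ∘ r b := by
  funext a
  simp only [idx_val, tuple, Function.comp_apply]
  by_cases hj : s.color a = j
  · obtain ⟨x, hx⟩ : ∃ x, s.1 a = ⟨j, x⟩ := by subst hj; exact ⟨_, rfl⟩
    rw [Shuffle.apply_r h1 h2 hx, hx]
    simp [letter]
  · rw [Shuffle.apply_r_of_ne h1 h2 hj, letter, letter, h.swapWord_ne (show (s.1 a).1 ≠ j from hj)]

end Words

/-! ### Matrices with one nonzero entry in each column -/

section Mono

variable {T A : Type*} [Fintype T] [DecidableEq T]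

/-- The matrix whose column `s` has the entry `c s` in the row `f s` and zeros elsewhere. -/
def colMatrix [Zero A] (f : T → T) (c : T → A) : Matrix T T A :=
  Matrix.of fun t s => if t = f s then c s else 0

omit [Fintype T] in
theorem colMatrix_apply [Zero A] (f : T → T) (c : T → A) (t s : T) :
    colMatrix f c t s = if t = f s then c s else 0 := rfl

variable [Ring A]

omit [Fintype T] in
theorem colMatrix_id (c : T → A) : colMatrix id c = Matrix.diagonal c := by
  ext t s
  by_cases h : t = s
  · subst h
    simp [colMatrix_apply]
  · simp [colMatrix_apply, h]

theorem colMatrix_mul_single (f : T → T) (c : T → A) (s t : T) (x : A) :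
    colMatrix f c * Matrix.single s t x = Matrix.single (f s) t (c s * x) := by
  ext u v
  rw [Matrix.mul_apply, Finset.sum_eq_single s]
  · by_cases h1 : u = f s <;> by_cases h2 : t = v <;>
      simp [colMatrix_apply, h1, h2, eq_comm]
  · intro w _ hw
    simp [hw.symm]
  · simp

/-- For an involution `f`, the only column with its entry in row `s` is `f s`. -/
theorem single_mul_colMatrix {f : T → T} (hf : Function.Involutive f) (c : T → A) (s t : T)
    (x : A) :
    Matrix.single t s x * colMatrix f c = Matrix.single t (f s) (x * c (f s)) := by
  ext u v
  rw [Matrix.mul_apply, Finset.sum_eq_single s]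
  · by_cases h2 : f s = v
    · subst h2
      by_cases h1 : t = u <;> simp [colMatrix_apply, h1, hf s]
    · have : s ≠ f v := fun h => h2 (by rw [h, hf v])
      simp [colMatrix_apply, Matrix.single_apply, h2, this]
  · intro w _ hw
    simp [hw.symm]
  · simp

theorem colMatrix_mul_colMatrix (f g : T → T) (c e : T → A) :
    colMatrix f c * colMatrix g e = colMatrix (f ∘ g) fun s => c (g s) * e s := by
  ext u v
  simp [colMatrix_apply, Matrix.mul_apply]

omit [Fintype T] in
theorem single_sub_single (s t : T) (x z : A) :
    Matrix.single s t x - Matrix.single s t z = Matrix.single s t (x - z) := by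
  exact ((Matrix.singleAddMonoidHom (α := A) s t).map_sub x z).symm

end Mono

/-! ### Matrix representations from commuting representations for the parts -/

section BlockRep

variable {I : Type u} (Γ : Quiver.{w} I) {d n : ℕ} {p : I → Fin d} {ν : Fin d → ℕ}
  {α : ∀ j, Set (Fin (ν j) → part p j)} {A : Type*} [Ring A]

/-- Commuting representations `Y j`, `P j`, `ε j` of the quiver Hecke algebras of the parts,
together with the products `E k` of the idempotents `ε j (k j)`. -/
structure BlockRep (hst : ∀ j, ∀ i ∈ α j, ∀ w : Equiv.Perm (Fin (ν j)), i ∘ w ∈ α j)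
    (Y : ∀ j, Fin (ν j) → A) (P : ∀ j, Fin (ν j - 1) → A) (ε : ∀ j, α j → A)
    (E : (∀ j, α j) → A) : Prop where
  rep (j : Fin d) : IsRep (Γ.fullSub (part p j)) (α j) (Y j) (P j) (ε j)
  sum_E : ∑ᶠ k, E k = 1
  E_mul_self (k : ∀ j, α j) : E k * E k = E k
  E_mul_ne (k l : ∀ j, α j) (h : k ≠ l) : E k * E l = 0
  e_mul_E (j : Fin d) (k : ∀ j, α j) : ε j (k j) * E k = E k
  Y_mul_E (j : Fin d) (a : Fin (ν j)) (k : ∀ j, α j) : Y j a * E k = E k * Y j a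
  P_mul_E (j : Fin d) (c : Fin (ν j - 1)) (k : ∀ j, α j) :
    P j c * E k = E (Function.update k j ⟨(k j).1 ∘ r c, hst j _ (k j).2 _⟩) * P j c
  Y_mul_Y (j j' : Fin d) (h : j ≠ j') (a : Fin (ν j)) (a' : Fin (ν j')) :
    Y j a * Y j' a' = Y j' a' * Y j a
  P_mul_Y (j j' : Fin d) (h : j ≠ j') (c : Fin (ν j - 1)) (a : Fin (ν j')) :
    P j c * Y j' a = Y j' a * P j c
  P_mul_P (j j' : Fin d) (h : j ≠ j') (c : Fin (ν j - 1)) (c' : Fin (ν j' - 1)) :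
    P j c * P j' c' = P j' c' * P j c

omit [Ring A] in
theorem Shuffle.exists_next {s : Shuffle n ν} {b c : Fin (n - 1)} (hc : (c : ℕ) = b + 1) {j : Fin d}
    {c₁ : Fin (ν j - 1)} (h2 : s.1 (hi b) = ⟨j, hi c₁⟩) (h : s.color (lo c) = s.color (hi c)) :
    ∃ c₂ : Fin (ν j - 1), s.1 (lo c) = ⟨j, lo c₂⟩ ∧ s.1 (hi c) = ⟨j, hi c₂⟩ ∧
      (c₂ : ℕ) = c₁ + 1 := by
  obtain ⟨j', c₂, h3, h4⟩ := Shuffle.exists_consecutive h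
  rw [hi_eq_lo hc, h3] at h2
  obtain rfl : j' = j := congrArg Sigma.fst h2
  refine ⟨c₂, h3, h4, ?_⟩
  have := congrArg Fin.val (eq_of_heq (Sigma.mk.inj h2).2)
  exact this

/-- The family `P`, indexed by positions. -/
def posP (P : ∀ j, Fin (ν j - 1) → A) (x : Σ j, Fin (ν j)) : A :=
  -- The last letter of a word has no successor. The value `0` is never met in `psiCoef`, because
  -- equal neighbouring colours mean consecutive letters.
  if h : (x.2 : ℕ) < ν x.1 - 1 then P x.1 ⟨x.2, h⟩ else 0

theorem posP_lo (P : ∀ j, Fin (ν j - 1) → A) (j : Fin d) (c : Fin (ν j - 1)) :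
    posP P ⟨j, lo c⟩ = P j c := dif_pos c.2

/-- The family `Y`, indexed by positions. -/
def posY (Y : ∀ j, Fin (ν j) → A) (x : Σ j, Fin (ν j)) : A := Y x.1 x.2

omit [Ring A] in
theorem posY_mk (Y : ∀ j, Fin (ν j) → A) (j : Fin d) (x : Fin (ν j)) : posY Y ⟨j, x⟩ = Y j x := rfl

/-- The coefficient with which `ψ_b` acts on the column of the shuffle `s`. -/
def psiCoef (P : ∀ j, Fin (ν j - 1) → A) (b : Fin (n - 1)) (s : Shuffle n ν) : A :=
  if s.color (lo b) = s.color (hi b) then posP P (s.1 (lo b)) else 1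

/-- The matrix by which `y_a` acts. -/
noncomputable def yMat (Y : ∀ j, Fin (ν j) → A) (a : Fin n) :
    Matrix (Shuffle n ν) (Shuffle n ν) A :=
  colMatrix id fun s => posY Y (s.1 a)

/-- The matrix by which `ψ_b` acts. -/
noncomputable def psiMat (P : ∀ j, Fin (ν j - 1) → A) (b : Fin (n - 1)) :
    Matrix (Shuffle n ν) (Shuffle n ν) A :=
  colMatrix (Shuffle.step b) (psiCoef P b)

/-- The matrix by which the idempotent of a tuple acts. -/
noncomputable def eMat {β : Set (Fin n → I)} (hβ : IsShuffleSet β α) (E : (∀ j, α j) → A) (i : β) :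
    Matrix (Shuffle n ν) (Shuffle n ν) A :=
  Matrix.single (hβ.idx.symm i).1 (hβ.idx.symm i).1 (E (hβ.idx.symm i).2)

theorem eMat_idx {β : Set (Fin n → I)} (hβ : IsShuffleSet β α) (E : (∀ j, α j) → A)
    (s : Shuffle n ν) (k : ∀ j, α j) : eMat hβ E (hβ.idx (s, k)) = Matrix.single s s (E k) := by
  simp [eMat]

variable {Y : ∀ j, Fin (ν j) → A} {P : ∀ j, Fin (ν j - 1) → A}

theorem psiCoef_of_ne {b : Fin (n - 1)} {s : Shuffle n ν}
    (h : s.color (lo b) ≠ s.color (hi b)) : psiCoef P b s = 1 := if_neg h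

theorem psiCoef_of_eq {b : Fin (n - 1)} {s : Shuffle n ν}
    (h : s.color (lo b) = s.color (hi b)) : psiCoef P b s = posP P (s.1 (lo b)) := if_pos h

theorem psiCoef_of_consecutive {b : Fin (n - 1)} {s : Shuffle n ν} {j : Fin d} {c : Fin (ν j - 1)}
    (h1 : s.1 (lo b) = ⟨j, lo c⟩) (h2 : s.1 (hi b) = ⟨j, hi c⟩) : psiCoef P b s = P j c := by
  rw [psiCoef_of_eq (by rw [Shuffle.color, Shuffle.color, h1, h2]), h1, posP_lo]

/-- Unless the three colours agree, at most one pair of them is equal. Both sides of the braid then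
meet that pair once, at the same letter, and every other crossing contributes `1`; no relation in
`A` is involved. -/
theorem psiCoef_braid_of_color {b c : Fin (n - 1)} (hc : (c : ℕ) = b + 1) (s : Shuffle n ν)
    (hs : ¬(s.color (lo b) = s.color (lo c) ∧ s.color (lo c) = s.color (hi c))) :
    psiCoef P c ((s.step c).step b) * (psiCoef P b (s.step c) * psiCoef P c s) =
      psiCoef P b ((s.step b).step c) * (psiCoef P c (s.step b) * psiCoef P b s) := by
  have e1 : hi b = lo c := hi_eq_lo hc
  have e2 : r c (lo b) = lo b := r_of_ne (e1 ▸ lo_ne_hi b) (lo_ne_hi_succ hc)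
  have e3 : r b (hi c) = hi c := r_of_ne (lo_ne_hi_succ hc).symm (e1 ▸ (lo_ne_hi c).symm)
  have e4 : r b (lo c) = lo b := by rw [← e1, r_hi]
  have e5 : r b (lo b) = lo c := by rw [r_lo, e1]
  have v1 : ∀ t : Shuffle n ν, (t.step c).1 (lo b) = t.1 (lo b) := by
    intro t
    by_cases h : t.color (lo c) = t.color (hi c)
    · rw [Shuffle.step_of_eq h]
    · rw [Shuffle.step_apply h, e2]
  have v2 : ∀ t : Shuffle n ν, t.color (lo b) ≠ t.color (lo c) →
      (t.step b).1 (lo c) = t.1 (lo b) := by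
    intro t h
    rw [Shuffle.step_apply (by rwa [e1]), e4]
  have v3 : ∀ t : Shuffle n ν, t.color (lo b) ≠ t.color (lo c) →
      (t.step b).1 (lo b) = t.1 (lo c) := by
    intro t h
    rw [Shuffle.step_apply (by rwa [e1]), e5]
  simp only [psiCoef, Shuffle.color_step, e1, e2, e3, e4, e5, r_lo, r_hi, v1]
  by_cases hxy : s.color (lo b) = s.color (lo c) <;>
    by_cases hyz : s.color (lo c) = s.color (hi c)
  · exact absurd ⟨hxy, hyz⟩ hs
  · have hxz : s.color (lo b) ≠ s.color (hi c) := fun h => hyz (hxy.symm.trans h)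
    rw [if_pos hxy, if_neg hxz, if_neg hyz, if_neg hxz, if_neg hyz, if_pos hxy, one_mul, mul_one,
      one_mul, one_mul, v2, v1]
    rwa [Shuffle.color_step, Shuffle.color_step, e2, r_lo]
  · have hxz : s.color (lo b) ≠ s.color (hi c) := fun h => hxy (h.trans hyz.symm)
    rw [if_neg hxy, if_neg hxz, if_pos hyz, if_neg hxz, if_pos hyz, if_neg hxy, one_mul, mul_one,
      one_mul, mul_one, v3 _ hxy]
  · rw [if_neg hxy, if_neg hyz, if_neg hyz, if_neg hxy, one_mul, mul_one, one_mul, mul_one]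
    by_cases hxz : s.color (lo b) = s.color (hi c)
    · rw [if_pos hxz, if_pos hxz, v2 _ hxy]
    · rw [if_neg hxz, if_neg hxz]

theorem polyQ_colMatrix (i j : I) (u v : Shuffle n ν → A) :
    Γ.polyQ i j (colMatrix id u) (colMatrix id v) = colMatrix id fun s => Γ.polyQ i j (u s) (v s) := by
  simp only [colMatrix_id]
  have := Γ.map_polyQ i j (Matrix.diagonalRingHom (Shuffle n ν) A) u v
  simp only [Matrix.diagonalRingHom_apply] at this
  rw [← this]
  congr 1
  funext s
  exact Γ.map_polyQ i j (Pi.evalRingHom (fun _ : Shuffle n ν => A) s) u v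

theorem dividedQ_colMatrix (i j : I) (u v w : Shuffle n ν → A) :
    Γ.dividedQ i j (colMatrix id u) (colMatrix id v) (colMatrix id w) =
      colMatrix id fun s => Γ.dividedQ i j (u s) (v s) (w s) := by
  simp only [colMatrix_id]
  have := Γ.map_dividedQ i j (Matrix.diagonalRingHom (Shuffle n ν) A) u v w
  simp only [Matrix.diagonalRingHom_apply] at this
  rw [← this]
  congr 1
  funext s
  exact Γ.map_dividedQ i j (Pi.evalRingHom (fun _ : Shuffle n ν => A) s) u v w

namespace BlockRep

variable {Γ} {hst : ∀ j, ∀ i ∈ α j, ∀ w : Equiv.Perm (Fin (ν j)), i ∘ w ∈ α j}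
  {ε : ∀ j, α j → A} {E : (∀ j, α j) → A} (hB : BlockRep Γ hst Y P ε E)
include hB

/-- `E k` absorbs `ε j (k j)`, so the relations of a single part can be used next to `E k`. -/
theorem mul_E_of {j : Fin d} {k : ∀ j, α j} {x z : A} (h : x * ε j (k j) = z * ε j (k j)) :
    x * E k = z * E k := by
  rw [← hB.e_mul_E j k, ← mul_assoc, h, mul_assoc]

theorem posY_comm (x z : Σ j, Fin (ν j)) : posY Y x * posY Y z = posY Y z * posY Y x := by
  obtain ⟨j, x⟩ := x
  obtain ⟨j', z⟩ := z
  by_cases h : j = j'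
  · subst h
    exact (hB.rep j).y_mul_y _ _
  · exact hB.Y_mul_Y _ _ h _ _

/-- Distant steps do not affect each other's coefficients. Two nontrivial coefficients commute
either because they belong to different parts or because distant places of one colour hold distant
letters. -/
theorem psiCoef_step_comm {a b : Fin (n - 1)} (h : (a : ℕ) + 1 < b ∨ (b : ℕ) + 1 < a)
    (s : Shuffle n ν) : psiCoef P a (s.step b) * psiCoef P b s =
      psiCoef P b (s.step a) * psiCoef P a s := by
  have key : ∀ {a b : Fin (n - 1)} (_ : (a : ℕ) + 1 < b ∨ (b : ℕ) + 1 < a),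
      psiCoef P a (s.step b) = psiCoef P a s := by
    intro a b h
    have h1 : r b (lo a) = lo a := by
      apply r_of_ne <;> simp only [ne_eq, Fin.ext_iff, lo, hi] <;> omega
    have h2 : r b (hi a) = hi a := by
      apply r_of_ne <;> simp only [ne_eq, Fin.ext_iff, lo, hi] <;> omega
    simp only [psiCoef, Shuffle.color_step, h1, h2]
    congr 2
    by_cases hs : s.color (lo b) = s.color (hi b)
    · rw [Shuffle.step_of_eq hs]
    · rw [Shuffle.step_apply hs, h1]
  rw [key h, key h.symm]
  by_cases ha : s.color (lo a) = s.color (hi a)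
  swap
  · rw [psiCoef_of_ne ha, one_mul, mul_one]
  by_cases hb : s.color (lo b) = s.color (hi b)
  swap
  · rw [psiCoef_of_ne hb, one_mul, mul_one]
  obtain ⟨j, c, h1, h2⟩ := Shuffle.exists_consecutive ha
  obtain ⟨j', c', h1', h2'⟩ := Shuffle.exists_consecutive hb
  rw [psiCoef_of_consecutive h1 h2, psiCoef_of_consecutive h1' h2']
  by_cases hj : j = j'
  swap
  · exact hB.P_mul_P _ _ hj _ _
  subst hj
  refine (hB.rep j).psi_mul_psi _ _ ?_
  have aux : ∀ {a b : Fin (n - 1)} {c c' : Fin (ν j - 1)}, s.1 (hi a) = ⟨j, hi c⟩ →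
      s.1 (lo b) = ⟨j, lo c'⟩ → (a : ℕ) + 1 < b → (c : ℕ) + 1 < c' := by
    intro a b c c' h1 h2 h
    have : s.1.symm ⟨j, hi c⟩ < s.1.symm ⟨j, lo c'⟩ := by
      rw [← h1, ← h2, Equiv.symm_apply_apply, Equiv.symm_apply_apply]
      exact h
    exact Shuffle.symm_lt_symm.1 this
  exact h.imp (aux h2 h1') (aux h2' h1)

variable {β : Set (Fin n → I)} [Finite β]

/-- Each relation that ends in an idempotent is compared on the column of one tuple `(s, k)`. If the
places involved have one colour, the steps fix `s` and the relation is that of the part at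
consecutive letters. Otherwise the crossings of different colours have coefficient `1`, which
matches `Q = 1` and a vanishing divided difference. -/
theorem isRep_matrix (hβ : IsShuffleSet β α)
    (hdisj : ∀ i j : I, p i ≠ p j → IsEmpty (Γ.Hom i j)) :
    IsRep Γ β (yMat (n := n) Y) (psiMat P) (eMat hβ E) where
  sum_e := by
    have := Fintype.ofFinite β
    have : Finite (Shuffle n ν × ∀ j, α j) := Finite.of_equiv _ hβ.idx.symm
    -- Finiteness of the set of families of words is drawn from that of `β` by fixing a shuffle;
    -- without shuffles the matrix ring is trivial.
    rcases isEmpty_or_nonempty (Shuffle n ν) with hT | ⟨⟨s₀⟩⟩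
    · ext s
      exact hT.elim s
    have := hβ.finite_words s₀
    have := Fintype.ofFinite (∀ j, α j)
    rw [finsum_eq_sum_of_fintype, ← hβ.idx.sum_comp, Fintype.sum_prod_type]
    simp only [eMat_idx]
    have h1 : ∀ s : Shuffle n ν, ∑ k, Matrix.single s s (E k) = Matrix.single s s (1 : A) := by
      intro s
      rw [← hB.sum_E, finsum_eq_sum_of_fintype]
      exact (map_sum (Matrix.singleAddMonoidHom (α := A) s s) _ _).symm
    simp only [h1]
    ext t u
    by_cases htu : t = u
    · subst htu
      simp [Matrix.sum_apply, Matrix.single_apply]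
    · rw [Matrix.sum_apply, Matrix.one_apply_ne htu]
      refine Finset.sum_eq_zero fun s _ => Matrix.single_apply_of_ne _ _ _ _ _ ?_
      rintro ⟨rfl, rfl⟩
      exact htu rfl
  e_mul_self i := by
    obtain ⟨s, k, rfl⟩ := hβ.idx_surj i
    rw [eMat_idx, Matrix.single_mul_single_same, hB.E_mul_self]
  e_mul_ne i j h := by
    obtain ⟨s, k, rfl⟩ := hβ.idx_surj i
    obtain ⟨t, l, rfl⟩ := hβ.idx_surj j
    rw [eMat_idx, eMat_idx]
    by_cases hst : s = t
    · subst hst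
      rw [Matrix.single_mul_single_same, hB.E_mul_ne, Matrix.single_zero]
      rintro rfl
      exact h rfl
    · exact Matrix.single_mul_single_of_ne _ _ _ _ hst _
  y_mul_y a b := by
    simp only [yMat, colMatrix_mul_colMatrix, id]
    congr 1
    funext s
    exact hB.posY_comm _ _
  y_mul_e a i := by
    obtain ⟨s, k, rfl⟩ := hβ.idx_surj i
    rw [eMat_idx, yMat, colMatrix_mul_single, single_mul_colMatrix fun _ => rfl]
    simp only [id]
    rw [posY, hB.Y_mul_E]
  psi_mul_e b i i' h := by
    obtain ⟨s, k, rfl⟩ := hβ.idx_surj i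
    rw [eMat_idx, psiMat, colMatrix_mul_single]
    by_cases hs : s.color (lo b) = s.color (hi b)
    · obtain ⟨j, c, h1, h2⟩ := Shuffle.exists_consecutive hs
      obtain rfl : i' = hβ.idx (s, hβ.swapWord j c k) :=
        Subtype.ext (h.trans (hβ.idx_swapWord h1 h2 k).symm)
      rw [eMat_idx, single_mul_colMatrix (Shuffle.step_step b), Shuffle.step_of_eq hs,
        psiCoef_of_consecutive h1 h2, hB.P_mul_E]
      rfl
    · obtain rfl : i' = hβ.idx (s.step b, k) := Subtype.ext (h.trans (hβ.idx_step hs k).symm)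
      rw [eMat_idx, single_mul_colMatrix (Shuffle.step_step b), Shuffle.step_step,
        psiCoef_of_ne hs, one_mul, mul_one]
  psi_mul_y_lo b i h := by
    obtain ⟨s, k, rfl⟩ := hβ.idx_surj i
    have hs : s.color (lo b) = s.color (hi b) := by
      rw [← p_tuple s k, ← p_tuple s k]
      exact congrArg p h
    obtain ⟨j, c, h1, h2⟩ := Shuffle.exists_consecutive hs
    simp only [eMat_idx, yMat, psiMat, sub_mul, mul_assoc, colMatrix_mul_single, id,
      Shuffle.step_of_eq hs, psiCoef_of_consecutive h1 h2, h1, h2, posY_mk]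
    rw [single_sub_single, Matrix.single_neg]
    congr 1
    rw [← mul_assoc, ← mul_assoc, ← sub_mul, ← neg_one_mul (E k)]
    refine hB.mul_E_of (j := j) ?_
    rw [neg_one_mul]
    refine (hB.rep j).psi_mul_y_lo c (k j) (Subtype.ext ?_)
    simpa [tuple, letter_mk, h1, h2] using h
  psi_mul_y_hi b i h := by
    obtain ⟨s, k, rfl⟩ := hβ.idx_surj i
    have hs : s.color (lo b) = s.color (hi b) := by
      rw [← p_tuple s k, ← p_tuple s k]
      exact congrArg p h
    obtain ⟨j, c, h1, h2⟩ := Shuffle.exists_consecutive hs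
    simp only [eMat_idx, yMat, psiMat, sub_mul, mul_assoc, colMatrix_mul_single, id,
      Shuffle.step_of_eq hs, psiCoef_of_consecutive h1 h2, h1, h2, posY_mk]
    rw [single_sub_single]
    congr 1
    rw [← mul_assoc, ← mul_assoc, ← sub_mul, ← one_mul (E k), ← mul_assoc, mul_one]
    refine hB.mul_E_of (j := j) ?_
    rw [one_mul]
    refine (hB.rep j).psi_mul_y_hi c (k j) (Subtype.ext ?_)
    simpa [tuple, letter_mk, h1, h2] using h
  psi_mul_y b a i h := by
    obtain ⟨s, k, rfl⟩ := hβ.idx_surj i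
    simp only [eMat_idx, yMat, psiMat, sub_mul, mul_assoc, colMatrix_mul_single, id]
    rw [single_sub_single, ← Matrix.single_zero (s.step b) s]
    congr 1
    by_cases hs : s.color (lo b) = s.color (hi b)
    swap
    · rw [psiCoef_of_ne hs, Shuffle.step_apply hs, r_r]
      simp
    rw [Shuffle.step_of_eq hs]
    obtain ⟨j, c, h1, h2⟩ := Shuffle.exists_consecutive hs
    rw [psiCoef_of_consecutive h1 h2, ← mul_assoc, ← mul_assoc, ← sub_mul]
    by_cases ha : s.color a = j
    · obtain ⟨x, hx⟩ : ∃ x, s.1 a = ⟨j, x⟩ := by subst ha; exact ⟨_, rfl⟩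
      rw [Shuffle.apply_r h1 h2 hx, hx, posY_mk, posY_mk, ← zero_mul (E k)]
      refine hB.mul_E_of (j := j) ?_
      rw [zero_mul]
      refine (hB.rep j).psi_mul_y c x (k j) fun h' => h ⟨?_, ?_⟩
      · refine h'.1.imp ?_ ?_
        · rintro rfl
          exact s.1.injective (hx.trans h1.symm)
        · rintro rfl
          exact s.1.injective (hx.trans h2.symm)
      · simpa [tuple, letter_mk, h1, h2] using congrArg Subtype.val h'.2
    · rw [Shuffle.apply_r_of_ne h1 h2 ha, posY, hB.P_mul_Y j (s.1 a).1 (Ne.symm ha), sub_self, zero_mul]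
  psi_mul_psi a b h := by
    rw [psiMat, psiMat, colMatrix_mul_colMatrix, colMatrix_mul_colMatrix]
    congr 1
    · funext s
      exact Shuffle.step_comm h.symm s
    · funext s
      exact hB.psiCoef_step_comm h s
  psi_sq b i := by
    obtain ⟨s, k, rfl⟩ := hβ.idx_surj i
    simp only [eMat_idx, yMat, psiMat, mul_assoc, polyQ_colMatrix, colMatrix_mul_single, id,
      Shuffle.step_step]
    congr 1
    by_cases hs : s.color (lo b) = s.color (hi b)
    · obtain ⟨j, c, h1, h2⟩ := Shuffle.exists_consecutive hs
      rw [Shuffle.step_of_eq hs, psiCoef_of_consecutive h1 h2, h1, h2, posY_mk, posY_mk,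
        ← mul_assoc]
      refine hB.mul_E_of (j := j) ?_
      rw [(hB.rep j).psi_sq, Quiver.polyQ_fullSub]
      simp [tuple, letter_mk, h1, h2]
    · have hp : p ((hβ.idx (s, k)).1 (lo b)) ≠ p ((hβ.idx (s, k)).1 (hi b)) := by
        simpa [p_tuple] using hs
      rw [psiCoef_of_ne hs, psiCoef_of_ne, Quiver.polyQ_of_isEmpty (fun h => hp (congrArg p h))
        (hdisj _ _ hp) (hdisj _ _ hp.symm)]
      · simp
      · simpa [Shuffle.color_step] using Ne.symm hs
  braid_eq b c hc i h := by
    obtain ⟨s, k, rfl⟩ := hβ.idx_surj i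
    have e1 : hi b = lo c := hi_eq_lo hc
    simp only [eMat_idx, yMat, psiMat, sub_mul, mul_assoc, dividedQ_colMatrix,
      colMatrix_mul_single, id, Shuffle.step_braid hc]
    by_cases hs : s.color (lo b) = s.color (lo c) ∧ s.color (lo c) = s.color (hi c)
    · obtain ⟨j, c₁, h1, h2⟩ := Shuffle.exists_consecutive (b := b) (s := s) (e1 ▸ hs.1)
      obtain ⟨c₂, h3, h4, h5⟩ := Shuffle.exists_next hc h2 hs.2
      rw [single_sub_single]
      simp only [Shuffle.step_of_eq hs.2, Shuffle.step_of_eq (e1 ▸ hs.1 : s.color (lo b) = _)]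
      congr 1
      rw [psiCoef_of_consecutive h1 h2, psiCoef_of_consecutive h3 h4, h1, h2, h4]
      simp only [posY_mk, ← mul_assoc, ← sub_mul]
      refine hB.mul_E_of (j := j) ?_
      rw [(hB.rep j).braid_eq c₁ c₂ h5 (k j), Quiver.dividedQ_fullSub]
      · simp [tuple, letter_mk, h1, h2]
      · refine Subtype.ext ?_
        simpa [tuple, letter_mk, h1, h4] using h
    · have := psiCoef_braid_of_color (P := P) hc s hs
      simp only [← mul_assoc] at this ⊢
      rw [this, sub_self]
      -- The outer letters are equal, so the middle one has another colour and the divided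
      -- difference vanishes.
      have hxz : s.color (lo b) = s.color (hi c) := by
        rw [← p_tuple s k, ← p_tuple s k]
        exact congrArg p h
      have hp : p ((hβ.idx (s, k)).1 (lo b)) ≠ p ((hβ.idx (s, k)).1 (hi b)) := by
        simp only [IsShuffleSet.idx_val, p_tuple, e1]
        exact fun h' => hs ⟨h', h'.symm.trans hxz⟩
      rw [Quiver.dividedQ_of_isEmpty (fun h => hp (congrArg p h))
        (hdisj _ _ hp) (hdisj _ _ hp.symm)]
      simp
  braid_ne b c hc i h := by
    obtain ⟨s, k, rfl⟩ := hβ.idx_surj i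
    have e1 : hi b = lo c := hi_eq_lo hc
    simp only [eMat_idx, psiMat, sub_mul, mul_assoc, colMatrix_mul_single, Shuffle.step_braid hc]
    by_cases hs : s.color (lo b) = s.color (lo c) ∧ s.color (lo c) = s.color (hi c)
    · obtain ⟨j, c₁, h1, h2⟩ := Shuffle.exists_consecutive (b := b) (s := s) (e1 ▸ hs.1)
      obtain ⟨c₂, h3, h4, h5⟩ := Shuffle.exists_next hc h2 hs.2
      rw [single_sub_single]
      simp only [Shuffle.step_of_eq hs.2, Shuffle.step_of_eq (e1 ▸ hs.1 : s.color (lo b) = _)]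
      rw [← Matrix.single_zero s s]
      congr 1
      rw [psiCoef_of_consecutive h1 h2, psiCoef_of_consecutive h3 h4]
      simp only [← mul_assoc, ← sub_mul]
      rw [← zero_mul (E k)]
      refine hB.mul_E_of (j := j) ?_
      rw [(hB.rep j).braid_ne c₁ c₂ h5 (k j), zero_mul]
      refine fun h' => h ?_
      simpa [tuple, letter_mk, h1, h4] using congrArg Subtype.val h'
    · have := psiCoef_braid_of_color (P := P) hc s hs
      simp only [← mul_assoc] at this ⊢
      rw [this, sub_self]

end BlockRep

end BlockRep

/-! ### The tensor product of the algebras of the parts -/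

section Tensor

open PiTensorProduct

variable {K : Type v} [CommRing K] {I : Type u} {Γ : Quiver.{w} I} {d n : ℕ} {p : I → Fin d}
  {ν : Fin d → ℕ} {α : ∀ j, Set (Fin (ν j) → part p j)} [∀ j, Finite (α j)]
  {A : Fin d → Type*} [∀ j, Ring (A j)] [∀ j, Algebra K (A j)]

theorem singleAlgHom_mul_tprod {ι : Type*} [DecidableEq ι] {A : ι → Type*} [∀ j, Ring (A j)]
    [∀ j, Algebra K (A j)] (j : ι) (x : A j) (f : ∀ j, A j) :
    (singleAlgHom j x : ⨂[K] j, A j) * tprod K f = tprod K (Function.update f j (x * f j)) := by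
  rw [singleAlgHom_apply, tprod_mul_tprod]
  congr 1
  funext i
  by_cases h : i = j
  · subst h; simp
  · simp [h]

theorem tprod_mul_singleAlgHom {ι : Type*} [DecidableEq ι] {A : ι → Type*} [∀ j, Ring (A j)]
    [∀ j, Algebra K (A j)] (j : ι) (x : A j) (f : ∀ j, A j) :
    tprod K f * (singleAlgHom j x : ⨂[K] j, A j) = tprod K (Function.update f j (f j * x)) := by
  rw [singleAlgHom_apply, tprod_mul_tprod]
  congr 1
  funext i
  by_cases h : i = j
  · subst h; simp
  · simp [h]

theorem singleAlgHom_comm {ι : Type*} [DecidableEq ι] {A : ι → Type*} [∀ j, Ring (A j)]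
    [∀ j, Algebra K (A j)] {j j' : ι} (h : j ≠ j') (x : A j) (z : A j') :
    (singleAlgHom j x : ⨂[K] j, A j) * singleAlgHom j' z = singleAlgHom j' z * singleAlgHom j x := by
  simp only [singleAlgHom_apply, tprod_mul_tprod]
  congr 1
  exact Pi.mulSingle_commute h x z

variable (q : ∀ j, Alg K (Γ.fullSub (part p j)) (α j) →ₐ[K] A j)

/-- The image of a generator of the algebra of the `j`-th part in the tensor product. -/
noncomputable def tensorGen (j : Fin d) (g : Gen (α j)) : ⨂[K] j, A j :=
  singleAlgHom j (q j (gen K _ _ g))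

/-- The tensor product of idempotents. -/
noncomputable def tensorE (k : ∀ j, α j) : ⨂[K] j, A j :=
  tprod K fun j => q j (gen K _ _ (Gen.e (k j)))

theorem isRep_tensorGen (j : Fin d) : IsRep (Γ.fullSub (part p j)) (α j)
    (fun a => tensorGen q j (Gen.y a)) (fun c => tensorGen q j (Gen.psi c))
    (fun i => tensorGen q j (Gen.e i)) :=
  (isRep_gen K _ (α j)).map (((singleAlgHom j).comp (q j) : _ →ₐ[K] ⨂[K] j, A j))

theorem blockRep_tensor
    (hst : ∀ j, ∀ i ∈ α j, ∀ w : Equiv.Perm (Fin (ν j)), i ∘ w ∈ α j) :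
    BlockRep Γ hst (fun j a => tensorGen q j (Gen.y a)) (fun j c => tensorGen q j (Gen.psi c))
      (fun j i => tensorGen q j (Gen.e i)) (tensorE q) := by
  have hrep := fun j => (isRep_gen K (Γ.fullSub (part p j)) (α j)).map (q j)
  constructor
  · exact isRep_tensorGen q
  · have := fun j => Fintype.ofFinite (α j)
    rw [finsum_eq_sum_of_fintype, one_def]
    simp only [tensorE]
    -- By multilinearity the sum over families of words is the tensor product of the sums of
    -- idempotents, each of which is `1`.
    rw [← MultilinearMap.map_sum (tprod K) (fun j i => q j (gen K _ _ (Gen.e i)))]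
    congr 1
    funext j
    rw [Pi.one_apply, ← (hrep j).sum_e, finsum_eq_sum_of_fintype]
  · intro k
    simp only [tensorE, tprod_mul_tprod]
    congr 1
    funext j
    exact (hrep j).e_mul_self _
  · intro k l h
    obtain ⟨j, hj⟩ := Function.ne_iff.1 h
    simp only [tensorE, tprod_mul_tprod]
    exact MultilinearMap.map_coord_zero (PiTensorProduct.tprod K) j ((hrep j).e_mul_ne _ _ hj)
  · intro j k
    simp only [tensorGen, tensorE, singleAlgHom_mul_tprod]
    rw [(hrep j).e_mul_self, Function.update_eq_self]
  · intro j a k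
    simp only [tensorGen, tensorE, singleAlgHom_mul_tprod, tprod_mul_singleAlgHom]
    rw [(hrep j).y_mul_e]
  · intro j c k
    simp only [tensorGen, tensorE, singleAlgHom_mul_tprod, tprod_mul_singleAlgHom]
    congr 1
    funext j'
    by_cases h : j' = j
    · subst h
      simp only [Function.update_self]
      exact (hrep j').psi_mul_e _ _ _ rfl
    · simp [h]
  · exact fun j j' h a a' => singleAlgHom_comm h _ _
  · exact fun j j' h a a' => singleAlgHom_comm h _ _
  · exact fun j j' h a a' => singleAlgHom_comm h _ _

/-- A subalgebra of the tensor product that contains the images of all generators is everything. -/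
theorem tensor_subalgebra_eq_top (hq : ∀ j, Function.Surjective (q j))
    (S : Subalgebra K (⨂[K] j, A j)) (h : ∀ j g, tensorGen q j g ∈ S) : S = ⊤ := by
  have h1 : ∀ j x, (singleAlgHom j x : ⨂[K] j, A j) ∈ S := by
    intro j x
    obtain ⟨x, rfl⟩ := hq j x
    have : (Algebra.adjoin K (Set.range (gen K (Γ.fullSub (part p j)) (α j)))) ≤
        S.comap ((singleAlgHom j).comp (q j)) := by
      refine Algebra.adjoin_le ?_
      rintro _ ⟨g, rfl⟩
      exact h j g
    rw [adjoin_gen] at this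
    exact this (Algebra.mem_top (x := x))
  refine eq_top_iff.2 fun x _ => ?_
  induction x using PiTensorProduct.induction_on with
  | smul_tprod c f =>
    refine S.smul_mem ?_ c
    -- A pure tensor is built up from `1` by inserting one factor at a time.
    have : ∀ s : Finset (Fin d), (tprod K (fun j => if j ∈ s then f j else 1) : ⨂[K] j, A j) ∈ S := by
      intro s
      induction s using Finset.induction_on with
      | empty =>
        simp only [Finset.notMem_empty, if_false]
        exact S.one_mem
      | insert j s hj ih =>
        have := S.mul_mem (h1 j (f j)) ih
        rw [singleAlgHom_mul_tprod] at this
        convert this using 2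
        funext i
        by_cases hi : i = j
        · subst hi; simp [hj]
        · simp [hi]
    simpa using this Finset.univ
  | add x y hx hy => exact S.add_mem (hx trivial) (hy trivial)

end Tensor

/-! ### The idempotents of the shuffles and the elements that permute them -/

section Tau

theorem mul_finsum_of_finite {ι B : Type*} [Finite ι] [NonUnitalNonAssocSemiring B] (x : B)
    (f : ι → B) : x * ∑ᶠ i, f i = ∑ᶠ i, x * f i :=
  map_finsum_of_finite (AddMonoidHom.mulLeft x) f

theorem finsum_mul_of_finite {ι B : Type*} [Finite ι] [NonUnitalNonAssocSemiring B] (x : B)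
    (f : ι → B) : (∑ᶠ i, f i) * x = ∑ᶠ i, f i * x :=
  map_finsum_of_finite (AddMonoidHom.mulRight x) f

variable {I : Type u} {Γ : Quiver.{w} I} {d n : ℕ} {p : I → Fin d} {ν : Fin d → ℕ}
  {α : ∀ j, Set (Fin (ν j) → part p j)} [∀ j, Finite (α j)] {β : Set (Fin n → I)}
  {B : Type*} [Ring B] {y : Fin n → B} {ψ : Fin (n - 1) → B} {e : β → B}

/-- The sum of the idempotents of all tuples that are shuffles of a given type. -/
noncomputable def shuffleE (hβ : IsShuffleSet β α) (e : β → B) (s : Shuffle n ν) : B :=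
  ∑ᶠ k, e (hβ.idx (s, k))

namespace IsRep

variable (hR : IsRep Γ β y ψ e) (hβ : IsShuffleSet β α)
include hR

theorem shuffleE_mul_e (s : Shuffle n ν) (k : ∀ j, α j) :
    shuffleE hβ e s * e (hβ.idx (s, k)) = e (hβ.idx (s, k)) := by
  rw [shuffleE, finsum_mul_of_finite, finsum_eq_single _ k, hR.e_mul_self]
  intro l hl
  refine hR.e_mul_ne _ _ fun h => hl ?_
  simpa using hβ.idx.injective h

theorem e_mul_shuffleE (s : Shuffle n ν) (k : ∀ j, α j) :
    e (hβ.idx (s, k)) * shuffleE hβ e s = e (hβ.idx (s, k)) := by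
  rw [shuffleE, mul_finsum_of_finite, finsum_eq_single _ k, hR.e_mul_self]
  intro l hl
  refine hR.e_mul_ne _ _ fun h => hl ?_
  simpa using (hβ.idx.injective h).symm

theorem shuffleE_mul_self (s : Shuffle n ν) :
    shuffleE hβ e s * shuffleE hβ e s = shuffleE hβ e s := by
  conv_lhs => rw [shuffleE, finsum_mul_of_finite]
  exact finsum_congr fun k => hR.e_mul_shuffleE hβ s k

theorem shuffleE_mul_ne {s t : Shuffle n ν} (h : s ≠ t) :
    shuffleE hβ e s * shuffleE hβ e t = 0 := by
  rw [shuffleE, shuffleE, finsum_mul_of_finite]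
  simp only [mul_finsum_of_finite]
  have : ∀ k l, e (hβ.idx (s, k)) * e (hβ.idx (t, l)) = 0 := fun k l =>
    hR.e_mul_ne _ _ fun h' => h (congrArg Prod.fst (hβ.idx.injective h'))
  simp [this]

theorem sum_shuffleE [Finite β] : ∑ s, shuffleE hβ e s = 1 := by
  have := Fintype.ofFinite β
  have := Fintype.ofFinite (∀ j, α j)
  rw [← hR.sum_e, finsum_eq_sum_of_fintype, ← hβ.idx.sum_comp, Fintype.sum_prod_type]
  simp only [shuffleE, finsum_eq_sum_of_fintype]

omit hR in
theorem mul_shuffleE_congr {s : Shuffle n ν} {x z : B}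
    (h : ∀ k, x * e (hβ.idx (s, k)) = z * e (hβ.idx (s, k))) :
    x * shuffleE hβ e s = z * shuffleE hβ e s := by
  simp only [shuffleE, mul_finsum_of_finite, h]

theorem y_mul_shuffleE (a : Fin n) (s : Shuffle n ν) :
    y a * shuffleE hβ e s = shuffleE hβ e s * y a := by
  simp only [shuffleE, mul_finsum_of_finite, finsum_mul_of_finite, hR.y_mul_e]

/-- Across colours the summands correspond with the same words; inside a colour they are permuted by
the involution `swapWord`. -/
theorem psi_mul_shuffleE (b : Fin (n - 1)) (s : Shuffle n ν) :
    ψ b * shuffleE hβ e s = shuffleE hβ e (s.step b) * ψ b := by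
  simp only [shuffleE, mul_finsum_of_finite, finsum_mul_of_finite]
  by_cases hs : s.color (lo b) = s.color (hi b)
  · obtain ⟨j, c, h1, h2⟩ := Shuffle.exists_consecutive hs
    rw [Shuffle.step_of_eq hs]
    have hinv : Function.Involutive (hβ.swapWord j c) := fun k => hβ.swapWord_swapWord j c k
    rw [← finsum_comp_equiv hinv.toPerm (f := fun k => e (hβ.idx (s, k)) * ψ b)]
    exact finsum_congr fun k => hR.psi_mul_e b _ _ (hβ.idx_swapWord h1 h2 k)
  · exact finsum_congr fun k => hR.psi_mul_e b _ _ (hβ.idx_step hs k)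

variable (hdisj : ∀ i j : I, p i ≠ p j → IsEmpty (Γ.Hom i j))

theorem psi_psi_shuffleE (hdisj : ∀ i j : I, p i ≠ p j → IsEmpty (Γ.Hom i j))
    {b : Fin (n - 1)} {s : Shuffle n ν} (hs : s.color (lo b) ≠ s.color (hi b)) :
    ψ b * ψ b * shuffleE hβ e s = shuffleE hβ e s := by
  conv_rhs => rw [← one_mul (shuffleE hβ e s)]
  refine mul_shuffleE_congr hβ fun k => ?_
  have hp : p ((hβ.idx (s, k)).1 (lo b)) ≠ p ((hβ.idx (s, k)).1 (hi b)) := by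
    simpa [p_tuple] using hs
  rw [hR.psi_sq, Quiver.polyQ_of_isEmpty (fun h => hp (congrArg p h)) (hdisj _ _ hp)
    (hdisj _ _ hp.symm)]

/-- An error term requires equal outer letters; the middle letter then has another colour, and the
error term is `0`. -/
theorem braid_shuffleE (hdisj : ∀ i j : I, p i ≠ p j → IsEmpty (Γ.Hom i j))
    {b c : Fin (n - 1)} (hc : (c : ℕ) = b + 1) {s : Shuffle n ν}
    (hs : ¬(s.color (lo b) = s.color (lo c) ∧ s.color (lo c) = s.color (hi c))) :
    ψ c * ψ b * ψ c * shuffleE hβ e s = ψ b * ψ c * ψ b * shuffleE hβ e s := by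
  refine mul_shuffleE_congr hβ fun k => ?_
  rw [← sub_eq_zero, ← sub_mul]
  by_cases h : (hβ.idx (s, k)).1 (lo b) = (hβ.idx (s, k)).1 (hi c)
  · have hxz : s.color (lo b) = s.color (hi c) := by
      rw [← p_tuple s k, ← p_tuple s k]
      exact congrArg p h
    have hp : p ((hβ.idx (s, k)).1 (lo b)) ≠ p ((hβ.idx (s, k)).1 (hi b)) := by
      simp only [IsShuffleSet.idx_val, p_tuple, hi_eq_lo hc]
      exact fun h' => hs ⟨h', h'.symm.trans hxz⟩
    rw [hR.braid_eq b c hc _ h, Quiver.dividedQ_of_isEmpty (fun h => hp (congrArg p h))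
      (hdisj _ _ hp) (hdisj _ _ hp.symm), zero_mul]
  · exact hR.braid_ne b c hc _ h

theorem psi_y_shuffleE {b : Fin (n - 1)} {s : Shuffle n ν} (hs : s.color (lo b) ≠ s.color (hi b))
    (a : Fin n) : ψ b * y a * shuffleE hβ e s = y (r b a) * ψ b * shuffleE hβ e s := by
  refine mul_shuffleE_congr hβ fun k => ?_
  rw [← sub_eq_zero, ← sub_mul]
  refine hR.psi_mul_y b a _ fun h => hs ?_
  rw [← p_tuple s k, ← p_tuple s k]
  exact congrArg p h.2

end IsRep

open Classical in
/-- The product of the `ψ_b` that takes the sorted shuffle to the shuffle `s`. -/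
noncomputable def tau (ψ : Fin (n - 1) → B) (e₀ : B) (s : Shuffle n ν) : B :=
  if h : ∃ b : Fin (n - 1), s.color (hi b) < s.color (lo b) then
    ψ h.choose * tau ψ e₀ (s.step h.choose) else e₀
termination_by s
decreasing_by exact Shuffle.step_lex_lt h.choose_spec

open Classical in
/-- The product of the `ψ_b` that takes the shuffle `s` to the sorted shuffle. -/
noncomputable def tauInv (ψ : Fin (n - 1) → B) (e₀ : B) (s : Shuffle n ν) : B :=
  if h : ∃ b : Fin (n - 1), s.color (hi b) < s.color (lo b) then
    tauInv ψ e₀ (s.step h.choose) * ψ h.choose else e₀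
termination_by s
decreasing_by exact Shuffle.step_lex_lt h.choose_spec

/-- The recursion follows one chosen descent, and a shuffle without descents is sorted. This
alternative drives the inductions below; independence of the choice is `IsRep.tau_of_descent`. -/
theorem tau_cases (ψ : Fin (n - 1) → B) (e₀ : B) {s₀ : Shuffle n ν} (hs₀ : Monotone s₀.color)
    (s : Shuffle n ν) :
    (s = s₀ ∧ tau ψ e₀ s = e₀ ∧ tauInv ψ e₀ s = e₀) ∨
      ∃ b : Fin (n - 1), s.color (hi b) < s.color (lo b) ∧
        tau ψ e₀ s = ψ b * tau ψ e₀ (s.step b) ∧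
        tauInv ψ e₀ s = tauInv ψ e₀ (s.step b) * ψ b := by
  by_cases h : ∃ b : Fin (n - 1), s.color (hi b) < s.color (lo b)
  · refine Or.inr ⟨h.choose, h.choose_spec, ?_, ?_⟩
    · rw [tau, dif_pos h]
    · rw [tauInv, dif_pos h]
  · refine Or.inl ⟨?_, ?_, ?_⟩
    · push Not at h
      exact Shuffle.eq_of_monotone (Shuffle.monotone_of_no_descent h) hs₀
    · rw [tau, dif_neg h]
    · rw [tauInv, dif_neg h]

namespace IsRep

variable (hR : IsRep Γ β y ψ e) (hβ : IsShuffleSet β α)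
  (hdisj : ∀ i j : I, p i ≠ p j → IsEmpty (Γ.Hom i j))
  {s₀ : Shuffle n ν} (hs₀ : Monotone s₀.color)
include hR hs₀

theorem shuffleE_mul_tau (s : Shuffle n ν) :
    shuffleE hβ e s * tau ψ (shuffleE hβ e s₀) s = tau ψ (shuffleE hβ e s₀) s := by
  induction s using Shuffle.lex_induction with
  | h s ih =>
    obtain ⟨rfl, h1, -⟩ | ⟨b, hb, h1, -⟩ := tau_cases ψ (shuffleE hβ e s₀) hs₀ s
    · rw [h1, hR.shuffleE_mul_self]
    · conv_lhs => rw [h1, ← mul_assoc, ← Shuffle.step_step b s, ← hR.psi_mul_shuffleE,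
        Shuffle.step_step, mul_assoc, ih _ (Shuffle.step_lex_lt hb), ← h1]

theorem tau_mul_shuffleE (s : Shuffle n ν) :
    tau ψ (shuffleE hβ e s₀) s * shuffleE hβ e s₀ = tau ψ (shuffleE hβ e s₀) s := by
  induction s using Shuffle.lex_induction with
  | h s ih =>
    obtain ⟨rfl, h1, -⟩ | ⟨b, hb, h1, -⟩ := tau_cases ψ (shuffleE hβ e s₀) hs₀ s
    · rw [h1, hR.shuffleE_mul_self]
    · rw [h1, mul_assoc, ih _ (Shuffle.step_lex_lt hb)]

theorem tauInv_mul_shuffleE (s : Shuffle n ν) :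
    tauInv ψ (shuffleE hβ e s₀) s * shuffleE hβ e s = tauInv ψ (shuffleE hβ e s₀) s := by
  induction s using Shuffle.lex_induction with
  | h s ih =>
    obtain ⟨rfl, -, h1⟩ | ⟨b, hb, -, h1⟩ := tau_cases ψ (shuffleE hβ e s₀) hs₀ s
    · rw [h1, hR.shuffleE_mul_self]
    · rw [h1, mul_assoc, hR.psi_mul_shuffleE, ← mul_assoc, ih _ (Shuffle.step_lex_lt hb)]

include hdisj

/-- The two products are mirror images made of crossings of different colours, so the `ψ_b` in the
middle cancel in pairs. The same holds in `tau_mul_tauInv`. -/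
theorem tauInv_mul_tau (s : Shuffle n ν) :
    tauInv ψ (shuffleE hβ e s₀) s * tau ψ (shuffleE hβ e s₀) s = shuffleE hβ e s₀ := by
  induction s using Shuffle.lex_induction with
  | h s ih =>
    obtain ⟨rfl, h1, h2⟩ | ⟨b, hb, h1, h2⟩ := tau_cases ψ (shuffleE hβ e s₀) hs₀ s
    · rw [h1, h2, hR.shuffleE_mul_self]
    · have hne : (s.step b).color (lo b) ≠ (s.step b).color (hi b) := by
        simpa [Shuffle.color_step] using hb.ne
      rw [h1, h2, ← hR.shuffleE_mul_tau hβ hs₀ (s.step b)]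
      calc _ = tauInv ψ (shuffleE hβ e s₀) (s.step b) * (ψ b * ψ b * shuffleE hβ e (s.step b)) *
            tau ψ (shuffleE hβ e s₀) (s.step b) := by simp only [mul_assoc]
        _ = _ := by
          rw [hR.psi_psi_shuffleE hβ hdisj hne, mul_assoc, hR.shuffleE_mul_tau hβ hs₀,
            ih _ (Shuffle.step_lex_lt hb)]

theorem tau_mul_tauInv (s : Shuffle n ν) :
    tau ψ (shuffleE hβ e s₀) s * tauInv ψ (shuffleE hβ e s₀) s = shuffleE hβ e s := by
  induction s using Shuffle.lex_induction with
  | h s ih =>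
    obtain ⟨rfl, h1, h2⟩ | ⟨b, hb, h1, h2⟩ := tau_cases ψ (shuffleE hβ e s₀) hs₀ s
    · rw [h1, h2, hR.shuffleE_mul_self]
    · rw [h1, h2]
      calc _ = ψ b * (tau ψ (shuffleE hβ e s₀) (s.step b) * tauInv ψ (shuffleE hβ e s₀) (s.step b))
            * ψ b := by simp only [mul_assoc]
        _ = _ := by
          rw [ih _ (Shuffle.step_lex_lt hb), mul_assoc, ← hR.psi_mul_shuffleE, ← mul_assoc,
            hR.psi_psi_shuffleE hβ hdisj hb.ne']

theorem braid_tau {b c : Fin (n - 1)} (hc : (c : ℕ) = b + 1) {s : Shuffle n ν}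
    (hs : ¬(s.color (lo b) = s.color (lo c) ∧ s.color (lo c) = s.color (hi c))) :
    ψ c * (ψ b * (ψ c * tau ψ (shuffleE hβ e s₀) s)) =
      ψ b * (ψ c * (ψ b * tau ψ (shuffleE hβ e s₀) s)) := by
  have h := hR.braid_shuffleE hβ hdisj hc hs
  rw [← hR.shuffleE_mul_tau hβ hs₀ s]
  simp only [← mul_assoc]
  rw [h]

/-- The chosen descent may be replaced by any other: a Matsumoto-type argument. Two descents are
joined by local confluence, through the commutation relation if they are far apart and the exact
braid relation if they are adjacent. -/
theorem tau_of_descent (s : Shuffle n ν) : ∀ b : Fin (n - 1), s.color (hi b) < s.color (lo b) →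
    tau ψ (shuffleE hβ e s₀) s = ψ b * tau ψ (shuffleE hβ e s₀) (s.step b) := by
  induction s using Shuffle.lex_induction with
  | h s ih =>
    have confl : ∀ b c : Fin (n - 1), b < c → s.color (hi b) < s.color (lo b) →
        s.color (hi c) < s.color (lo c) →
        ψ b * tau ψ (shuffleE hβ e s₀) (s.step b) = ψ c * tau ψ (shuffleE hβ e s₀) (s.step c) := by
      intro b c hbc hb hc
      by_cases hfar : (b : ℕ) + 1 < c
      · have e1 : r b (lo c) = lo c := by
          apply r_of_ne <;> simp only [ne_eq, Fin.ext_iff, lo, hi] <;> omega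
        have e2 : r b (hi c) = hi c := by
          apply r_of_ne <;> simp only [ne_eq, Fin.ext_iff, lo, hi] <;> omega
        have e3 : r c (lo b) = lo b := by
          apply r_of_ne <;> simp only [ne_eq, Fin.ext_iff, lo, hi] <;> omega
        have e4 : r c (hi b) = hi b := by
          apply r_of_ne <;> simp only [ne_eq, Fin.ext_iff, lo, hi] <;> omega
        rw [ih _ (Shuffle.step_lex_lt hb) c (by simpa only [Shuffle.color_step, e1, e2] using hc),
          ih _ (Shuffle.step_lex_lt hc) b (by simpa only [Shuffle.color_step, e3, e4] using hb),
          Shuffle.step_comm (Or.inl hfar), ← mul_assoc, ← mul_assoc,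
          hR.psi_mul_psi _ _ (Or.inl hfar)]
      · have hc1 : (c : ℕ) = b + 1 := by
          have := Fin.lt_def.1 hbc
          omega
        have e1 : hi b = lo c := hi_eq_lo hc1
        have e2 : r c (lo b) = lo b := r_of_ne (e1 ▸ lo_ne_hi b) (lo_ne_hi_succ hc1)
        have e3 : r b (hi c) = hi c := r_of_ne (lo_ne_hi_succ hc1).symm (e1 ▸ (lo_ne_hi c).symm)
        have e4 : r b (lo c) = lo b := by rw [← e1, r_hi]
        have e5 : r b (lo b) = lo c := by rw [r_lo, e1]
        rw [e1] at hb
        have hb' : s.color (hi b) < s.color (lo b) := by rwa [e1]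
        have hac := hc.trans hb
        have l1 := Shuffle.step_lex_lt hb'
        have l2 := Shuffle.step_lex_lt hc
        -- Three strictly decreasing colours: `d1`, `d2` continue the sorting that begins at `b`,
        -- and `d3`, `d4` the one that begins at `c`, up to a common shuffle.
        have d1 : (s.step b).color (hi c) < (s.step b).color (lo c) := by
          simpa only [Shuffle.color_step, e3, e4] using hac
        have d2 : ((s.step b).step c).color (hi b) < ((s.step b).step c).color (lo b) := by
          simpa only [Shuffle.color_step, e1, e2, e3, e4, e5, r_lo] using hc
        have d3 : (s.step c).color (hi b) < (s.step c).color (lo b) := by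
          simpa only [Shuffle.color_step, e1, e2, r_lo] using hac
        have d4 : ((s.step c).step b).color (hi c) < ((s.step c).step b).color (lo c) := by
          simpa only [Shuffle.color_step, e1, e2, e3, e4, e5, r_lo, r_hi] using hb
        rw [ih _ l1 c d1, ih _ ((Shuffle.step_lex_lt d1).trans l1) b d2, ih _ l2 b d3,
          ih _ ((Shuffle.step_lex_lt d3).trans l2) c d4, Shuffle.step_braid hc1,
          hR.braid_tau hβ hdisj hs₀ hc1]
        rintro ⟨h1, -⟩
        simp only [Shuffle.color_step, e2, e3, e4, e5, r_lo] at h1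
        exact hc.ne h1
    intro b hb
    obtain ⟨rfl, -⟩ | ⟨c, hc, h1, -⟩ := tau_cases ψ (shuffleE hβ e s₀) hs₀ s
    · exact absurd (hs₀ (lo_lt_hi b).le) (not_le.2 hb)
    · rw [h1]
      rcases lt_trichotomy b c with h | h | h
      · exact (confl b c h hb hc).symm
      · rw [h]
      · exact confl c b h hc hb

/-- If `b` is an ascent of `s`, it is a descent of `s.step b` and `tau_of_descent` applies there. If
it is a descent, the leading `ψ b` of `tau s` cancels. -/
theorem psi_mul_tau_of_ne {b : Fin (n - 1)} {s : Shuffle n ν}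
    (hs : s.color (lo b) ≠ s.color (hi b)) :
    ψ b * tau ψ (shuffleE hβ e s₀) s = tau ψ (shuffleE hβ e s₀) (s.step b) := by
  rcases hs.lt_or_gt with h | h
  · rw [hR.tau_of_descent hβ hdisj hs₀ (s.step b) b (by simpa [Shuffle.color_step] using h),
      Shuffle.step_step]
  · have hne : (s.step b).color (lo b) ≠ (s.step b).color (hi b) := by
      simpa [Shuffle.color_step] using h.ne
    rw [hR.tau_of_descent hβ hdisj hs₀ s b h, ← hR.shuffleE_mul_tau hβ hs₀ (s.step b), ← mul_assoc,
      ← mul_assoc, hR.psi_psi_shuffleE hβ hdisj hne, hR.shuffleE_mul_tau hβ hs₀]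

-- Across colours `ψ_b` passes `y` without correction, so `y` follows its letter from its place in
-- `s` to its place in `s₀`.
omit hdisj in
theorem y_mul_tau (s : Shuffle n ν) : ∀ a : Fin n,
    y a * tau ψ (shuffleE hβ e s₀) s = tau ψ (shuffleE hβ e s₀) s * y (s₀.1.symm (s.1 a)) := by
  induction s using Shuffle.lex_induction with
  | h s ih =>
    intro a
    obtain ⟨rfl, h1, -⟩ | ⟨b, hb, h1, -⟩ := tau_cases ψ (shuffleE hβ e s₀) hs₀ s
    · rw [h1, hR.y_mul_shuffleE, Equiv.symm_apply_apply]
    · have hne : (s.step b).color (lo b) ≠ (s.step b).color (hi b) := by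
        simpa [Shuffle.color_step] using hb.ne
      have h := hR.psi_y_shuffleE hβ hne (r b a)
      rw [r_r] at h
      have ih' := ih _ (Shuffle.step_lex_lt hb) (r b a)
      rw [Shuffle.step_apply hb.ne', r_r] at ih'
      rw [h1, mul_assoc, ← ih', ← hR.shuffleE_mul_tau hβ hs₀ (s.step b)]
      simp only [← mul_assoc]
      rw [h]

/-- Consecutive letters of one colour are carried together to their places in `s₀`. A distant
descent commutes with `ψ b`. At an adjacent descent a letter of another colour has to pass both
letters, and the braid relation, exact here, moves the crossing of the pair from `b` to `c`. -/
theorem psi_mul_tau_of_eq (s : Shuffle n ν) : ∀ (b b₀ : Fin (n - 1)),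
    s.1 (lo b) = s₀.1 (lo b₀) → s.1 (hi b) = s₀.1 (hi b₀) → s.color (lo b) = s.color (hi b) →
    ψ b * tau ψ (shuffleE hβ e s₀) s = tau ψ (shuffleE hβ e s₀) s * ψ b₀ := by
  induction s using Shuffle.lex_induction with
  | h s ih =>
    intro b b₀ h1 h2 hs
    obtain ⟨rfl, h3, -⟩ | ⟨c, hc, h3, -⟩ := tau_cases ψ (shuffleE hβ e s₀) hs₀ s
    · have : b = b₀ := by
        have := s.1.injective h1
        simpa [lo, Fin.ext_iff] using this
      subst this
      rw [h3, hR.psi_mul_shuffleE, Shuffle.step_of_eq hs]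
    · have l1 := Shuffle.step_lex_lt hc
      have hcb : c ≠ b := by
        rintro rfl
        exact hc.ne' hs
      by_cases hfar : (b : ℕ) + 1 < c ∨ (c : ℕ) + 1 < b
      · have e1 : r c (lo b) = lo b := by
          apply r_of_ne <;> simp only [ne_eq, Fin.ext_iff, lo, hi] <;> omega
        have e2 : r c (hi b) = hi b := by
          apply r_of_ne <;> simp only [ne_eq, Fin.ext_iff, lo, hi] <;> omega
        rw [h3, ← mul_assoc, hR.psi_mul_psi _ _ hfar, mul_assoc, ih _ l1 b b₀, ← mul_assoc]
        · rw [Shuffle.step_apply hc.ne', e1, h1]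
        · rw [Shuffle.step_apply hc.ne', e2, h2]
        · simpa only [Shuffle.color_step, e1, e2] using hs
      rcases (show (c : ℕ) = b + 1 ∨ (b : ℕ) = c + 1 by
        have : (c : ℕ) ≠ b := fun h => hcb (Fin.ext h)
        omega) with hc1 | hc1
      · have e1 : hi b = lo c := hi_eq_lo hc1
        have e2 : r c (lo b) = lo b := r_of_ne (e1 ▸ lo_ne_hi b) (lo_ne_hi_succ hc1)
        have e3 : r b (hi c) = hi c := r_of_ne (lo_ne_hi_succ hc1).symm (e1 ▸ (lo_ne_hi c).symm)
        have e4 : r b (lo c) = lo b := by rw [← e1, r_hi]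
        have e5 : r b (lo b) = lo c := by rw [r_lo, e1]
        rw [e1] at hs h2
        -- Having passed the right letter of the pair, the smaller colour stands to the right of the
        -- left one.
        have d1 : (s.step c).color (hi b) < (s.step c).color (lo b) := by
          simpa only [Shuffle.color_step, e1, e2, r_lo, hs] using hc
        have l2 := (Shuffle.step_lex_lt d1).trans l1
        rw [h3, hR.tau_of_descent hβ hdisj hs₀ _ b d1, ← hR.braid_tau hβ hdisj hs₀ hc1,
          ih _ l2 c b₀, mul_assoc, mul_assoc]
        · rw [Shuffle.step_apply d1.ne', e4, Shuffle.step_apply hc.ne', e2, h1]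
        · rw [Shuffle.step_apply d1.ne', e3, Shuffle.step_apply hc.ne', r_hi, h2]
        · simpa only [Shuffle.color_step, e1, e2, e3, e4, r_hi] using hs
        · rintro ⟨h, -⟩
          simp only [Shuffle.color_step, e2, e4, e5, r_lo] at h
          exact hc.ne (h.trans hs)
      · have e1 : hi c = lo b := hi_eq_lo hc1
        have e2 : r b (lo c) = lo c := r_of_ne (e1 ▸ lo_ne_hi c) (lo_ne_hi_succ hc1)
        have e3 : r c (hi b) = hi b := r_of_ne (lo_ne_hi_succ hc1).symm (e1 ▸ (lo_ne_hi b).symm)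
        have e4 : r c (lo b) = lo c := by rw [← e1, r_hi]
        have e5 : r c (lo c) = lo b := by rw [r_lo, e1]
        have hc' := hc
        rw [e1] at hc'
        -- The mirror case: the larger colour has passed the left letter of the pair and must still
        -- pass the right one.
        have d1 : (s.step c).color (hi b) < (s.step c).color (lo b) := by
          simpa only [Shuffle.color_step, e3, e4, ← hs] using hc'
        have l2 := (Shuffle.step_lex_lt d1).trans l1
        rw [h3, hR.tau_of_descent hβ hdisj hs₀ _ b d1, hR.braid_tau hβ hdisj hs₀ hc1,
          ih _ l2 c b₀, mul_assoc, mul_assoc]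
        · rw [Shuffle.step_apply d1.ne', e2, Shuffle.step_apply hc.ne', e5, h1]
        · rw [e1, Shuffle.step_apply d1.ne', r_lo, Shuffle.step_apply hc.ne', e3, h2]
        · simpa only [Shuffle.color_step, e1, e2, e3, e5, r_lo] using hs
        · rintro ⟨-, h⟩
          simp only [Shuffle.color_step, e3, e4, r_lo, r_hi] at h
          exact hc'.ne (hs.trans h)

end IsRep

end Tau

/-! ### Corner algebras -/

section Corner

variable {K : Type v} [CommRing K] {B : Type*} [Ring B] [Algebra K B] {e₀ : B}
  (he : IsIdempotentElem e₀)

/-- The inclusion of a corner. -/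
def cornerVal : he.Corner →+ B where
  toFun x := x.1
  map_zero' := rfl
  map_add' _ _ := rfl

theorem cornerVal_mul (x z : he.Corner) :
    cornerVal he (x * z) = cornerVal he x * cornerVal he z := rfl

theorem cornerVal_one : cornerVal he 1 = e₀ := rfl

theorem mul_cornerVal (x : he.Corner) : e₀ * cornerVal he x = cornerVal he x :=
  ((Subsemigroup.mem_corner_iff he).1 x.2).1

theorem cornerVal_mul_self (x : he.Corner) : cornerVal he x * e₀ = cornerVal he x :=
  ((Subsemigroup.mem_corner_iff he).1 x.2).2

/-- The scalars of a corner. -/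
noncomputable def cornerScalar : K →+* he.Corner where
  toFun c := ⟨c • e₀, (Subsemigroup.mem_corner_iff he).2
    ⟨by rw [mul_smul_comm, he.eq], by rw [smul_mul_assoc, he.eq]⟩⟩
  map_zero' := Subtype.ext (zero_smul _ _)
  map_one' := Subtype.ext (one_smul _ _)
  map_add' c c' := Subtype.ext (add_smul _ _ _)
  map_mul' c c' := Subtype.ext (by
    change (c * c') • e₀ = (c • e₀) * (c' • e₀)
    rw [smul_mul_smul_comm, he.eq])

noncomputable instance cornerAlgebra : Algebra K he.Corner :=
  (cornerScalar (K := K) he).toAlgebra' fun c x => Subtype.ext (by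
    change (c • e₀) * cornerVal he x = cornerVal he x * (c • e₀)
    rw [mul_smul_comm, smul_mul_assoc, mul_cornerVal, cornerVal_mul_self])

theorem cornerVal_smul (c : K) (x : he.Corner) : cornerVal he (c • x) = c • cornerVal he x := by
  rw [Algebra.smul_def, cornerVal_mul]
  change (c • e₀) * cornerVal he x = _
  rw [smul_mul_assoc, mul_cornerVal]

variable (K) in
/-- The projection to the corner from the centralizer of the idempotent. -/
noncomputable def toCorner : Subalgebra.centralizer K {e₀} →ₐ[K] he.Corner where
  toFun x := ⟨x.1 * e₀, (Subsemigroup.mem_corner_iff he).2 ⟨by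
    rw [← mul_assoc, (Subalgebra.mem_centralizer_iff K).1 x.2 e₀ rfl, mul_assoc, he.eq],
    by rw [mul_assoc, he.eq]⟩⟩
  map_zero' := Subtype.ext (zero_mul _)
  map_one' := Subtype.ext (one_mul _)
  map_add' x z := Subtype.ext (add_mul _ _ _)
  map_mul' x z := Subtype.ext (by
    change x.1 * z.1 * e₀ = x.1 * e₀ * (z.1 * e₀)
    rw [← mul_assoc, mul_assoc x.1 e₀, (Subalgebra.mem_centralizer_iff K).1 z.2 e₀ rfl, ← mul_assoc,
      mul_assoc _ e₀, he.eq])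
  commutes' c := Subtype.ext (by
    change algebraMap K B c * e₀ = c • e₀
    rw [Algebra.smul_def])

end Corner

/-! ### The representations of the algebras of the parts in a corner -/

section Iota

variable {K : Type v} [CommRing K] {I : Type u} {Γ : Quiver.{w} I} {d n : ℕ} {p : I → Fin d}
  {ν : Fin d → ℕ} {α : ∀ j, Set (Fin (ν j) → part p j)} [∀ j, Finite (α j)]
  {β : Set (Fin n → I)} {B : Type*} [Ring B] [Algebra K B] {y : Fin n → B} {ψ : Fin (n - 1) → B}
  {e : β → B} {s₀ : Shuffle n ν}

/-- The place of a letter of a word in the sorted shuffle. -/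
noncomputable def place (s₀ : Shuffle n ν) (j : Fin d) (a : Fin (ν j)) : Fin n := s₀.1.symm ⟨j, a⟩

theorem apply_place (s₀ : Shuffle n ν) (j : Fin d) (a : Fin (ν j)) :
    s₀.1 (place s₀ j a) = ⟨j, a⟩ := s₀.1.apply_symm_apply _

omit [∀ j, Finite (α j)] in
theorem tuple_place (s₀ : Shuffle n ν) (k : ∀ j, α j) (j : Fin d) (a : Fin (ν j)) :
    tuple s₀ k (place s₀ j a) = ((k j).1 a).1 := by
  rw [tuple, apply_place, letter_mk]

/-- The place of two consecutive letters of a word in the sorted shuffle. -/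
noncomputable def place₂ (hs₀ : Monotone s₀.color) (j : Fin d) (c : Fin (ν j - 1)) : Fin (n - 1) :=
  (Shuffle.exists_neighbour hs₀ j c).choose

theorem apply_lo_place₂ (hs₀ : Monotone s₀.color) (j : Fin d) (c : Fin (ν j - 1)) :
    s₀.1 (lo (place₂ hs₀ j c)) = ⟨j, lo c⟩ :=
  (Shuffle.exists_neighbour hs₀ j c).choose_spec.1

theorem apply_hi_place₂ (hs₀ : Monotone s₀.color) (j : Fin d) (c : Fin (ν j - 1)) :
    s₀.1 (hi (place₂ hs₀ j c)) = ⟨j, hi c⟩ :=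
  (Shuffle.exists_neighbour hs₀ j c).choose_spec.2

theorem lo_place₂ (hs₀ : Monotone s₀.color) (j : Fin d) (c : Fin (ν j - 1)) :
    lo (place₂ hs₀ j c) = place s₀ j (lo c) :=
  (Equiv.eq_symm_apply _).2 (apply_lo_place₂ hs₀ j c)

theorem hi_place₂ (hs₀ : Monotone s₀.color) (j : Fin d) (c : Fin (ν j - 1)) :
    hi (place₂ hs₀ j c) = place s₀ j (hi c) :=
  (Equiv.eq_symm_apply _).2 (apply_hi_place₂ hs₀ j c)

theorem r_place₂ (hs₀ : Monotone s₀.color) (j : Fin d) (c : Fin (ν j - 1)) (a : Fin (ν j)) :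
    r (place₂ hs₀ j c) (place s₀ j a) = place s₀ j (r c a) :=
  (Equiv.eq_symm_apply _).2
    (Shuffle.apply_r (apply_lo_place₂ hs₀ j c) (apply_hi_place₂ hs₀ j c) (apply_place s₀ j a))

theorem step_place₂ (hs₀ : Monotone s₀.color) (j : Fin d) (c : Fin (ν j - 1)) :
    s₀.step (place₂ hs₀ j c) = s₀ :=
  Shuffle.step_of_eq (by
    rw [Shuffle.color, Shuffle.color, apply_lo_place₂, apply_hi_place₂])

theorem place₂_far (hs₀ : Monotone s₀.color) (j : Fin d) {c c' : Fin (ν j - 1)}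
    (h : (c : ℕ) + 1 < c') : (place₂ hs₀ j c : ℕ) + 1 < place₂ hs₀ j c' := by
  have : place s₀ j (hi c) < place s₀ j (lo c') := Shuffle.symm_lt_symm.2 h
  rw [← hi_place₂ hs₀, ← lo_place₂ hs₀] at this
  exact this

theorem place₂_succ (hs₀ : Monotone s₀.color) (j : Fin d) {c c' : Fin (ν j - 1)}
    (h : (c' : ℕ) = c + 1) : (place₂ hs₀ j c' : ℕ) = place₂ hs₀ j c + 1 := by
  have : lo (place₂ hs₀ j c') = hi (place₂ hs₀ j c) := by
    rw [lo_place₂, hi_place₂, hi_eq_lo h]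
  exact congrArg Fin.val this

open Classical in
/-- The sum of the idempotents of the sorted tuples whose `j`-th word is given. -/
noncomputable def wordE (hβ : IsShuffleSet β α) (e : β → B) (s₀ : Shuffle n ν) (j : Fin d)
    (i : α j) : B :=
  ∑ᶠ k : ∀ j, α j, if k j = i then e (hβ.idx (s₀, k)) else 0

namespace IsRep

variable (hR : IsRep Γ β y ψ e) (hβ : IsShuffleSet β α)
include hR

theorem isIdempotentElem_shuffleE (s : Shuffle n ν) : IsIdempotentElem (shuffleE hβ e s) :=
  hR.shuffleE_mul_self hβ s

open Classical in
theorem wordE_mul_e (j : Fin d) (i : α j) (k : ∀ j, α j) :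
    wordE hβ e s₀ j i * e (hβ.idx (s₀, k)) = if k j = i then e (hβ.idx (s₀, k)) else 0 := by
  rw [wordE, finsum_mul_of_finite, finsum_eq_single _ k]
  · split_ifs <;> simp [hR.e_mul_self]
  · intro l hl
    have : e (hβ.idx (s₀, l)) * e (hβ.idx (s₀, k)) = 0 :=
      hR.e_mul_ne _ _ fun h => hl (by simpa using hβ.idx.injective h)
    split_ifs <;> simp [this]

theorem wordE_mul_shuffleE (j : Fin d) (i : α j) :
    wordE hβ e s₀ j i * shuffleE hβ e s₀ = wordE hβ e s₀ j i := by
  rw [wordE, finsum_mul_of_finite]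
  refine finsum_congr fun k => ?_
  split_ifs
  · exact hR.e_mul_shuffleE hβ _ _
  · exact zero_mul _

theorem shuffleE_mul_wordE (j : Fin d) (i : α j) :
    shuffleE hβ e s₀ * wordE hβ e s₀ j i = wordE hβ e s₀ j i := by
  rw [wordE, mul_finsum_of_finite]
  refine finsum_congr fun k => ?_
  split_ifs
  · exact hR.shuffleE_mul_e hβ _ _
  · exact mul_zero _

variable (K) in
/-- The element `y` as an element of the centralizer. -/
noncomputable def cenY (s₀ : Shuffle n ν) (a : Fin n) :
    Subalgebra.centralizer K {shuffleE hβ e s₀} :=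
  ⟨y a, (Subalgebra.mem_centralizer_iff K).2 fun _ h => by
    rw [Set.mem_singleton_iff.1 h, hR.y_mul_shuffleE]⟩

variable (K) in
/-- The element `ψ` as an element of the centralizer. -/
noncomputable def cenPsi (hs₀ : Monotone s₀.color) (j : Fin d) (c : Fin (ν j - 1)) :
    Subalgebra.centralizer K {shuffleE hβ e s₀} :=
  ⟨ψ (place₂ hs₀ j c), (Subalgebra.mem_centralizer_iff K).2 fun _ h => by
    rw [Set.mem_singleton_iff.1 h, hR.psi_mul_shuffleE, step_place₂]⟩

variable (K) in
/-- The idempotent of a word as an element of the centralizer. -/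
noncomputable def cenE (s₀ : Shuffle n ν) (j : Fin d) (i : α j) :
    Subalgebra.centralizer K {shuffleE hβ e s₀} :=
  ⟨wordE hβ e s₀ j i, (Subalgebra.mem_centralizer_iff K).2 fun _ h => by
    rw [Set.mem_singleton_iff.1 h, hR.wordE_mul_shuffleE, hR.shuffleE_mul_wordE]⟩

/-- The unit of the corner is the sum of the `e (s₀, k)`, so identities in the corner are checked on
single sorted tuples. In the variant below, a factor `cenE` leaves only the families with a
prescribed `j`-th word. -/
theorem toCorner_congr {x z : Subalgebra.centralizer K {shuffleE hβ e s₀}}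
    (h : ∀ k, x.1 * e (hβ.idx (s₀, k)) = z.1 * e (hβ.idx (s₀, k))) :
    toCorner K (hR.isIdempotentElem_shuffleE hβ s₀) x =
      toCorner K (hR.isIdempotentElem_shuffleE hβ s₀) z :=
  Subtype.ext (mul_shuffleE_congr hβ h)

theorem toCorner_congr_mul {x z : Subalgebra.centralizer K {shuffleE hβ e s₀}} {j : Fin d} {i : α j}
    (h : ∀ k, k j = i → x.1 * e (hβ.idx (s₀, k)) = z.1 * e (hβ.idx (s₀, k))) :
    toCorner K (hR.isIdempotentElem_shuffleE hβ s₀) (x * hR.cenE K hβ s₀ j i) =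
      toCorner K (hR.isIdempotentElem_shuffleE hβ s₀) (z * hR.cenE K hβ s₀ j i) := by
  refine hR.toCorner_congr hβ fun k => ?_
  change x.1 * wordE hβ e s₀ j i * _ = z.1 * wordE hβ e s₀ j i * _
  rw [mul_assoc, mul_assoc, hR.wordE_mul_e]
  split_ifs with hk
  · exact h k hk
  · rw [mul_zero, mul_zero]

variable (K) in
/-- The image of a generator of the algebra of the `j`-th part in the corner. -/
noncomputable def cornerGen (hs₀ : Monotone s₀.color) (j : Fin d) :
    Gen (α j) → (hR.isIdempotentElem_shuffleE hβ s₀).Corner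
  | Gen.y a => toCorner K _ (hR.cenY K hβ s₀ (place s₀ j a))
  | Gen.psi c => toCorner K _ (hR.cenPsi K hβ hs₀ j c)
  | Gen.e i => toCorner K _ (hR.cenE K hβ s₀ j i)

/-- In the sorted shuffle consecutive letters of a word are neighbours. The relations of the part
are therefore those of the whole algebra at the places of colour `j`, checked tuple by tuple. -/
theorem isRep_corner (hs₀ : Monotone s₀.color) (j : Fin d) :
    IsRep (Γ.fullSub (part p j)) (α j) (fun a => hR.cornerGen K hβ hs₀ j (Gen.y a))
      (fun c => hR.cornerGen K hβ hs₀ j (Gen.psi c))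
      (fun i => hR.cornerGen K hβ hs₀ j (Gen.e i)) := by
  constructor
  · simp only [cornerGen]
    rw [← map_finsum_of_finite, ← map_one (toCorner K (hR.isIdempotentElem_shuffleE hβ s₀))]
    refine hR.toCorner_congr hβ fun k => ?_
    rw [← Subalgebra.val_apply, map_finsum_of_finite, finsum_mul_of_finite, finsum_eq_single _ (k j)]
    · change wordE hβ e s₀ j (k j) * _ = _
      rw [hR.wordE_mul_e, if_pos rfl]
      exact (one_mul _).symm
    · intro i hi
      change wordE hβ e s₀ j i * _ = _
      rw [hR.wordE_mul_e, if_neg hi.symm]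
  · intro i
    simp only [cornerGen]
    rw [← map_mul]
    refine hR.toCorner_congr hβ fun k => ?_
    change wordE hβ e s₀ j i * wordE hβ e s₀ j i * _ = wordE hβ e s₀ j i * _
    rw [mul_assoc, hR.wordE_mul_e]
    split_ifs with hk
    · rw [hR.wordE_mul_e, if_pos hk]
    · rw [mul_zero]
  · intro i i' h
    simp only [cornerGen]
    rw [← map_mul, ← map_zero (toCorner K (hR.isIdempotentElem_shuffleE hβ s₀)),
      ← zero_mul (hR.cenE K hβ s₀ j i')]
    refine hR.toCorner_congr_mul hβ fun k hk => ?_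
    change wordE hβ e s₀ j i * _ = 0 * _
    rw [hR.wordE_mul_e, if_neg fun h' => h (h'.symm.trans hk), zero_mul]
  · intro a b
    simp only [cornerGen]
    rw [← map_mul, ← map_mul]
    congr 1
    exact Subtype.ext (hR.y_mul_y _ _)
  · intro a i
    simp only [cornerGen]
    rw [← map_mul, ← map_mul]
    refine hR.toCorner_congr hβ fun k => ?_
    change y _ * wordE hβ e s₀ j i * _ = wordE hβ e s₀ j i * y _ * _
    rw [mul_assoc, mul_assoc, hR.y_mul_e, ← mul_assoc (wordE _ _ _ _ _), hR.wordE_mul_e]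
    split_ifs
    · rw [hR.y_mul_e]
    · rw [mul_zero, zero_mul]
  · intro c i i' h
    simp only [cornerGen]
    rw [← map_mul, ← map_mul]
    refine hR.toCorner_congr hβ fun k => ?_
    change ψ _ * wordE hβ e s₀ j i * _ = wordE hβ e s₀ j i' * ψ _ * _
    have hψ := hR.psi_mul_e (place₂ hs₀ j c) (hβ.idx (s₀, k)) (hβ.idx (s₀, hβ.swapWord j c k))
      (hβ.idx_swapWord (apply_lo_place₂ hs₀ j c) (apply_hi_place₂ hs₀ j c) k)
    rw [mul_assoc, mul_assoc, hψ, ← mul_assoc (wordE _ _ _ _ _), hR.wordE_mul_e, hR.wordE_mul_e]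
    have : hβ.swapWord j c k j = i' ↔ k j = i := by
      rw [Subtype.ext_iff, Subtype.ext_iff, hβ.swapWord_same, h]
      exact (r c).surjective.injective_comp_right.eq_iff
    by_cases hk : k j = i
    · rw [if_pos hk, if_pos (this.2 hk), hψ]
    · rw [if_neg hk, if_neg (this.not.2 hk), mul_zero, zero_mul]
  · intro c i h
    simp only [cornerGen]
    rw [← map_mul, ← map_mul, ← map_sub, ← map_mul, ← map_neg, ← neg_one_mul (hR.cenE K hβ s₀ j i)]
    refine hR.toCorner_congr_mul hβ fun k hk => ?_
    subst hk
    change (ψ _ * y _ - y _ * ψ _) * _ = (-1) * _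
    rw [neg_one_mul, ← lo_place₂ hs₀, ← hi_place₂ hs₀]
    refine hR.psi_mul_y_lo _ _ ?_
    rw [IsShuffleSet.idx_val, lo_place₂, hi_place₂, tuple_place, tuple_place, h]
  · intro c i h
    simp only [cornerGen]
    rw [← map_mul, ← map_mul, ← map_sub, ← map_mul, ← one_mul (hR.cenE K hβ s₀ j i), ← mul_assoc,
      mul_one]
    refine hR.toCorner_congr_mul hβ fun k hk => ?_
    subst hk
    change (ψ _ * y _ - y _ * ψ _) * _ = 1 * _
    rw [one_mul, ← lo_place₂ hs₀, ← hi_place₂ hs₀]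
    refine hR.psi_mul_y_hi _ _ ?_
    rw [IsShuffleSet.idx_val, lo_place₂, hi_place₂, tuple_place, tuple_place, h]
  · intro c a i h
    simp only [cornerGen]
    rw [← map_mul, ← map_mul, ← map_sub, ← map_mul,
      ← map_zero (toCorner K (hR.isIdempotentElem_shuffleE hβ s₀)), ← zero_mul (hR.cenE K hβ s₀ j i)]
    refine hR.toCorner_congr_mul hβ fun k hk => ?_
    subst hk
    change (ψ _ * y _ - y _ * ψ _) * _ = 0 * _
    rw [zero_mul, ← r_place₂ hs₀]
    refine hR.psi_mul_y _ _ _ fun h' => h ⟨?_, ?_⟩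
    · refine h'.1.imp (fun h => ?_) (fun h => ?_)
      · rw [lo_place₂] at h
        simpa [place] using h
      · rw [hi_place₂] at h
        simpa [place] using h
    · have := h'.2
      rw [IsShuffleSet.idx_val, lo_place₂, hi_place₂, tuple_place, tuple_place] at this
      exact Subtype.ext this
  · intro a b h
    simp only [cornerGen]
    rw [← map_mul, ← map_mul]
    congr 1
    exact Subtype.ext (hR.psi_mul_psi _ _ (h.imp (place₂_far hs₀ j) (place₂_far hs₀ j)))
  · intro c i
    simp only [cornerGen]
    rw [← Quiver.map_polyQ, ← map_mul, ← map_mul, ← map_mul]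
    refine hR.toCorner_congr_mul hβ fun k hk => ?_
    subst hk
    rw [← Subalgebra.val_apply, ← Subalgebra.val_apply, Quiver.map_polyQ, Quiver.polyQ_fullSub]
    have := hR.psi_sq (place₂ hs₀ j c) (hβ.idx (s₀, k))
    rw [IsShuffleSet.idx_val, lo_place₂, hi_place₂, tuple_place, tuple_place] at this
    exact this
  · intro b c hc i h
    simp only [cornerGen]
    rw [← Quiver.map_dividedQ]
    simp only [← map_mul, ← map_sub]
    refine hR.toCorner_congr_mul hβ fun k hk => ?_
    subst hk
    rw [← Subalgebra.val_apply, ← Subalgebra.val_apply, Quiver.map_dividedQ,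
      Quiver.dividedQ_fullSub]
    have := hR.braid_eq (place₂ hs₀ j b) (place₂ hs₀ j c) (place₂_succ hs₀ j hc) (hβ.idx (s₀, k))
    rw [IsShuffleSet.idx_val, lo_place₂, hi_place₂, hi_place₂, tuple_place, tuple_place,
      tuple_place] at this
    exact this (congrArg Subtype.val h)
  · intro b c hc i h
    simp only [cornerGen]
    simp only [← map_mul, ← map_sub]
    rw [← map_zero (toCorner K (hR.isIdempotentElem_shuffleE hβ s₀)),
      ← zero_mul (hR.cenE K hβ s₀ j i)]
    refine hR.toCorner_congr_mul hβ fun k hk => ?_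
    subst hk
    have := hR.braid_ne (place₂ hs₀ j b) (place₂ hs₀ j c) (place₂_succ hs₀ j hc) (hβ.idx (s₀, k))
    rw [IsShuffleSet.idx_val, lo_place₂, hi_place₂, tuple_place, tuple_place] at this
    refine Eq.trans (this fun h' => h (Subtype.ext h')) ?_
    exact (zero_mul _).symm

/-- Different parts occupy disjoint sets of places in the sorted shuffle. -/
theorem cornerGen_comm (hs₀ : Monotone s₀.color) {j j' : Fin d} (hj : j ≠ j') (g : Gen (α j))
    (g' : Gen (α j')) : hR.cornerGen K hβ hs₀ j g * hR.cornerGen K hβ hs₀ j' g' =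
      hR.cornerGen K hβ hs₀ j' g' * hR.cornerGen K hβ hs₀ j g := by
  have hψy : ∀ {j j' : Fin d} (_ : j ≠ j') (c : Fin (ν j - 1)) (a : Fin (ν j')),
      hR.cornerGen K hβ hs₀ j (Gen.psi c) * hR.cornerGen K hβ hs₀ j' (Gen.y a) =
      hR.cornerGen K hβ hs₀ j' (Gen.y a) * hR.cornerGen K hβ hs₀ j (Gen.psi c) := by
    intro j j' hj c a
    simp only [cornerGen]
    rw [← map_mul, ← map_mul]
    refine hR.toCorner_congr hβ fun k => ?_
    have h1 : place s₀ j' a ≠ lo (place₂ hs₀ j c) := by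
      rw [lo_place₂]
      intro h
      exact hj (congrArg Sigma.fst (s₀.1.symm.injective h)).symm
    have h2 : place s₀ j' a ≠ hi (place₂ hs₀ j c) := by
      rw [hi_place₂]
      intro h
      exact hj (congrArg Sigma.fst (s₀.1.symm.injective h)).symm
    have := hR.psi_mul_y (place₂ hs₀ j c) (place s₀ j' a) (hβ.idx (s₀, k))
      fun h => h.1.elim h1 h2
    rw [r_of_ne h1 h2, sub_mul, sub_eq_zero] at this
    exact this
  have hye : ∀ {j j' : Fin d} (_ : j ≠ j') (a : Fin (ν j)) (i : α j'),
      hR.cornerGen K hβ hs₀ j (Gen.y a) * hR.cornerGen K hβ hs₀ j' (Gen.e i) =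
      hR.cornerGen K hβ hs₀ j' (Gen.e i) * hR.cornerGen K hβ hs₀ j (Gen.y a) := by
    intro j j' hj a i
    simp only [cornerGen]
    rw [← map_mul, ← map_mul]
    refine hR.toCorner_congr hβ fun k => ?_
    change y _ * wordE hβ e s₀ j' i * _ = wordE hβ e s₀ j' i * y _ * _
    rw [mul_assoc, mul_assoc, hR.y_mul_e, ← mul_assoc (wordE _ _ _ _ _), hR.wordE_mul_e]
    split_ifs
    · rw [hR.y_mul_e]
    · rw [mul_zero, zero_mul]
  have hψe : ∀ {j j' : Fin d} (_ : j ≠ j') (c : Fin (ν j - 1)) (i : α j'),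
      hR.cornerGen K hβ hs₀ j (Gen.psi c) * hR.cornerGen K hβ hs₀ j' (Gen.e i) =
      hR.cornerGen K hβ hs₀ j' (Gen.e i) * hR.cornerGen K hβ hs₀ j (Gen.psi c) := by
    intro j j' hj c i
    simp only [cornerGen]
    rw [← map_mul, ← map_mul]
    refine hR.toCorner_congr hβ fun k => ?_
    change ψ _ * wordE hβ e s₀ j' i * _ = wordE hβ e s₀ j' i * ψ _ * _
    have hψ := hR.psi_mul_e (place₂ hs₀ j c) (hβ.idx (s₀, k)) (hβ.idx (s₀, hβ.swapWord j c k))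
      (hβ.idx_swapWord (apply_lo_place₂ hs₀ j c) (apply_hi_place₂ hs₀ j c) k)
    rw [mul_assoc, mul_assoc, hψ, ← mul_assoc (wordE _ _ _ _ _), hR.wordE_mul_e, hR.wordE_mul_e,
      hβ.swapWord_ne hj.symm]
    split_ifs
    · rw [hψ]
    · rw [mul_zero, zero_mul]
  cases g with
  | y a =>
    cases g' with
    | y a' =>
      simp only [cornerGen]
      rw [← map_mul, ← map_mul]
      congr 1
      exact Subtype.ext (hR.y_mul_y _ _)
    | psi c' => exact (hψy hj.symm c' a).symm
    | e i' => exact hye hj a i'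
  | psi c =>
    cases g' with
    | y a' => exact hψy hj c a'
    | psi c' =>
      simp only [cornerGen]
      rw [← map_mul, ← map_mul]
      congr 1
      refine Subtype.ext (hR.psi_mul_psi _ _ ?_)
      -- Equal or adjacent indices would make two crossings share a place, which would then have two
      -- colours.
      have key : ∀ {j j' : Fin d} (_ : j ≠ j') (c : Fin (ν j - 1)) (c' : Fin (ν j' - 1)),
          (place₂ hs₀ j c : ℕ) ≠ place₂ hs₀ j' c' ∧ (place₂ hs₀ j c : ℕ) + 1 ≠ place₂ hs₀ j' c' := by
        intro j j' hj c c'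
        refine ⟨fun h => hj ?_, fun h => hj ?_⟩
        · have h1 := apply_lo_place₂ hs₀ j c
          rw [Fin.ext h, apply_lo_place₂] at h1
          exact (congrArg Sigma.fst h1).symm
        · have h1 := apply_hi_place₂ hs₀ j c
          rw [hi_eq_lo h.symm, apply_lo_place₂] at h1
          exact (congrArg Sigma.fst h1).symm
      have h1 := key hj c c'
      have h2 := key hj.symm c' c
      omega
    | e i' => exact hψe hj c i'
  | e i =>
    cases g' with
    | y a' => exact (hye hj.symm a' i).symm
    | psi c' => exact (hψe hj.symm c' i).symm
    | e i' =>
      simp only [cornerGen]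
      rw [← map_mul, ← map_mul]
      refine hR.toCorner_congr hβ fun k => ?_
      change wordE hβ e s₀ j i * wordE hβ e s₀ j' i' * _ =
        wordE hβ e s₀ j' i' * wordE hβ e s₀ j i * _
      rw [mul_assoc, mul_assoc, hR.wordE_mul_e, hR.wordE_mul_e]
      split_ifs with h1 h2 h2 <;> simp [hR.wordE_mul_e, h1, h2]

end IsRep

end Iota

/-! ### Homomorphisms from tensor products of algebras -/

section TensorLift

open PiTensorProduct

theorem prod_ofFn_mul {C : Type*} [Monoid C] {d : ℕ} (a b : Fin d → C)
    (h : ∀ i j, i ≠ j → Commute (b i) (a j)) :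
    (List.ofFn fun i => a i * b i).prod = (List.ofFn a).prod * (List.ofFn b).prod := by
  induction d with
  | zero => simp
  | succ d ih =>
    simp only [List.ofFn_succ, List.prod_cons]
    rw [ih _ _ fun i j hij => h _ _ (by simpa using hij)]
    have : Commute (b 0) (List.ofFn fun i : Fin d => a i.succ).prod := by
      refine Commute.list_prod_right _ _ fun x hx => ?_
      obtain ⟨i, rfl⟩ := (List.mem_ofFn' _ _).1 hx
      exact h _ _ (Fin.succ_ne_zero i).symm
    simp only [mul_assoc]
    rw [← mul_assoc (b 0), this.eq, mul_assoc]

theorem prod_ofFn_eq_single {C : Type*} [Monoid C] {d : ℕ} (a : Fin d → C) (j : Fin d)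
    (h : ∀ i, i ≠ j → a i = 1) : (List.ofFn a).prod = a j := by
  induction d with
  | zero => exact j.elim0
  | succ d ih =>
    rw [List.ofFn_succ, List.prod_cons]
    rcases Fin.eq_zero_or_eq_succ j with rfl | ⟨j, rfl⟩
    · have : (List.ofFn fun i : Fin d => a i.succ) = List.replicate d 1 := by
        rw [← List.ofFn_const]
        congr 1
        funext i
        exact h _ (Fin.succ_ne_zero i)
      rw [this]
      simp
    · rw [h 0 (Fin.succ_ne_zero j).symm, one_mul, ih (fun i => a i.succ) j]
      intro i hi
      exact h _ (by simpa using hi)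

variable {K : Type*} [CommRing K] {d : ℕ} {A : Fin d → Type*} [∀ j, Ring (A j)]
  [∀ j, Algebra K (A j)] {C : Type*} [Ring C] [Algebra K C] (f : ∀ j, A j →ₐ[K] C)
  (hf : ∀ j j', j ≠ j' → ∀ x z, Commute (f j x) (f j' z))

/-- The homomorphism defined on a tensor product by commuting homomorphisms on the factors. -/
noncomputable def tensorLift : (⨂[K] j, A j) →ₐ[K] C :=
  liftAlgHom ((MultilinearMap.mkPiAlgebraFin K d C).compLinearMap fun j => (f j).toLinearMap)
    (by
      have : (fun j => (f j).toLinearMap ((1 : ∀ j, A j) j)) = fun _ => 1 := by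
        funext j
        exact map_one (f j)
      rw [MultilinearMap.compLinearMap_apply, MultilinearMap.mkPiAlgebraFin_apply, this]
      simp)
    (fun x z => by
      simp only [MultilinearMap.compLinearMap_apply, MultilinearMap.mkPiAlgebraFin_apply]
      rw [← prod_ofFn_mul]
      · congr 2
        funext j
        exact map_mul (f j) _ _
      · intro i j hij
        exact hf _ _ hij _ _)

theorem tensorLift_tprod (x : ∀ j, A j) :
    tensorLift f hf (PiTensorProduct.tprod K x) = (List.ofFn fun j => f j (x j)).prod := by
  rw [tensorLift, liftAlgHom_apply, lift.tprod]
  rfl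

theorem tensorLift_single (j : Fin d) (x : A j) :
    tensorLift f hf (singleAlgHom j x) = f j x := by
  rw [singleAlgHom_apply, tensorLift_tprod, prod_ofFn_eq_single _ j]
  · simp
  · intro i hi
    simp [hi]

end TensorLift

/-! ### Reduction to generators -/

section Generation

variable {K : Type v} [CommRing K] {I : Type u} {Γ : Quiver.{w} I} {n : ℕ} {α : Set (Fin n → I)}
  [Finite α] {A : Type*} [Ring A] [Algebra K A] {q : Alg K Γ α →ₐ[K] A}

theorem mem_subalgebra_of_gen (hq : Function.Surjective q) (S : Subalgebra K A)
    (h : ∀ g, q (gen K Γ α g) ∈ S) (x : A) : x ∈ S := by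
  obtain ⟨x, rfl⟩ := hq x
  have : (Algebra.adjoin K (Set.range (gen K Γ α))) ≤ S.comap q := by
    refine Algebra.adjoin_le ?_
    rintro _ ⟨g, rfl⟩
    exact h g
  rw [adjoin_gen] at this
  exact this (Algebra.mem_top (x := x))

theorem commute_of_gen (hq : Function.Surjective q) {C : Type*} [Ring C] [Algebra K C]
    (f : A →ₐ[K] C) {c : C} (h : ∀ g, Commute c (f (q (gen K Γ α g)))) (x : A) :
    Commute c (f x) := by
  have := mem_subalgebra_of_gen hq ((Subalgebra.centralizer K {c}).comap f)
    (fun g => (Subalgebra.mem_centralizer_iff K).2 fun _ hx => by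
      rw [Set.mem_singleton_iff.1 hx]
      exact (h g).eq) x
  exact (Subalgebra.mem_centralizer_iff K).1 this c rfl

end Generation

/-! ### The inverse of the matrix representation -/

section Inverse

variable {K : Type v} [CommRing K] {I : Type u} {Γ : Quiver.{w} I} {d n : ℕ} {p : I → Fin d}
  {ν : Fin d → ℕ} {α : ∀ j, Set (Fin (ν j) → part p j)} [∀ j, Finite (α j)]
  {β : Set (Fin n → I)} {B : Type*} [Ring B] [Algebra K B] {y : Fin n → B} {ψ : Fin (n - 1) → B}
  {e : β → B} {s₀ : Shuffle n ν}
  {A : Fin d → Type*} [∀ j, Ring (A j)] [∀ j, Algebra K (A j)]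
  {q : ∀ j, Alg K (Γ.fullSub (part p j)) (α j) →ₐ[K] A j}

/-- Brings the idempotents into the same shape as `yMat` and `psiMat`, so that one lemma treats all
generators. -/
theorem single_eq_colMatrix {T D : Type*} [DecidableEq T] [Zero D] (s : T) (x : D) :
    Matrix.single s s x = colMatrix id (Pi.single s x) := by
  ext t u
  rw [colMatrix_apply, Matrix.single_apply]
  by_cases h : u = s
  · subst h
    by_cases h' : t = u <;> simp [h', eq_comm]
  · simp [h, Ne.symm h]

/-- The linear map that sends a matrix unit to the product of the elements that go from a shuffle
to the sorted shuffle and back, with the coefficient inserted. -/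
noncomputable def matrixToAlg {e₀ : B} (he : IsIdempotentElem e₀) (ψ : Fin (n - 1) → B) {D : Type*}
    [Ring D] [Algebra K D] (ι : D →ₐ[K] he.Corner) (M : Matrix (Shuffle n ν) (Shuffle n ν) D) : B :=
  ∑ s, ∑ t, tau ψ e₀ s * cornerVal he (ι (M s t)) * tauInv ψ e₀ t

/-- The hypothesis says that `g` acts on the elements `tau` as `colMatrix f c` acts on columns.
Compatibility with left multiplication is enough for a left inverse, so multiplicativity of
`matrixToAlg` is not needed. -/
theorem matrixToAlg_colMatrix_mul {e₀ : B} (he : IsIdempotentElem e₀) {D : Type*}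
    [Ring D] [Algebra K D] (ι : D →ₐ[K] he.Corner) {f : Shuffle n ν → Shuffle n ν}
    {c : Shuffle n ν → D} {g : B}
    (h : ∀ s, g * tau ψ e₀ s = tau ψ e₀ (f s) * cornerVal he (ι (c s)))
    (M : Matrix (Shuffle n ν) (Shuffle n ν) D) :
    matrixToAlg he ψ ι (colMatrix f c * M) = g * matrixToAlg he ψ ι M := by
  have h1 : ∀ s t, (colMatrix f c * M) s t = ∑ u, if s = f u then c u * M u t else 0 := by
    intro s t
    rw [Matrix.mul_apply]
    refine Finset.sum_congr rfl fun u _ => ?_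
    rw [colMatrix_apply]
    split_ifs <;> simp
  simp only [matrixToAlg, h1, map_sum, Finset.mul_sum, Finset.sum_mul]
  rw [Finset.sum_comm]
  conv_rhs => rw [Finset.sum_comm]
  refine Finset.sum_congr rfl fun t _ => ?_
  rw [Finset.sum_comm]
  refine Finset.sum_congr rfl fun u _ => ?_
  rw [Finset.sum_eq_single (f u)]
  · rw [if_pos rfl, map_mul, cornerVal_mul, ← mul_assoc, ← mul_assoc, ← mul_assoc, ← h]
  · intro s _ hs
    rw [if_neg hs]
    simp
  · simp

namespace IsRep

variable (hR : IsRep Γ β y ψ e) (hβ : IsShuffleSet β α)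
  (hdisj : ∀ i j : I, p i ≠ p j → IsEmpty (Γ.Hom i j)) (hs₀ : Monotone s₀.color)

include hR hs₀ in
theorem e_mul_tau (s : Shuffle n ν) (k : ∀ j, α j) :
    e (hβ.idx (s, k)) * tau ψ (shuffleE hβ e s₀) s =
      tau ψ (shuffleE hβ e s₀) s * e (hβ.idx (s₀, k)) := by
  induction s using Shuffle.lex_induction with
  | h s ih =>
    obtain ⟨rfl, h1, -⟩ | ⟨b, hb, h1, -⟩ := tau_cases ψ (shuffleE hβ e s₀) hs₀ s
    · rw [h1, hR.shuffleE_mul_e, hR.e_mul_shuffleE]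
    · have hne : (s.step b).color (lo b) ≠ (s.step b).color (hi b) := by
        simpa [Shuffle.color_step] using hb.ne
      have h2 := hβ.idx_step hne k
      rw [Shuffle.step_step] at h2
      rw [h1, ← mul_assoc, ← hR.psi_mul_e b _ _ h2, mul_assoc, ih _ (Shuffle.step_lex_lt hb),
        mul_assoc]

variable {hR hβ hs₀} in
theorem commute_corner (hq : ∀ j, Function.Surjective (q j))
    {ι : ∀ j, A j →ₐ[K] (hR.isIdempotentElem_shuffleE hβ s₀).Corner}
    (hι : ∀ j g, ι j (q j (gen K _ _ g)) = hR.cornerGen K hβ hs₀ j g) (j j' : Fin d) (h : j ≠ j')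
    (x : A j) (z : A j') : Commute (ι j x) (ι j' z) := by
  refine commute_of_gen (hq j') (ι j') (fun g' => ?_) z
  refine (commute_of_gen (hq j) (ι j) (fun g => ?_) x).symm
  rw [hι, hι]
  exact (hR.cornerGen_comm hβ hs₀ h g g').symm

variable {ι : (⨂[K] j, A j) →ₐ[K] (hR.isIdempotentElem_shuffleE hβ s₀).Corner}
  (hι : ∀ j g, ι (tensorGen q j g) = hR.cornerGen K hβ hs₀ j g)
include hι

-- `ι` is known on generators only, so the element is identified through its products with all `e
-- (s₀, l)`. For `l ≠ k` a word in which the families differ makes the product vanish; the case `l =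
-- k` follows because the `tensorE` sum to `1`.
open Classical in
theorem iota_tensorE (k : ∀ j, α j) :
    cornerVal _ (ι (tensorE q k)) = e (hβ.idx (s₀, k)) := by
  have hB := blockRep_tensor q hβ.stable
  have h1 : ∀ k l : ∀ j, α j, l ≠ k →
      cornerVal _ (ι (tensorE q k)) * e (hβ.idx (s₀, l)) = 0 := by
    intro k l hlk
    obtain ⟨j, hj⟩ := Function.ne_iff.1 hlk
    have h2 : tensorE q k = tensorE q k * tensorGen q j (Gen.e (k j)) := by
      conv_lhs => rw [tensorE]
      rw [tensorE, tensorGen, tprod_mul_singleAlgHom]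
      rw [← map_mul, (isRep_gen K _ (α j)).e_mul_self, Function.update_eq_self]
    rw [h2, map_mul, hι, cornerVal_mul, mul_assoc]
    change _ * (wordE hβ e s₀ j (k j) * _ * _) = 0
    rw [mul_assoc (wordE _ _ _ _ _), hR.shuffleE_mul_e, hR.wordE_mul_e, if_neg hj, mul_zero]
  have h3 : ∀ k l : ∀ j, α j, cornerVal _ (ι (tensorE q k)) * e (hβ.idx (s₀, l)) =
      if l = k then e (hβ.idx (s₀, k)) else 0 := by
    intro k l
    split_ifs with h
    · subst h
      have h4 := congrArg (fun x => cornerVal _ (ι x) * e (hβ.idx (s₀, l))) hB.sum_E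
      simp only [map_one, cornerVal_one, map_finsum_of_finite, finsum_mul_of_finite] at h4
      rw [hR.shuffleE_mul_e, finsum_eq_single _ l] at h4
      · exact h4
      · exact fun k hk => h1 k l hk.symm
    · exact h1 k l h
  refine (cornerVal_mul_self _ _).symm.trans ?_
  change cornerVal _ (ι (tensorE q k)) * (∑ᶠ l, e (hβ.idx (s₀, l))) = _
  rw [mul_finsum_of_finite]
  rw [finsum_eq_single _ k]
  · rw [h3, if_pos rfl]
  · intro l hl
    rw [h3, if_neg hl]

theorem y_mul_tau_eq (a : Fin n) (s : Shuffle n ν) :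
    y a * tau ψ (shuffleE hβ e s₀) s = tau ψ (shuffleE hβ e s₀) s *
      cornerVal _ (ι (posY (fun j a => tensorGen q j (Gen.y a)) (s.1 a))) := by
  rw [hR.y_mul_tau hβ hs₀, posY, hι]
  change _ = _ * (y (place s₀ (s.1 a).1 (s.1 a).2) * shuffleE hβ e s₀)
  rw [hR.y_mul_shuffleE, ← mul_assoc, hR.tau_mul_shuffleE hβ hs₀]
  rfl

include hdisj in
theorem psi_mul_tau_eq (b : Fin (n - 1)) (s : Shuffle n ν) :
    ψ b * tau ψ (shuffleE hβ e s₀) s = tau ψ (shuffleE hβ e s₀) (s.step b) *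
      cornerVal _ (ι (psiCoef (fun j c => tensorGen q j (Gen.psi c)) b s)) := by
  by_cases hs : s.color (lo b) = s.color (hi b)
  · obtain ⟨j, c, h1, h2⟩ := Shuffle.exists_consecutive hs
    rw [psiCoef_of_consecutive h1 h2, Shuffle.step_of_eq hs, hι,
      hR.psi_mul_tau_of_eq hβ hdisj hs₀ s b (place₂ hs₀ j c) (by rw [h1, apply_lo_place₂])
        (by rw [h2, apply_hi_place₂]) hs]
    change _ = _ * (ψ (place₂ hs₀ j c) * shuffleE hβ e s₀)
    rw [hR.psi_mul_shuffleE, step_place₂, ← mul_assoc, hR.tau_mul_shuffleE hβ hs₀]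
  · rw [psiCoef_of_ne hs, map_one, cornerVal_one, hR.tau_mul_shuffleE hβ hs₀,
      hR.psi_mul_tau_of_ne hβ hdisj hs₀ hs]

theorem e_mul_tau_eq (s u : Shuffle n ν) (k : ∀ j, α j) :
    e (hβ.idx (s, k)) * tau ψ (shuffleE hβ e s₀) u = tau ψ (shuffleE hβ e s₀) u *
      cornerVal _ (ι ((Pi.single s (tensorE q k) : Shuffle n ν → ⨂[K] j, A j) u)) := by
  by_cases h : u = s
  · subst h
    rw [Pi.single_eq_same, hR.iota_tensorE hβ hs₀ hι, hR.e_mul_tau hβ hs₀]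
  · rw [Pi.single_eq_of_ne h, map_zero, map_zero, mul_zero, ← hR.shuffleE_mul_tau hβ hs₀,
      ← hR.e_mul_shuffleE, mul_assoc, ← mul_assoc (shuffleE _ _ _), hR.shuffleE_mul_ne hβ (Ne.symm h),
      zero_mul, mul_zero]

include hdisj in
theorem matrixToAlg_genFun_mul (g : Gen β) (M : Matrix (Shuffle n ν) (Shuffle n ν) (⨂[K] j, A j)) :
    matrixToAlg _ ψ ι (genFun (yMat fun j a => tensorGen q j (Gen.y a))
      (psiMat fun j c => tensorGen q j (Gen.psi c)) (eMat hβ (tensorE q)) g * M) =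
    genFun y ψ e g * matrixToAlg _ ψ ι M := by
  cases g with
  | y a => exact matrixToAlg_colMatrix_mul _ ι (hR.y_mul_tau_eq hβ hs₀ hι a) M
  | psi b => exact matrixToAlg_colMatrix_mul _ ι (hR.psi_mul_tau_eq hβ hdisj hs₀ hι b) M
  | e i =>
    obtain ⟨s, k, rfl⟩ := hβ.idx_surj i
    simp only [genFun]
    rw [eMat_idx, single_eq_colMatrix]
    exact matrixToAlg_colMatrix_mul _ ι (fun u => hR.e_mul_tau_eq hβ hs₀ hι s u k) M

-- Only diagonal terms survive, and `tau s * tauInv s = shuffleE s` sums to `1`.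
omit hι in
include hdisj hs₀ in
theorem matrixToAlg_one [Finite β] :
    matrixToAlg (hR.isIdempotentElem_shuffleE hβ s₀) ψ ι
      (1 : Matrix (Shuffle n ν) (Shuffle n ν) (⨂[K] j, A j)) = 1 := by
  rw [matrixToAlg, ← hR.sum_shuffleE hβ]
  refine Finset.sum_congr rfl fun s _ => ?_
  rw [Finset.sum_eq_single s]
  · rw [Matrix.one_apply_eq, map_one, cornerVal_one, hR.tau_mul_shuffleE hβ hs₀,
      hR.tau_mul_tauInv hβ hdisj hs₀]
  · intro t _ ht
    rw [Matrix.one_apply_ne ht.symm]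
    simp
  · simp

end IsRep

end Inverse

/-! ### Bijectivity of the matrix representation -/

section Bijective

variable {K : Type v} [CommRing K] {I : Type u} {Γ : Quiver.{w} I} {d n : ℕ} {p : I → Fin d}
  {ν : Fin d → ℕ} {α : ∀ j, Set (Fin (ν j) → part p j)} [∀ j, Finite (α j)]
  {β : Set (Fin n → I)} [Finite β] {B : Type*} [Ring B] [Algebra K B] {s₀ : Shuffle n ν}
  {A : Fin d → Type*} [∀ j, Ring (A j)] [∀ j, Algebra K (A j)]
  {q : ∀ j, Alg K (Γ.fullSub (part p j)) (α j) →ₐ[K] A j}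
  {qB : Alg K Γ β →ₐ[K] B}

/-- The representation given by the images of the generators in a quotient. -/
theorem isRep_quot (qB : Alg K Γ β →ₐ[K] B) : IsRep Γ β (fun a => qB (gen K Γ β (Gen.y a)))
    (fun b => qB (gen K Γ β (Gen.psi b))) (fun i => qB (gen K Γ β (Gen.e i))) :=
  (isRep_gen K Γ β).map qB

/-- The matrix by which a generator acts. -/
noncomputable def genMat (hβ : IsShuffleSet β α)
    (q : ∀ j, Alg K (Γ.fullSub (part p j)) (α j) →ₐ[K] A j) :
    Gen β → Matrix (Shuffle n ν) (Shuffle n ν) (⨂[K] j, A j) :=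
  genFun (yMat fun j a => tensorGen q j (Gen.y a)) (psiMat fun j c => tensorGen q j (Gen.psi c))
    (eMat hβ (tensorE q))

variable (hβ : IsShuffleSet β α) (hdisj : ∀ i j : I, p i ≠ p j → IsEmpty (Γ.Hom i j))
  (hs₀ : Monotone s₀.color) (hqB : Function.Surjective qB) (hq : ∀ j, Function.Surjective (q j))
  {Φ : B →ₐ[K] Matrix (Shuffle n ν) (Shuffle n ν) (⨂[K] j, A j)}
  (hΦ : ∀ g, Φ (qB (gen K Γ β g)) = genMat hβ q g)
  {ι : (⨂[K] j, A j) →ₐ[K] ((isRep_quot qB).isIdempotentElem_shuffleE hβ s₀).Corner}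
  (hι : ∀ j g, ι (tensorGen q j g) = (isRep_quot qB).cornerGen K hβ hs₀ j g)

-- Compatibility with left multiplication passes from the generators to the algebra they generate;
-- evaluating at the matrix `1` gives the left inverse.
include hdisj hs₀ hqB hΦ hι in
theorem matrixToAlg_map (b : B) :
    matrixToAlg ((isRep_quot qB).isIdempotentElem_shuffleE hβ s₀)
      (fun b => qB (gen K Γ β (Gen.psi b))) ι (Φ b) = b := by
  have key : ∀ x, ∀ M : Matrix (Shuffle n ν) (Shuffle n ν) (⨂[K] j, A j),
      matrixToAlg ((isRep_quot qB).isIdempotentElem_shuffleE hβ s₀)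
        (fun b => qB (gen K Γ β (Gen.psi b))) ι (Φ (qB x) * M) =
      qB x * matrixToAlg ((isRep_quot qB).isIdempotentElem_shuffleE hβ s₀)
        (fun b => qB (gen K Γ β (Gen.psi b))) ι M := by
    intro x
    have hx : x ∈ Algebra.adjoin K (Set.range (gen K Γ β)) := by
      rw [adjoin_gen]
      exact Algebra.mem_top
    induction hx using Algebra.adjoin_induction with
    | mem x hx =>
      obtain ⟨g, rfl⟩ := hx
      intro M
      have hg : qB (gen K Γ β g) = genFun (fun a => qB (gen K Γ β (Gen.y a)))
        (fun b => qB (gen K Γ β (Gen.psi b))) (fun i => qB (gen K Γ β (Gen.e i))) g := by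
        cases g <;> rfl
      rw [hΦ, hg]
      exact (isRep_quot qB).matrixToAlg_genFun_mul hβ hdisj hs₀ hι g M
    | algebraMap c =>
      intro M
      rw [AlgHom.commutes, AlgHom.commutes, ← Algebra.smul_def, ← Algebra.smul_def]
      simp only [matrixToAlg, Matrix.smul_apply, map_smul, cornerVal_smul, Finset.smul_sum,
        mul_smul_comm, smul_mul_assoc]
    | add x z _ _ hx hz =>
      intro M
      rw [map_add, map_add, add_mul, add_mul, ← hx, ← hz]
      simp only [matrixToAlg, Matrix.add_apply, map_add, mul_add, add_mul, Finset.sum_add_distrib]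
    | mul x z _ _ hx hz =>
      intro M
      rw [map_mul, map_mul, mul_assoc, hx, hz, mul_assoc]
  obtain ⟨x, rfl⟩ := hqB b
  have := key x 1
  rwa [mul_one, (isRep_quot qB).matrixToAlg_one hβ hdisj hs₀, mul_one] at this

omit [∀ j, Finite (α j)] in
/-- The matrix units with all coefficients from a set that generates the tensor product. -/
theorem single_mem_range_of {T D : Type*} [Fintype T] [DecidableEq T] [Ring D] [Algebra K D]
    {R : Subalgebra K (Matrix T T D)} {s₀ : T} (h1 : ∀ s, Matrix.single s s₀ (1 : D) ∈ R)
    (h2 : ∀ s, Matrix.single s₀ s (1 : D) ∈ R) (h3 : ∀ x : D, Matrix.single s₀ s₀ x ∈ R) : R = ⊤ := by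
  refine eq_top_iff.2 fun M _ => ?_
  rw [Matrix.matrix_eq_sum_single M]
  refine R.sum_mem fun s _ => R.sum_mem fun t _ => ?_
  have := R.mul_mem (R.mul_mem (h1 s) (h3 (M s t))) (h2 t)
  simpa using this

-- The range contains the diagonal matrix units, as sums of idempotents. Multiplying by `ψ_b` along
-- descents gives the units linking any `s` with `s₀`. Finally the entries `x` at `(s₀, s₀)` in the
-- range form a subalgebra containing all generators of the tensor product.
include hs₀ hq hΦ in
theorem map_surjective : Function.Surjective Φ := by
  rw [← AlgHom.range_eq_top]
  have hB := blockRep_tensor q hβ.stable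
  have hg : ∀ g, genMat hβ q g ∈ Φ.range := fun g => ⟨_, hΦ g⟩
  have he : ∀ s k, Matrix.single s s (tensorE q k) ∈ Φ.range := by
    intro s k
    have := hg (Gen.e (hβ.idx (s, k)))
    simp only [genMat, genFun] at this
    rwa [eMat_idx] at this
  have hsum : ∀ (s : Shuffle n ν) (f : (∀ j, α j) → ⨂[K] j, A j),
      (∀ k, Matrix.single s s (f k) ∈ Φ.range) → Matrix.single s s (∑ᶠ k, f k) ∈ Φ.range := by
    intro s f hf
    have := Fintype.ofFinite (∀ j, α j)
    have h := map_finsum_of_finite (Matrix.singleAddMonoidHom (α := ⨂[K] j, A j) s s) f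
    simp only [Matrix.singleAddMonoidHom_apply] at h
    rw [h, finsum_eq_sum_of_fintype]
    exact Φ.range.sum_mem fun k _ => hf k
  have h0 : ∀ s, Matrix.single s s (1 : ⨂[K] j, A j) ∈ Φ.range := by
    intro s
    rw [← hB.sum_E]
    exact hsum _ _ (he s)
  have h12 : ∀ s, Matrix.single s s₀ (1 : ⨂[K] j, A j) ∈ Φ.range ∧
      Matrix.single s₀ s (1 : ⨂[K] j, A j) ∈ Φ.range := by
    intro s
    induction s using Shuffle.lex_induction with
    | h s ih =>
      by_cases hs : ∃ b : Fin (n - 1), s.color (hi b) < s.color (lo b)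
      · obtain ⟨b, hb⟩ := hs
        have hne : (s.step b).color (lo b) ≠ (s.step b).color (hi b) := by
          simpa [Shuffle.color_step] using hb.ne
        obtain ⟨i1, i2⟩ := ih _ (Shuffle.step_lex_lt hb)
        constructor
        · have := Φ.range.mul_mem (hg (Gen.psi b)) i1
          simp only [genMat, genFun] at this
          rwa [psiMat, colMatrix_mul_single, psiCoef_of_ne hne, one_mul, Shuffle.step_step] at this
        · have := Φ.range.mul_mem i2 (hg (Gen.psi b))
          simp only [genMat, genFun] at this
          rwa [psiMat, single_mul_colMatrix (Shuffle.step_step b), Shuffle.step_step,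
            psiCoef_of_ne hb.ne', one_mul] at this
      · push Not at hs
        obtain rfl := Shuffle.eq_of_monotone (Shuffle.monotone_of_no_descent hs) hs₀
        exact ⟨h0 _, h0 _⟩
  refine single_mem_range_of (fun s => (h12 s).1) (fun s => (h12 s).2) fun x => ?_
  let S : Subalgebra K (⨂[K] j, A j) :=
    { carrier := {x | Matrix.single s₀ s₀ x ∈ Φ.range}
      mul_mem' := fun {x z} hx hz => by
        have := Φ.range.mul_mem hx hz
        rwa [Matrix.single_mul_single_same] at this
      add_mem' := fun {x z} hx hz => by
        have := Φ.range.add_mem hx hz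
        rwa [← Matrix.single_add] at this
      algebraMap_mem' := fun c => by
        have := Φ.range.smul_mem (h0 s₀) c
        rwa [Matrix.smul_single, ← Algebra.algebraMap_eq_smul_one] at this }
  have hS : S = ⊤ := by
    refine tensor_subalgebra_eq_top q hq S fun j g => ?_
    change Matrix.single s₀ s₀ _ ∈ Φ.range
    cases g with
    | y a =>
      have := Φ.range.mul_mem (hg (Gen.y (place s₀ j a))) (h0 s₀)
      simp only [genMat, genFun] at this
      rwa [yMat, colMatrix_mul_single, apply_place, mul_one] at this
    | psi c =>
      have := Φ.range.mul_mem (hg (Gen.psi (place₂ hs₀ j c))) (h0 s₀)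
      simp only [genMat, genFun] at this
      rwa [psiMat, colMatrix_mul_single, step_place₂,
        psiCoef_of_consecutive (apply_lo_place₂ hs₀ j c) (apply_hi_place₂ hs₀ j c),
        mul_one] at this
    | e i =>
      -- The idempotent of a word in one part is the sum of the `tensorE k` with that word as `j`-th
      -- entry.
      rw [← mul_one (tensorGen _ _ _), ← hB.sum_E, mul_finsum_of_finite]
      refine hsum _ _ fun k => ?_
      by_cases hk : k j = i
      · subst hk
        rw [hB.e_mul_E]
        exact he _ _
      · rw [← hB.e_mul_E j k, ← mul_assoc, (hB.rep j).e_mul_ne _ _ (Ne.symm hk), zero_mul,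
          Matrix.single_zero]
        exact Φ.range.zero_mem
  exact (hS ▸ Algebra.mem_top : x ∈ S)

end Bijective

/-! ### Gradings -/

section TensorMatrixGrade

open PiTensorProduct

variable {K : Type*} [CommRing K]

theorem tensorGrade_mul {ι : Type*} [Fintype ι] {A : ι → Type*} [∀ i, Ring (A i)]
    [∀ i, Algebra K (A i)] {𝒜 : ∀ i, ℤ → Submodule K (A i)}
    (h : ∀ i k l x z, x ∈ 𝒜 i k → z ∈ 𝒜 i l → x * z ∈ 𝒜 i (k + l)) {k l : ℤ} {x z : ⨂[K] i, A i}
    (hx : x ∈ tensorGrade K 𝒜 k) (hz : z ∈ tensorGrade K 𝒜 l) :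
    x * z ∈ tensorGrade K 𝒜 (k + l) := by
  induction hx using Submodule.span_induction with
  | mem x hx =>
    obtain ⟨m, a, ha, rfl, rfl⟩ := hx
    induction hz using Submodule.span_induction with
    | mem z hz =>
      obtain ⟨m', a', ha', rfl, rfl⟩ := hz
      exact Submodule.subset_span ⟨fun i => m i + m' i, a * a',
        fun i => h i _ _ _ _ (ha i) (ha' i), Finset.sum_add_distrib, tprod_mul_tprod _ _⟩
    | zero => rw [mul_zero]; exact Submodule.zero_mem _
    | add z w _ _ h1 h2 => rw [mul_add]; exact Submodule.add_mem _ h1 h2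
    | smul c z _ h1 => rw [mul_smul_comm]; exact Submodule.smul_mem _ _ h1
  | zero => rw [zero_mul]; exact Submodule.zero_mem _
  | add z w _ _ h1 h2 => rw [add_mul]; exact Submodule.add_mem _ h1 h2
  | smul c z _ h1 => rw [smul_mul_assoc]; exact Submodule.smul_mem _ _ h1

theorem singleAlgHom_mem_tensorGrade {ι : Type*} [Fintype ι] [DecidableEq ι] {A : ι → Type*}
    [∀ i, Ring (A i)] [∀ i, Algebra K (A i)] {𝒜 : ∀ i, ℤ → Submodule K (A i)}
    (h : ∀ i, 1 ∈ 𝒜 i 0) {j : ι} {k : ℤ} {x : A j} (hx : x ∈ 𝒜 j k) :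
    singleAlgHom j x ∈ tensorGrade K 𝒜 k := by
  refine Submodule.subset_span ⟨Pi.single j k, Pi.mulSingle j x, fun i => ?_, ?_, ?_⟩
  · by_cases hi : i = j
    · subst hi
      simpa using hx
    · simpa [hi] using h i
  · simp
  · rw [singleAlgHom_apply]
    rfl

theorem matrixGrade_mul {T D : Type*} [Fintype T] [Ring D] [Algebra K D] {𝒟 : ℤ → Submodule K D}
    {k l : ℤ} (h : ∀ x z, x ∈ 𝒟 k → z ∈ 𝒟 l → x * z ∈ 𝒟 (k + l)) {M N : Matrix T T D}
    (hM : M ∈ matrixGrade K T 𝒟 k) (hN : N ∈ matrixGrade K T 𝒟 l) :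
    M * N ∈ matrixGrade K T 𝒟 (k + l) := fun s t => by
  rw [Matrix.mul_apply]
  exact Submodule.sum_mem _ fun u _ => h _ _ (hM s u) (hN u t)

theorem colMatrix_mem_matrixGrade {T D : Type*} [DecidableEq T] [Ring D] [Algebra K D]
    {𝒟 : ℤ → Submodule K D} {k : ℤ} {f : T → T} {c : T → D} (h : ∀ s, c s ∈ 𝒟 k) :
    colMatrix f c ∈ matrixGrade K T 𝒟 k := fun s t => by
  rw [colMatrix_apply]
  split_ifs
  · exact h t
  · exact Submodule.zero_mem _

theorem single_mem_matrixGrade {T D : Type*} [DecidableEq T] [Ring D] [Algebra K D]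
    {𝒟 : ℤ → Submodule K D} {k : ℤ} {s t : T} {x : D} (h : x ∈ 𝒟 k) :
    Matrix.single s t x ∈ matrixGrade K T 𝒟 k := fun u v => by
  rw [Matrix.single_apply]
  split_ifs
  · exact h
  · exact Submodule.zero_mem _

end TensorMatrixGrade

/-! ### Gradings of quotients of quiver Hecke algebras -/

section QuotGrade

variable {K : Type v} [CommRing K] {I : Type u} {Γ : Quiver.{w} I} {n : ℕ} {β : Set (Fin n → I)}
  [Finite β] {B : Type*} [Ring B] [Algebra K B]

/-- The grading of a quotient of the quiver Hecke algebra. -/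
noncomputable def quotGrade (q : Alg K Γ β →ₐ[K] B) (k : ℤ) : Submodule K B :=
  (grade K Γ β k).map q.toLinearMap

variable {q : Alg K Γ β →ₐ[K] B}

theorem map_mem_quotGrade {k : ℤ} {x : Alg K Γ β} (h : IsMonomial K Γ β k x) :
    q x ∈ quotGrade q k := ⟨x, Submodule.subset_span h, rfl⟩

/-- To show that the components of a grading are mapped to given submodules, it is enough to
consider monomials. -/
theorem quotGrade_induction {k : ℤ} {P : B → Prop} (h0 : P 0)
    (hadd : ∀ x z, P x → P z → P (x + z)) (hsmul : ∀ (c : K) x, P x → P (c • x))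
    (h : ∀ x, IsMonomial K Γ β k x → P (q x)) {b : B} (hb : b ∈ quotGrade q k) : P b := by
  obtain ⟨x, hx, rfl⟩ := hb
  change x ∈ Submodule.span K _ at hx
  induction hx using Submodule.span_induction with
  | mem x hx => exact h x hx
  | zero => rw [map_zero]; exact h0
  | add x z _ _ h1 h2 => rw [map_add]; exact hadd _ _ h1 h2
  | smul c x _ h1 => rw [map_smul]; exact hsmul _ _ h1

theorem quotGrade_mul {k l : ℤ} {x z : B} (hx : x ∈ quotGrade q k) (hz : z ∈ quotGrade q l) :
    x * z ∈ quotGrade q (k + l) := by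
  refine quotGrade_induction (P := fun x => x * z ∈ quotGrade q (k + l)) ?_ ?_ ?_ ?_ hx
  · rw [zero_mul]; exact Submodule.zero_mem _
  · intro x w h1 h2; rw [add_mul]; exact Submodule.add_mem _ h1 h2
  · intro c x h1; rw [smul_mul_assoc]; exact Submodule.smul_mem _ _ h1
  intro x hx
  refine quotGrade_induction (P := fun z => q x * z ∈ quotGrade q (k + l)) ?_ ?_ ?_ ?_ hz
  · rw [mul_zero]; exact Submodule.zero_mem _
  · intro x w h1 h2; rw [mul_add]; exact Submodule.add_mem _ h1 h2
  · intro c x h1; rw [mul_smul_comm]; exact Submodule.smul_mem _ _ h1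
  intro z hz
  rw [← map_mul]
  exact map_mem_quotGrade (IsMonomial.mul _ _ _ _ hx hz)

theorem finsum_mem_of_finite {ι : Type*} [Finite ι] (S : Submodule K B) {f : ι → B}
    (h : ∀ i, f i ∈ S) : ∑ᶠ i, f i ∈ S := by
  have := Fintype.ofFinite ι
  rw [finsum_eq_sum_of_fintype]
  exact S.sum_mem fun i _ => h i

theorem one_mem_quotGrade : 1 ∈ quotGrade q 0 := by
  rw [← (isRep_quot q).sum_e]
  exact finsum_mem_of_finite _ fun i => map_mem_quotGrade (IsMonomial.e i)

end QuotGrade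

/-! ### The isomorphism for one block -/

section Core

variable {K : Type v} [CommRing K] {I : Type u} {Γ : Quiver.{w} I} {d n : ℕ} {p : I → Fin d}
  {ν : Fin d → ℕ} {α : ∀ j, Set (Fin (ν j) → part p j)} [∀ j, Finite (α j)]
  {β : Set (Fin n → I)} [Finite β] {B : Type*} [Ring B] [Algebra K B] {s₀ : Shuffle n ν}
  {A : Fin d → Type*} [∀ j, Ring (A j)] [∀ j, Algebra K (A j)]
  {q : ∀ j, Alg K (Γ.fullSub (part p j)) (α j) →ₐ[K] A j}
  {qB : Alg K Γ β →ₐ[K] B}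

theorem tensorGen_y_mem (j : Fin d) (a : Fin (ν j)) :
    tensorGen q j (Gen.y a) ∈ tensorGrade K (fun j => quotGrade (q j)) 2 :=
  singleAlgHom_mem_tensorGrade (𝒜 := fun j => quotGrade (q j)) (fun _ => one_mem_quotGrade)
    (map_mem_quotGrade (IsMonomial.y a))

theorem tensorE_mem (k : ∀ j, α j) :
    tensorE q k ∈ tensorGrade K (fun j => quotGrade (q j)) 0 :=
  Submodule.subset_span ⟨fun _ => 0, _, fun _ => map_mem_quotGrade (IsMonomial.e _),
    Finset.sum_const_zero, rfl⟩

/-- The degree of `ψ_c` is defined only next to an idempotent; `tensorE k` supplies that of its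
`j`-th word. -/
theorem tensorGen_psi_mul_tensorE_mem (hst : ∀ j, ∀ i ∈ α j, ∀ w : Equiv.Perm (Fin (ν j)), i ∘ w ∈ α j)
    (j : Fin d) (c : Fin (ν j - 1)) (k : ∀ j, α j) :
    tensorGen q j (Gen.psi c) * tensorE q k ∈ tensorGrade K (fun j => quotGrade (q j))
      ((Γ.fullSub (part p j)).dDeg ((k j).1 (lo c)) ((k j).1 (hi c))) := by
  rw [← (blockRep_tensor q hst).e_mul_E j k, ← mul_assoc, tensorGen, tensorGen, ← map_mul,
    ← map_mul, ← add_zero (Quiver.dDeg _ _ _)]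
  refine tensorGrade_mul (𝒜 := fun j => quotGrade (q j)) (fun _ _ _ _ _ => quotGrade_mul) ?_
    (tensorE_mem k)
  exact singleAlgHom_mem_tensorGrade (𝒜 := fun j => quotGrade (q j)) (fun _ => one_mem_quotGrade)
    (map_mem_quotGrade (IsMonomial.psi _ _))

omit [∀ j, Finite (α j)] [Finite β] in
theorem dDeg_tuple {s : Shuffle n ν} {b : Fin (n - 1)} (hβ : IsShuffleSet β α)
    (hdisj : ∀ i j : I, p i ≠ p j → IsEmpty (Γ.Hom i j)) (k : ∀ j, α j)
    (hs : s.color (lo b) ≠ s.color (hi b)) :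
    Γ.dDeg ((hβ.idx (s, k)).1 (lo b)) ((hβ.idx (s, k)).1 (hi b)) = 0 := by
  have hp : p ((hβ.idx (s, k)).1 (lo b)) ≠ p ((hβ.idx (s, k)).1 (hi b)) := by
    simpa [p_tuple] using hs
  exact Quiver.dDeg_of_isEmpty (fun h => hp (congrArg p h)) (hdisj _ _ hp) (hdisj _ _ hp.symm)

variable (hβ : IsShuffleSet β α) (hdisj : ∀ i j : I, p i ≠ p j → IsEmpty (Γ.Hom i j))
  (hs₀ : Monotone s₀.color) (hqB : Function.Surjective qB) (hq : ∀ j, Function.Surjective (q j))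

include hdisj in
theorem map_mem_matrixGrade {Φ : B →ₐ[K] Matrix (Shuffle n ν) (Shuffle n ν) (⨂[K] j, A j)}
    (hΦ : ∀ g, Φ (qB (gen K Γ β g)) = genMat hβ q g) {k : ℤ} {b : B} (hb : b ∈ quotGrade qB k) :
    Φ b ∈ matrixGrade K (Shuffle n ν) (tensorGrade K fun j => quotGrade (q j)) k := by
  refine quotGrade_induction (P := fun b => Φ b ∈ _) ?_ ?_ ?_ ?_ hb
  · rw [map_zero]; exact Submodule.zero_mem _
  · intro x z h1 h2; rw [map_add]; exact Submodule.add_mem _ h1 h2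
  · intro c x h1; rw [map_smul]; exact Submodule.smul_mem _ _ h1
  clear hb
  intro x hx
  induction hx with
  | e i =>
    rw [hΦ]
    exact single_mem_matrixGrade (tensorE_mem _)
  | y a =>
    rw [hΦ]
    exact colMatrix_mem_matrixGrade fun s => tensorGen_y_mem _ _
  | psi b i =>
    rw [map_mul, map_mul, hΦ, hΦ]
    obtain ⟨s, k, rfl⟩ := hβ.idx_surj i
    simp only [genMat, genFun]
    rw [eMat_idx, psiMat, colMatrix_mul_single]
    refine single_mem_matrixGrade ?_
    by_cases hs : s.color (lo b) = s.color (hi b)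
    · obtain ⟨j, c, h1, h2⟩ := Shuffle.exists_consecutive hs
      rw [psiCoef_of_consecutive h1 h2]
      convert tensorGen_psi_mul_tensorE_mem hβ.stable j c k using 1
      rw [Quiver.dDeg_fullSub]
      simp [tuple, h1, h2, letter_mk]
    · rw [dDeg_tuple hβ hdisj k hs, psiCoef_of_ne hs, one_mul]
      exact tensorE_mem k
  | mul k l x z _ _ hx hz =>
    rw [map_mul, map_mul]
    exact matrixGrade_mul (fun _ _ h1 h2 => tensorGrade_mul (𝒜 := fun j => quotGrade (q j))
      (fun _ _ _ _ _ => quotGrade_mul) h1 h2) hx hz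

theorem shuffleE_mem (s : Shuffle n ν) :
    shuffleE hβ (fun i => qB (gen K Γ β (Gen.e i))) s ∈ quotGrade qB 0 :=
  finsum_mem_of_finite _ fun _ => map_mem_quotGrade (IsMonomial.e _)

include hdisj in
theorem psi_mul_shuffleE_mem {s : Shuffle n ν} {b : Fin (n - 1)}
    (hs : s.color (lo b) ≠ s.color (hi b)) :
    qB (gen K Γ β (Gen.psi b)) * shuffleE hβ (fun i => qB (gen K Γ β (Gen.e i))) s ∈
      quotGrade qB 0 := by
  rw [shuffleE, mul_finsum_of_finite]
  refine finsum_mem_of_finite _ fun k => ?_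
  rw [← map_mul, ← dDeg_tuple hβ hdisj k hs]
  exact map_mem_quotGrade (IsMonomial.psi _ _)

include hdisj hs₀ in
theorem tau_mem (s : Shuffle n ν) :
    tau (fun b => qB (gen K Γ β (Gen.psi b)))
      (shuffleE hβ (fun i => qB (gen K Γ β (Gen.e i))) s₀) s ∈ quotGrade qB 0 ∧
    tauInv (fun b => qB (gen K Γ β (Gen.psi b)))
      (shuffleE hβ (fun i => qB (gen K Γ β (Gen.e i))) s₀) s ∈ quotGrade qB 0 := by
  have hR := isRep_quot qB
  induction s using Shuffle.lex_induction with
  | h s ih =>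
    obtain ⟨rfl, h1, h2⟩ | ⟨b, hb, h1, h2⟩ := tau_cases (fun b => qB (gen K Γ β (Gen.psi b)))
      (shuffleE hβ (fun i => qB (gen K Γ β (Gen.e i))) s₀) hs₀ s
    · rw [h1, h2]
      exact ⟨shuffleE_mem hβ _, shuffleE_mem hβ _⟩
    · have hne : (s.step b).color (lo b) ≠ (s.step b).color (hi b) := by
        simpa [Shuffle.color_step] using hb.ne
      obtain ⟨i1, i2⟩ := ih _ (Shuffle.step_lex_lt hb)
      -- An idempotent is inserted next to each `ψ_b`, which makes it homogeneous of degree `0`.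
      rw [h1, h2, ← hR.shuffleE_mul_tau hβ hs₀, ← hR.tauInv_mul_shuffleE hβ hs₀, ← mul_assoc,
        mul_assoc (tauInv _ _ _), ← add_zero (0 : ℤ)]
      refine ⟨quotGrade_mul (psi_mul_shuffleE_mem hβ hdisj hne) i1, quotGrade_mul i2 ?_⟩
      have := hR.psi_mul_shuffleE hβ b s
      rw [← this]
      exact psi_mul_shuffleE_mem hβ hdisj hb.ne'

theorem cornerVal_prod_mem {e₀ : B} (he : IsIdempotentElem e₀) (h0 : e₀ ∈ quotGrade qB 0) {m : ℕ}
    (c : Fin m → he.Corner) (k : Fin m → ℤ) (h : ∀ j, cornerVal he (c j) ∈ quotGrade qB (k j)) :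
    cornerVal he (List.ofFn c).prod ∈ quotGrade qB (∑ j, k j) := by
  induction m with
  | zero =>
    simp only [List.ofFn_zero, List.prod_nil, Finset.univ_eq_empty, Finset.sum_empty]
    exact h0
  | succ m ih =>
    rw [List.ofFn_succ, List.prod_cons, cornerVal_mul, Fin.sum_univ_succ]
    exact quotGrade_mul (h 0) (ih _ _ fun j => h j.succ)

theorem cornerVal_iota_mem {j : Fin d}
    {ι : A j →ₐ[K] ((isRep_quot qB).isIdempotentElem_shuffleE hβ s₀).Corner}
    (hι : ∀ g, ι (q j (gen K _ _ g)) = (isRep_quot qB).cornerGen K hβ hs₀ j g) {k : ℤ} {x : A j}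
    (hx : x ∈ quotGrade (q j) k) : cornerVal _ (ι x) ∈ quotGrade qB k := by
  have hR := isRep_quot qB
  have h0 := shuffleE_mem (qB := qB) hβ s₀
  refine quotGrade_induction (P := fun x => cornerVal _ (ι x) ∈ quotGrade qB k) ?_ ?_ ?_ ?_ hx
  · rw [map_zero, map_zero]; exact Submodule.zero_mem _
  · intro x z h1 h2; rw [map_add, map_add]; exact Submodule.add_mem _ h1 h2
  · intro c x h1; rw [map_smul, cornerVal_smul]; exact Submodule.smul_mem _ _ h1
  have hword : ∀ i, wordE hβ (fun i => qB (gen K Γ β (Gen.e i))) s₀ j i ∈ quotGrade qB 0 := by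
    intro i
    refine finsum_mem_of_finite _ fun k => ?_
    split_ifs
    · exact map_mem_quotGrade (IsMonomial.e _)
    · exact Submodule.zero_mem _
  clear hx
  intro x hx
  induction hx with
  | e i =>
    rw [hι]
    exact quotGrade_mul (k := 0) (l := 0) (hword i) h0
  | y a =>
    rw [hι]
    exact quotGrade_mul (k := 2) (l := 0) (map_mem_quotGrade (IsMonomial.y _)) h0
  | psi c i =>
    rw [map_mul, map_mul, hι, hι, cornerVal_mul]
    change qB (gen K Γ β (Gen.psi (place₂ hs₀ j c))) *
      shuffleE hβ (fun i => qB (gen K Γ β (Gen.e i))) s₀ *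
      (wordE hβ (fun i => qB (gen K Γ β (Gen.e i))) s₀ j i *
        shuffleE hβ (fun i => qB (gen K Γ β (Gen.e i))) s₀) ∈ quotGrade qB _
    rw [hR.wordE_mul_shuffleE, mul_assoc, hR.shuffleE_mul_wordE, wordE, mul_finsum_of_finite]
    refine finsum_mem_of_finite _ fun k => ?_
    split_ifs with hk
    · subst hk
      rw [← map_mul]
      have := map_mem_quotGrade (q := qB) (IsMonomial.psi (K := K) (Γ := Γ) (place₂ hs₀ j c)
        (hβ.idx (s₀, k)))
      rw [IsShuffleSet.idx_val, lo_place₂, hi_place₂, tuple_place, tuple_place] at this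
      rwa [Quiver.dDeg_fullSub]
    · rw [mul_zero]
      exact Submodule.zero_mem _
  | mul k l x z _ _ hx hz =>
    rw [map_mul, map_mul, cornerVal_mul]
    exact quotGrade_mul hx hz

/-- The isomorphism between (a quotient of) a quiver Hecke algebra and a matrix algebra over the
tensor product of (quotients of) the quiver Hecke algebras of the parts. -/
theorem gradedIso_block (hβ : IsShuffleSet β α)
    (hdisj : ∀ i j : I, p i ≠ p j → IsEmpty (Γ.Hom i j))
    (hs₀ : Monotone s₀.color) (hqB : Function.Surjective qB) (hq : ∀ j, Function.Surjective (q j))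
    (hΦ : ∃ Φ : B →ₐ[K] Matrix (Shuffle n ν) (Shuffle n ν) (⨂[K] j, A j),
      ∀ g, Φ (qB (gen K Γ β g)) = genMat hβ q g)
    (hι : ∀ j, ∃ ι : A j →ₐ[K] ((isRep_quot qB).isIdempotentElem_shuffleE hβ s₀).Corner,
      ∀ g, ι (q j (gen K _ _ g)) = (isRep_quot qB).cornerGen K hβ hs₀ j g) :
    GradedIso K (quotGrade qB)
      (matrixGrade K (Shuffle n ν) (tensorGrade K fun j => quotGrade (q j))) := by
  obtain ⟨Φ, hΦ⟩ := hΦ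
  choose ι hι using hι
  have hc := IsRep.commute_corner hq hι
  have hι' : ∀ j g, tensorLift ι hc (tensorGen q j g) = (isRep_quot qB).cornerGen K hβ hs₀ j g := by
    intro j g
    rw [tensorGen, tensorLift_single, hι]
  have hinv := matrixToAlg_map hβ hdisj hs₀ hqB hΦ hι'
  refine ⟨Φ.toNonUnitalAlgHom, ⟨?_, map_surjective hβ hs₀ hq hΦ⟩, fun k b => ?_⟩
  · intro b b' h
    rw [← hinv b, ← hinv b']
    exact congrArg _ h
  · refine ⟨fun hb => map_mem_matrixGrade hβ hdisj hΦ hb, fun hb => ?_⟩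
    -- Degrees are reflected: `b` is recovered from the entries of `Φ b` by `ι`, which preserves
    -- degrees, and factors `tau`, `tauInv` of degree `0`.
    rw [← hinv b]
    refine Submodule.sum_mem _ fun s _ => Submodule.sum_mem _ fun t _ => ?_
    rw [← add_zero k, ← zero_add k]
    refine quotGrade_mul (quotGrade_mul (tau_mem hβ hdisj hs₀ s).1 ?_) (tau_mem hβ hdisj hs₀ t).2
    have hst := hb s t
    change Φ b s t ∈ _ at hst
    generalize Φ b s t = x at hst
    change x ∈ Submodule.span K _ at hst
    induction hst using Submodule.span_induction with
    | mem x hx =>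
      obtain ⟨m, a, ha, rfl, rfl⟩ := hx
      rw [tensorLift_tprod]
      exact cornerVal_prod_mem _ (shuffleE_mem hβ s₀) _ _ fun j =>
        cornerVal_iota_mem hβ hs₀ (hι j) (ha j)
    | zero => rw [map_zero, map_zero]; exact Submodule.zero_mem _
    | add x z _ _ h1 h2 => rw [map_add, map_add]; exact Submodule.add_mem _ h1 h2
    | smul c x _ h1 => rw [map_smul, cornerVal_smul]; exact Submodule.smul_mem _ _ h1

end Core

/-! ### The isomorphism for one block of the quiver Hecke algebra and its cyclotomic quotient -/

section Block

open PiTensorProduct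

variable {K : Type v} [CommRing K] {I : Type u} {Γ : Quiver.{w} I} {d n : ℕ} {p : I → Fin d}
  {ν : Fin d → ℕ} {α : ∀ j, Set (Fin (ν j) → part p j)} [∀ j, Finite (α j)]
  {β : Set (Fin n → I)} [Finite β] {s₀ : Shuffle n ν}

/-- An earlier letter of the same word would need a place before the first one. -/
theorem Shuffle.apply_zero_snd (s : Shuffle n ν) (hn : 0 < n) : ((s.1 ⟨0, hn⟩).2 : ℕ) = 0 := by
  by_contra h
  have hj : 0 < ν (s.1 ⟨0, hn⟩).1 := (s.1 ⟨0, hn⟩).2.pos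
  have h1 : s.1.symm ⟨(s.1 ⟨0, hn⟩).1, ⟨0, hj⟩⟩ < s.1.symm ⟨(s.1 ⟨0, hn⟩).1, (s.1 ⟨0, hn⟩).2⟩ :=
    Shuffle.symm_lt_symm.2 (Nat.pos_of_ne_zero h)
  rw [Sigma.eta, Equiv.symm_apply_apply] at h1
  exact Nat.not_lt_zero _ h1

theorem gradedIso_grade (hβ : IsShuffleSet β α)
    (hdisj : ∀ i j : I, p i ≠ p j → IsEmpty (Γ.Hom i j)) :
    GradedIso K (grade K Γ β) (matrixGrade K (Shuffle n ν)
      (tensorGrade K fun j => grade K (Γ.fullSub (part p j)) (α j))) := by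
  obtain ⟨s₀, hs₀⟩ := Shuffle.exists_monotone hβ.sum_eq
  have h := gradedIso_block (K := K) (qB := AlgHom.id K (Alg K Γ β))
    (q := fun j => AlgHom.id K (Alg K (Γ.fullSub (part p j)) (α j))) hβ hdisj hs₀
    Function.surjective_id (fun _ => Function.surjective_id)
    ⟨((blockRep_tensor _ hβ.stable).isRep_matrix hβ hdisj).lift K, fun g => IsRep.lift_gen _ g⟩
    fun j => ⟨((isRep_quot _).isRep_corner (K := K) hβ hs₀ j).lift K, fun g => by
      rw [AlgHom.id_apply, IsRep.lift_gen]
      cases g <;> rfl⟩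
  have hq : ∀ {m : ℕ} {J : Type u} (Δ : Quiver.{w} J) (γ : Set (Fin m → J)) [Finite γ],
      quotGrade (AlgHom.id K (Alg K Δ γ)) = grade K Δ γ := fun Δ γ _ =>
    funext fun k => Submodule.map_id _
  simpa only [hq] using h

variable {A : Fin d → Type*} [∀ j, Ring (A j)] [∀ j, Algebra K (A j)]
  {q : ∀ j, Alg K (Γ.fullSub (part p j)) (α j) →ₐ[K] A j} {Λ : I → ℕ}

-- In each column the first place holds the first letter of some word, so the relation is the
-- cyclotomic relation of the part of that letter.
omit [Finite β] in
theorem yMat_pow_mul_eMat (hβ : IsShuffleSet β α)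
    (hq : ∀ j (h : 0 < ν j) (i : α j), q j (gen K _ _ (Gen.y ⟨0, h⟩)) ^ Λ (i.1 ⟨0, h⟩).1 *
      q j (gen K _ _ (Gen.e i)) = 0) (hn : 0 < n) (i : β) :
    yMat (fun j a => tensorGen q j (Gen.y a)) ⟨0, hn⟩ ^ Λ (i.1 ⟨0, hn⟩) *
      eMat hβ (tensorE q) i = 0 := by
  obtain ⟨s, k, rfl⟩ := hβ.idx_surj i
  rw [eMat_idx, yMat, colMatrix_id, Matrix.diagonal_pow, ← colMatrix_id, colMatrix_mul_single,
    IsShuffleSet.idx_val, tuple]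
  have h0 := s.apply_zero_snd hn
  rw [Pi.pow_apply]
  generalize s.1 ⟨0, hn⟩ = x at h0
  obtain ⟨j, a, ha⟩ := x
  obtain rfl : a = 0 := h0
  rw [posY_mk, letter_mk, tensorGen, ← map_pow, tensorE, singleAlgHom_mul_tprod, hq j ha (k j)]
  simp

-- This makes `ι` descend to cyclotomic quotients. The cyclotomic relation holds at the first place
-- of a shuffle that starts with the word `j`; `tau` and `tauInv` of that shuffle transport it to
-- the place of the same letter in the sorted shuffle.
omit [Finite β] in
theorem pow_mul_e_of_cyclotomic {B : Type*} [Ring B] {y : Fin n → B}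
    {ψ : Fin (n - 1) → B} {e : β → B} (hR : IsRep Γ β y ψ e)
    (hβ : IsShuffleSet β α)
    (hdisj : ∀ i j : I, p i ≠ p j → IsEmpty (Γ.Hom i j)) (hs₀ : Monotone s₀.color)
    (hB : ∀ (hn : 0 < n) (i : β), y ⟨0, hn⟩ ^ Λ (i.1 ⟨0, hn⟩) * e i = 0) {j : Fin d}
    (hj : 0 < ν j) (k : ∀ j, α j) :
    y (place s₀ j ⟨0, hj⟩) ^ Λ ((k j).1 ⟨0, hj⟩).1 * e (hβ.idx (s₀, k)) = 0 := by
  have hn : 0 < n := (place s₀ j ⟨0, hj⟩).pos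
  obtain ⟨s, hs⟩ := Shuffle.exists_apply_zero hβ.sum_eq hn j hj
  have h1 := hB hn (hβ.idx (s, k))
  rw [IsShuffleSet.idx_val, tuple, hs, letter_mk] at h1
  have h2 : ∀ m : ℕ, y ⟨0, hn⟩ ^ m * tau ψ (shuffleE hβ e s₀) s =
      tau ψ (shuffleE hβ e s₀) s * y (place s₀ j ⟨0, hj⟩) ^ m := by
    intro m
    have h3 := hR.y_mul_tau hβ hs₀ s ⟨0, hn⟩
    rw [hs] at h3
    have : SemiconjBy (tau ψ (shuffleE hβ e s₀) s) (y (place s₀ j ⟨0, hj⟩)) (y ⟨0, hn⟩) := h3.symm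
    exact (this.pow_right m).symm
  have h4 : shuffleE hβ e s₀ * (y (place s₀ j ⟨0, hj⟩) ^ Λ ((k j).1 ⟨0, hj⟩).1 *
      e (hβ.idx (s₀, k))) = 0 := by
    rw [← hR.tauInv_mul_tau hβ hdisj hs₀ s, mul_assoc, ← mul_assoc (tau _ _ _), ← h2, mul_assoc,
      ← hR.e_mul_tau hβ hs₀, ← mul_assoc (_ ^ _), h1, zero_mul, mul_zero]
  have h5 : Commute (y (place s₀ j ⟨0, hj⟩) ^ Λ ((k j).1 ⟨0, hj⟩).1) (shuffleE hβ e s₀) :=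
    Commute.pow_left (hR.y_mul_shuffleE hβ _ _) _
  rwa [← mul_assoc, ← h5.eq, mul_assoc, hR.shuffleE_mul_e] at h4

variable (K Γ β) in
/-- The projection of the quiver Hecke algebra onto its cyclotomic quotient. -/
noncomputable def toCyc (Λ : I → ℕ) : Alg K Γ β →ₐ[K] CycAlg K Γ β Λ :=
  RingQuot.mkAlgHom K (CycRel K Γ β Λ)

theorem toCyc_surjective (Λ : I → ℕ) : Function.Surjective (toCyc K Γ β Λ) :=
  RingQuot.mkAlgHom_surjective K _

theorem toCyc_cyclotomic (Λ : I → ℕ) (hn : 0 < n) (i : β) :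
    toCyc K Γ β Λ (gen K Γ β (Gen.y ⟨0, hn⟩)) ^ Λ (i.1 ⟨0, hn⟩) *
      toCyc K Γ β Λ (gen K Γ β (Gen.e i)) = 0 := by
  rw [← map_pow, ← map_mul, ← map_zero (toCyc K Γ β Λ)]
  exact RingQuot.mkAlgHom_rel K (CycRel.cyc hn i)

variable (Λ) in
/-- A homomorphism from the quiver Hecke algebra that respects the cyclotomic relations factors
through the cyclotomic quotient. -/
theorem exists_lift_cyclotomic {C : Type*} [Semiring C] [Algebra K C] (f : Alg K Γ β →ₐ[K] C)
    (h : ∀ (hn : 0 < n) (i : β),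
      f (gen K Γ β (Gen.y ⟨0, hn⟩)) ^ Λ (i.1 ⟨0, hn⟩) * f (gen K Γ β (Gen.e i)) = 0) :
    ∃ g : CycAlg K Γ β Λ →ₐ[K] C, ∀ x, g (toCyc K Γ β Λ x) = f x :=
  ⟨RingQuot.liftAlgHom K ⟨f, by
    rintro _ _ ⟨hn, i⟩
    rw [map_mul, map_pow, map_zero, h hn i]⟩, fun x => RingQuot.liftAlgHom_mkAlgHom_apply K f _ x⟩

/-- The quotients enter only through surjectivity, their cyclotomic relations and the universal
properties `liftB` and `liftA`. -/
theorem gradedIso_block_of_cyclotomic {B : Type*} [Ring B] [Algebra K B] {qB : Alg K Γ β →ₐ[K] B}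
    (hβ : IsShuffleSet β α) (hdisj : ∀ i j : I, p i ≠ p j → IsEmpty (Γ.Hom i j))
    (hqB : Function.Surjective qB) (hq : ∀ j, Function.Surjective (q j))
    (hB : ∀ (hn : 0 < n) (i : β), qB (gen K _ _ (Gen.y ⟨0, hn⟩)) ^ Λ (i.1 ⟨0, hn⟩) *
      qB (gen K _ _ (Gen.e i)) = 0)
    (hA : ∀ j (h : 0 < ν j) (i : α j), q j (gen K _ _ (Gen.y ⟨0, h⟩)) ^ Λ (i.1 ⟨0, h⟩).1 *
      q j (gen K _ _ (Gen.e i)) = 0)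
    (liftB : ∀ f : Alg K Γ β →ₐ[K] Matrix (Shuffle n ν) (Shuffle n ν) (⨂[K] j, A j),
      (∀ (hn : 0 < n) (i : β),
        f (gen K Γ β (Gen.y ⟨0, hn⟩)) ^ Λ (i.1 ⟨0, hn⟩) * f (gen K Γ β (Gen.e i)) = 0) →
      ∃ g : B →ₐ[K] Matrix (Shuffle n ν) (Shuffle n ν) (⨂[K] j, A j), ∀ x, g (qB x) = f x)
    (liftA : ∀ (j : Fin d) (e₀ : B) (he : IsIdempotentElem e₀)
      (f : Alg K (Γ.fullSub (part p j)) (α j) →ₐ[K] he.Corner),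
      (∀ (hj : 0 < ν j) (i : α j),
        f (gen K _ _ (Gen.y ⟨0, hj⟩)) ^ Λ (i.1 ⟨0, hj⟩).1 * f (gen K _ _ (Gen.e i)) = 0) →
      ∃ g : A j →ₐ[K] he.Corner, ∀ x, g (q j x) = f x) :
    GradedIso K (quotGrade qB)
      (matrixGrade K (Shuffle n ν) (tensorGrade K fun j => quotGrade (q j))) := by
  obtain ⟨s₀, hs₀⟩ := Shuffle.exists_monotone hβ.sum_eq
  refine gradedIso_block hβ hdisj hs₀ hqB hq ?_ fun j => ?_
  · obtain ⟨g, hg⟩ := liftB (((blockRep_tensor q hβ.stable).isRep_matrix hβ hdisj).lift K)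
      fun hn i => by
        rw [IsRep.lift_y, IsRep.lift_e]
        exact yMat_pow_mul_eMat hβ hA hn i
    exact ⟨g, fun x => by rw [hg, IsRep.lift_gen]; rfl⟩
  · have hR := isRep_quot qB
    obtain ⟨g, hg⟩ := liftA j _ _ ((hR.isRep_corner (K := K) hβ hs₀ j).lift K) fun hj i => by
      rw [IsRep.lift_y, IsRep.lift_e, IsRep.cornerGen, IsRep.cornerGen, ← map_pow, ← map_mul,
        ← map_zero (toCorner K (hR.isIdempotentElem_shuffleE hβ s₀)),
        ← zero_mul (hR.cenE K hβ s₀ j i)]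
      refine hR.toCorner_congr_mul (K := K) hβ fun k hk => ?_
      subst hk
      exact (pow_mul_e_of_cyclotomic hR hβ hdisj hs₀ hB hj k).trans (zero_mul _).symm
    exact ⟨g, fun x => by
      rw [hg, IsRep.lift_gen]
      cases x <;> rfl⟩

theorem gradedIso_cycGrade (hβ : IsShuffleSet β α)
    (hdisj : ∀ i j : I, p i ≠ p j → IsEmpty (Γ.Hom i j)) (Λ : I → ℕ) :
    GradedIso K (cycGrade K Γ β Λ) (matrixGrade K (Shuffle n ν)
      (tensorGrade K fun j => cycGrade K (Γ.fullSub (part p j)) (α j) fun i => Λ i.1)) := by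
  have := gradedIso_block_of_cyclotomic (K := K) (n := n) (Γ := Γ) (ν := ν) (α := α) (β := β) (Λ := Λ)
    (B := CycAlg K Γ β Λ) (qB := toCyc K Γ β Λ)
    (A := fun j => CycAlg K (Γ.fullSub (part p j)) (α j) fun i => Λ i.1)
    (q := fun j => toCyc K (Γ.fullSub (part p j)) (α j) fun i => Λ i.1) hβ hdisj
    (toCyc_surjective Λ) (fun _ => toCyc_surjective _) (toCyc_cyclotomic Λ)
    (fun _ => toCyc_cyclotomic _) (fun f => exists_lift_cyclotomic (K := K) (Γ := Γ) (β := β) Λ f)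
    (fun j _ he f => exists_lift_cyclotomic (K := K) (Γ := Γ.fullSub (part p j)) (β := α j)
      (C := he.Corner) (fun i : part p j => Λ i.1) f)
  exact this

end Block

/-! ### Orbits of tuples and orbits of words in the parts -/

section Orbits

variable {I : Type u} {d n : ℕ} {p : I → Fin d} {ν : Fin d → ℕ}

theorem orbit_nonempty (ω : Orbit I n) : ω.orbit.Nonempty := by
  induction ω using Quotient.inductionOn' with
  | h a => exact ⟨a, MulAction.orbitRel.Quotient.mem_orbit.2 rfl⟩

theorem Orbit.eq_of_mem {ω ω' : Orbit I n} {i : Fin n → I} (h : i ∈ ω.orbit) (h' : i ∈ ω'.orbit) :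
    ω = ω' := by
  rw [MulAction.orbitRel.Quotient.mem_orbit] at h h'
  rw [← h, ← h']

theorem Orbit.exists_perm {ω : Orbit I n} {i i' : Fin n → I} (h : i ∈ ω.orbit)
    (h' : i' ∈ ω.orbit) : ∃ w : Equiv.Perm (Fin n), i' = i ∘ w := by
  rw [MulAction.orbitRel.Quotient.mem_orbit] at h h'
  obtain ⟨w, hw⟩ := Quotient.exact' (h'.trans h.symm)
  exact ⟨DomMulAct.mk.symm w, hw.symm⟩

theorem tuple_sort {α : ∀ j, Set (Fin (ν j) → part p j)} {k l : ∀ j, α j}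
    (π : ∀ j, Equiv.Perm (Fin (ν j))) (hl : ∀ j, (l j).1 = (k j).1 ∘ π j) (s : Shuffle n ν)
    (a : Fin n) : letter k (Equiv.sigmaCongrRight π (s.1 a)) = tuple s l a := by
  rw [tuple, letter, letter, hl]
  rfl

/-- One common tuple suffices: `exists_sort` splits any rearrangement of it into a shuffle and
permutations of the words, and conversely these compose to a permutation of places. -/
theorem isShuffleSet_orbit (hν : ∑ j, ν j = n) (ω : ∀ j, Orbit (part p j) (ν j)) (ω' : Orbit I n)
    (s₀ : Shuffle n ν) (k₀ : ∀ j, (ω j).orbit) (h : tuple s₀ k₀ ∈ ω'.orbit) :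
    IsShuffleSet ω'.orbit fun j => (ω j).orbit where
  sum_eq := hν
  mem_iff i := by
    constructor
    · intro hi
      obtain ⟨w, rfl⟩ := Orbit.exists_perm h hi
      obtain ⟨s, π, hs⟩ := Shuffle.exists_sort (w.trans s₀.1)
      refine ⟨s, fun j => ⟨(k₀ j).1 ∘ π j, orbit_stable _ _ (k₀ j).2 _⟩, funext fun a => ?_⟩
      rw [← tuple_sort π (k := k₀) fun _ => rfl]
      exact congrArg (letter k₀) (congrArg (fun e => e a) hs).symm
    · rintro ⟨s, k, rfl⟩
      choose π hπ using fun j => Orbit.exists_perm (k₀ j).2 (k j).2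
      have : tuple s k = tuple s₀ k₀ ∘ (s.1.trans ((Equiv.sigmaCongrRight π).trans s₀.1.symm)) := by
        funext a
        rw [← tuple_sort π hπ]
        simp [tuple]
      rw [this]
      exact orbit_stable _ _ h _
  stable j i hi w := orbit_stable _ i hi w

theorem exists_isShuffleSet (hν : ∑ j, ν j = n) (ω : ∀ j, Orbit (part p j) (ν j)) :
    ∃ ω' : Orbit I n, IsShuffleSet ω'.orbit fun j => (ω j).orbit := by
  obtain ⟨s, -⟩ := Shuffle.exists_monotone hν
  choose k hk using fun j => orbit_nonempty (ω j)
  refine ⟨Quotient.mk'' (tuple s fun j => (⟨k j, hk j⟩ : (ω j).orbit)),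
    isShuffleSet_orbit hν ω _ s (fun j => ⟨k j, hk j⟩) ?_⟩
  rw [MulAction.orbitRel.Quotient.mem_orbit]

theorem exists_equiv_fiber (c : Fin n → Fin d) :
    ∃ (ν : Fin d → ℕ) (e : Fin n ≃ Σ j, Fin (ν j)), ∀ a, (e a).1 = c a :=
  ⟨_, (Equiv.sigmaFiberEquiv c).symm.trans (Equiv.sigmaCongrRight fun _ => Fintype.equivFin _),
    fun _ => rfl⟩

-- The composition counts the letters of a tuple in each part, and the words are its subwords.
variable (p) in
theorem exists_isShuffleSet_of_orbit (ω' : Orbit I n) :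
    ∃ (ν : Comp d n) (ω : ∀ j, Orbit (part p j) (ν.1 j)),
      IsShuffleSet ω'.orbit fun j => (ω j).orbit := by
  obtain ⟨i, hi⟩ := orbit_nonempty ω'
  obtain ⟨ν, e, he⟩ := exists_equiv_fiber fun a => p (i a)
  have hν : ∑ j, ν j = n := by simpa using (Fintype.card_congr e).symm
  have hp : ∀ j x, p (i (e.symm ⟨j, x⟩)) = j := fun j x => by
    rw [← he, Equiv.apply_symm_apply]
  let k : ∀ j, Fin (ν j) → part p j := fun j x => ⟨i (e.symm ⟨j, x⟩), hp j x⟩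
  let ω : ∀ j, Orbit (part p j) (ν j) := fun j => Quotient.mk'' (k j)
  have hk : ∀ j, k j ∈ (ω j).orbit := fun j => by
    rw [MulAction.orbitRel.Quotient.mem_orbit]
  obtain ⟨s, π, hs⟩ := Shuffle.exists_sort e
  refine ⟨⟨ν, hν⟩, ω, isShuffleSet_orbit hν ω ω' s
    (fun j => ⟨k j ∘ π j, orbit_stable _ _ (hk j) _⟩) ?_⟩
  convert hi
  funext a
  rw [← tuple_sort π (k := fun j => (⟨k j, hk j⟩ : (ω j).orbit)) fun _ => rfl]
  have : Equiv.sigmaCongrRight π (s.1 a) = e a := (congrArg (fun e => e a) hs).symm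
  rw [this]
  exact congrArg i (e.symm_apply_apply a)

theorem card_color (s : Shuffle n ν) (j : Fin d) :
    Fintype.card {a // s.color a = j} = ν j := by
  rw [← Fintype.card_fin (ν j)]
  refine (Fintype.card_congr (Equiv.ofBijective
    (fun x => (⟨s.1.symm ⟨j, x⟩, by simp [Shuffle.color]⟩ : {a // s.color a = j})) ⟨?_, ?_⟩)).symm
  · intro x z h
    simpa using congrArg Subtype.val h
  · rintro ⟨a, rfl⟩
    exact ⟨(s.1 a).2, Subtype.ext (by simp [Shuffle.color])⟩

/-- The colours of a common tuple give the composition and the shuffle, and then its words give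
their orbits. -/
theorem isShuffleSet_unique {ω' : Orbit I n} {x y : Σ ν : Comp d n, ∀ j, Orbit (part p j) (ν.1 j)}
    (hx : IsShuffleSet ω'.orbit fun j => (x.2 j).orbit)
    (hy : IsShuffleSet ω'.orbit fun j => (y.2 j).orbit) : x = y := by
  obtain ⟨i, hi⟩ := orbit_nonempty ω'
  obtain ⟨s, k, rfl⟩ := (hx.mem_iff _).1 hi
  obtain ⟨t, l, h⟩ := (hy.mem_iff _).1 hi
  obtain ⟨⟨ν, hν⟩, x⟩ := x
  obtain ⟨⟨μ, hμ⟩, y⟩ := y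
  have hc : ∀ a, s.color a = t.color a := fun a => by rw [← p_tuple s k, ← p_tuple t l, h]
  obtain rfl : ν = μ := funext fun j => by
    refine (card_color s j).symm.trans (Eq.trans ?_ (card_color t j))
    simp only [hc]
  have hst : t = s := Shuffle.ext_color fun a => (hc a).symm
  subst hst
  congr 1
  funext j
  refine Orbit.eq_of_mem (k j).2 ?_
  have : (k j).1 = (l j).1 := funext fun a => Subtype.ext <| by
    have := congrFun h (t.1.symm ⟨j, a⟩)
    simpa [tuple, letter_mk] using this.symm
  rw [this]
  exact (l j).2

variable (p n) in
/-- An orbit of tuples amounts to a composition and orbits of words in the parts. -/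
noncomputable def orbitEquiv :
    (Σ ν : Comp d n, ∀ j, Orbit (part p j) (ν.1 j)) ≃ Orbit I n :=
  Equiv.ofBijective (fun x => (exists_isShuffleSet x.1.2 x.2).choose)
    ⟨fun x y h => isShuffleSet_unique (exists_isShuffleSet x.1.2 x.2).choose_spec
      (by
        have h : (exists_isShuffleSet x.1.2 x.2).choose = (exists_isShuffleSet y.1.2 y.2).choose := h
        rw [h]
        exact (exists_isShuffleSet y.1.2 y.2).choose_spec), fun ω' => by
      obtain ⟨ν, ω, h⟩ := exists_isShuffleSet_of_orbit p ω'
      refine ⟨⟨ν, ω⟩, ?_⟩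
      -- A shuffle set is determined by its words, so the chosen orbit shares the tuple `i` with
      -- `ω'`.
      have h1 := (exists_isShuffleSet ν.2 ω).choose_spec
      obtain ⟨i, hi⟩ := orbit_nonempty ω'
      exact Orbit.eq_of_mem ((h1.mem_iff i).2 ((h.mem_iff i).1 hi)) hi⟩

theorem isShuffleSet_orbitEquiv (x : Σ ν : Comp d n, ∀ j, Orbit (part p j) (ν.1 j)) :
    IsShuffleSet (orbitEquiv n p x).orbit fun j => (x.2 j).orbit :=
  (exists_isShuffleSet x.1.2 x.2).choose_spec

end Orbits

/-! ### Isomorphisms of graded algebras -/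

section GradedIso

variable {K : Type*} [CommRing K]

namespace GradedIso

section

variable {A B C : Type*} [NonUnitalNonAssocSemiring A] [Module K A] [NonUnitalNonAssocSemiring B]
  [Module K B] [NonUnitalNonAssocSemiring C] [Module K C] {𝒜 : ℤ → Submodule K A}
  {ℬ : ℤ → Submodule K B} {𝒞 : ℤ → Submodule K C}

theorem trans (h : GradedIso K 𝒜 ℬ) (h' : GradedIso K ℬ 𝒞) : GradedIso K 𝒜 𝒞 := by
  obtain ⟨f, hf, hf'⟩ := h
  obtain ⟨g, hg, hg'⟩ := h'
  exact ⟨g.comp f, hg.comp hf, fun k x => (hf' k x).trans (hg' k _)⟩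

theorem symm (h : GradedIso K 𝒜 ℬ) : GradedIso K ℬ 𝒜 := by
  obtain ⟨f, hf, hf'⟩ := h
  let e := Equiv.ofBijective f hf
  have he : ∀ x, f (e.symm x) = x := e.apply_symm_apply
  refine ⟨f.inverse e.symm e.left_inv e.right_inv, e.symm.bijective, fun k x => ?_⟩
  change _ ↔ e.symm x ∈ _
  rw [hf', he]

end

section

variable {ι : Type*} {A B : ι → Type*} [∀ i, NonUnitalSemiring (A i)] [∀ i, Module K (A i)]
  [∀ i, NonUnitalSemiring (B i)] [∀ i, Module K (B i)]
  {𝒜 : ∀ i, ℤ → Submodule K (A i)} {ℬ : ∀ i, ℤ → Submodule K (B i)}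

theorem directSum (h : ∀ i, GradedIso K (𝒜 i) (ℬ i)) :
    GradedIso K (directSumGrade K 𝒜) (directSumGrade K ℬ) := by
  choose f hf hf' using h
  have h0 : ∀ i x, f i x = 0 ↔ x = 0 := fun i x =>
    ⟨fun h => (hf i).1 (h.trans (map_zero _).symm), fun h => by rw [h, map_zero]⟩
  refine ⟨{ toFun := fun x => ⟨fun i => f i (x.1 i), x.2.subset fun i hi h => hi ?_⟩,
            map_smul' := fun c x => ?_, map_zero' := ?_, map_add' := fun x z => ?_,
            map_mul' := fun x z => ?_ }, ⟨fun x z h => ?_, fun z => ?_⟩, fun k x => ?_⟩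
  · simp [h]
  · exact Subtype.ext (funext fun i => map_smul (f i) c (x.1 i))
  · exact Subtype.ext (funext fun i => map_zero (f i))
  · exact Subtype.ext (funext fun i => map_add (f i) (x.1 i) (z.1 i))
  · exact Subtype.ext (funext fun i => map_mul (f i) (x.1 i) (z.1 i))
  · exact Subtype.ext (funext fun i => (hf i).1 (congrFun (congrArg Subtype.val h) i))
  · choose x hx using fun i => (hf i).2 (z.1 i)
    refine ⟨⟨x, z.2.subset fun i hi h => hi ((h0 i _).1 ((hx i).trans h))⟩,
      Subtype.ext (funext hx)⟩
  · exact forall_congr' fun i => hf' i k _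

theorem directSum_reindex {κ : Type*} (e : κ ≃ ι) :
    GradedIso K (directSumGrade K 𝒜) (directSumGrade K fun i => 𝒜 (e i)) := by
  refine ⟨{ toFun := fun x => ⟨fun i => x.1 (e i), x.2.preimage e.injective.injOn⟩,
            map_smul' := fun _ _ => rfl, map_zero' := rfl, map_add' := fun _ _ => rfl,
            map_mul' := fun _ _ => rfl }, ⟨fun x z h => ?_, fun z => ?_⟩, fun k x => ?_⟩
  · refine Subtype.ext (funext fun i => ?_)
    obtain ⟨i, rfl⟩ := e.surjective i
    exact congrFun (congrArg Subtype.val h) i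
  · refine ⟨⟨(Equiv.piCongrLeft A e) z.1, ?_⟩, Subtype.ext (funext fun i => ?_)⟩
    · refine (z.2.image e).subset fun i hi => ?_
      obtain ⟨i, rfl⟩ := e.surjective i
      exact ⟨i, by simpa using hi, rfl⟩
    · exact Equiv.piCongrLeft_apply_apply _ _ _ _
  · exact (e.forall_congr_right (q := fun i => x.1 i ∈ 𝒜 i k)).symm

end

theorem directSum_sigma {ι : Type*} {κ : ι → Type*} {A : ∀ i, κ i → Type*}
    [∀ i l, NonUnitalSemiring (A i l)] [∀ i l, Module K (A i l)]
    (𝒜 : ∀ i l, ℤ → Submodule K (A i l)) :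
    GradedIso K (directSumGrade K fun x : Σ i, κ i => 𝒜 x.1 x.2)
      (directSumGrade K fun i => directSumGrade K (𝒜 i)) := by
  refine ⟨{ toFun := fun x => ⟨fun i => ⟨fun l => x.1 ⟨i, l⟩,
              x.2.preimage (sigma_mk_injective.injOn)⟩,
              (x.2.image Sigma.fst).subset fun i hi => ?_⟩,
            map_smul' := fun _ _ => rfl, map_zero' := rfl, map_add' := fun _ _ => rfl,
            map_mul' := fun _ _ => rfl }, ⟨fun x z h => ?_, fun z => ?_⟩, fun k x => ?_⟩
  · by_contra h
    refine hi (Subtype.ext (funext fun l => ?_))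
    by_contra h'
    exact h ⟨⟨i, l⟩, h', rfl⟩
  · exact Subtype.ext (funext fun ⟨i, l⟩ =>
      congrFun (congrArg Subtype.val (congrFun (congrArg Subtype.val h) i)) l)
  · refine ⟨⟨fun x => (z.1 x.1).1 x.2, ?_⟩, rfl⟩
    refine (z.2.biUnion fun i _ => (z.1 i).2.image (Sigma.mk i)).subset ?_
    rintro ⟨i, l⟩ h
    refine Set.mem_biUnion (x := i) (fun h' => h ?_) ⟨l, h, rfl⟩
    change (z.1 i).1 l = 0
    rw [h']
    rfl
  · exact Sigma.forall

section Matrix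

variable {A B : Type*} [NonUnitalNonAssocSemiring A] [Module K A] [NonUnitalNonAssocSemiring B]
  [Module K B] {𝒜 : ℤ → Submodule K A} {ℬ : ℤ → Submodule K B} {m m' : Type*} [Fintype m]
  [Fintype m']

theorem matrix (h : GradedIso K 𝒜 ℬ) (e : m ≃ m') :
    GradedIso K (matrixGrade K m 𝒜) (matrixGrade K m' ℬ) := by
  obtain ⟨f, hf, hf'⟩ := h
  refine ⟨{ toFun := fun M s t => f (M (e.symm s) (e.symm t)),
            map_smul' := fun c M => ?_, map_zero' := ?_, map_add' := fun M N => ?_,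
            map_mul' := fun M N => ?_ }, ⟨fun M N h => ?_, fun N => ?_⟩, fun k M => ?_⟩
  · ext s t
    exact map_smul f c _
  · ext s t
    exact map_zero f
  · ext s t
    exact map_add f _ _
  · ext s t
    simp only [Matrix.mul_apply, map_sum, map_mul]
    exact (e.symm.sum_comp fun u => f (M (e.symm s) u) * f (N u (e.symm t))).symm
  · ext s t
    simpa using hf.1 (congrFun (congrFun h (e s)) (e t))
  · choose g hg using hf.2
    refine ⟨fun s t => g (N (e s) (e t)), ?_⟩
    ext s t
    refine (hg _).trans ?_
    rw [e.apply_symm_apply, e.apply_symm_apply]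
  · refine ⟨fun h s t => (hf' k _).1 (h _ _), fun h s t => (hf' k _).2 ?_⟩
    have := h (e s) (e t)
    change f (M (e.symm (e s)) (e.symm (e t))) ∈ _ at this
    rwa [e.symm_apply_apply, e.symm_apply_apply] at this

theorem matrix_directSum {ι : Type*} {A : ι → Type*} [∀ i, NonUnitalSemiring (A i)]
    [∀ i, Module K (A i)] (𝒜 : ∀ i, ℤ → Submodule K (A i)) :
    GradedIso K (matrixGrade K m (directSumGrade K 𝒜))
      (directSumGrade K fun i => matrixGrade K m (𝒜 i)) := by
  refine ⟨{ toFun := fun M => ⟨fun i s t => (M s t).1 i, ?_⟩,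
            map_smul' := fun _ _ => rfl, map_zero' := rfl, map_add' := fun _ _ => rfl,
            map_mul' := fun M N => ?_ }, ⟨fun M N h => ?_, fun N => ?_⟩, fun k M => ?_⟩
  · refine (Set.finite_iUnion fun s => Set.finite_iUnion fun t => (M s t).2).subset fun i hi => ?_
    by_contra h
    simp only [Set.mem_iUnion, not_exists] at h
    exact hi (by ext s t; exact not_not.1 (h s t))
  · refine Subtype.ext (funext fun i => ?_)
    ext s t
    change ((∑ u, M s u * N u t : directSumAlg K A)).1 i = ∑ u, (M s u).1 i * (N u t).1 i
    rw [AddSubmonoidClass.coe_finsetSum, Finset.sum_apply]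
    rfl
  · ext s t i
    exact congrFun (congrFun (congrFun (congrArg Subtype.val h) i) s) t
  · refine ⟨fun s t => ⟨fun i => N.1 i s t, N.2.subset fun i hi h => hi ?_⟩, rfl⟩
    exact congrFun (congrFun h s) t
  · exact ⟨fun h i s t => h s t i, fun h s t i => h i s t⟩

end Matrix

end GradedIso

/-! ### Tensor products of direct sums -/

section Tensor

open PiTensorProduct

section Single

variable {ι : Type*} {A : ι → Type*} [∀ i, NonUnitalSemiring (A i)] [∀ i, Module K (A i)]

theorem finite_setOf_ne_zero (x : directSumAlg K A) : {i | x.1 i ≠ 0}.Finite := x.2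

/-- The indices of the components that do not vanish. -/
noncomputable def directSumSupport (x : directSumAlg K A) : Finset ι :=
  (finite_setOf_ne_zero x).toFinset

theorem notMem_directSumSupport {x : directSumAlg K A} {i : ι} :
    i ∉ directSumSupport x ↔ x.1 i = 0 := by
  rw [directSumSupport, Set.Finite.mem_toFinset]
  exact not_not

variable (K A) in
/-- The projection of a direct sum onto a summand. -/
def directSumProj (i : ι) : directSumAlg K A →ₗ[K] A i where
  toFun x := x.1 i
  map_add' _ _ := rfl
  map_smul' _ _ := rfl

variable (K A) in
open Classical in
/-- The inclusion of a summand into a direct sum. -/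
noncomputable def directSumSingle (i : ι) : A i →ₗ[K] directSumAlg K A where
  toFun x := ⟨Pi.single i x, (Set.finite_singleton i).subset fun l hl => by
    by_contra h
    exact hl (Pi.single_eq_of_ne h x)⟩
  map_add' x z := Subtype.ext (Pi.single_add i x z)
  map_smul' c x := Subtype.ext (Pi.single_smul i c x)

open Classical in
theorem directSumSingle_val (i : ι) (x : A i) : (directSumSingle K A i x).1 = Pi.single i x := rfl

theorem directSumSingle_mem {𝒜 : ∀ i, ℤ → Submodule K (A i)} {i : ι} {x : A i} {k : ℤ}
    (h : x ∈ 𝒜 i k) : directSumSingle K A i x ∈ directSumGrade K 𝒜 k := fun l => by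
  classical
  rw [directSumSingle_val]
  by_cases hl : l = i
  · subst hl
    rwa [Pi.single_eq_same]
  · rw [Pi.single_eq_of_ne hl]
    exact Submodule.zero_mem _

theorem sum_directSumSingle (x : directSumAlg K A) :
    ∑ i ∈ directSumSupport x, directSumSingle K A i (x.1 i) = x := by
  classical
  refine Subtype.ext (funext fun l => ?_)
  rw [AddSubmonoidClass.coe_finsetSum, Finset.sum_apply]
  simp only [directSumSingle_val]
  rw [Finset.sum_eq_single l]
  · exact Pi.single_eq_same _ _
  · intro i _ hi
    exact Pi.single_eq_of_ne hi.symm _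
  · intro h
    rw [notMem_directSumSupport.1 h, Pi.single_zero]
    rfl

end Single

variable {J : Type*} [Fintype J] {Ω : J → Type*} {A : ∀ j, Ω j → Type*}
  [∀ j ω, NonUnitalSemiring (A j ω)] [∀ j ω, Module K (A j ω)]

variable (K A) in
/-- The component of an element of a tensor product of direct sums. -/
noncomputable def tensorProj (ω : ∀ j, Ω j) :
    (⨂[K] j, directSumAlg K (A j)) →ₗ[K] ⨂[K] j, A j (ω j) :=
  PiTensorProduct.map fun j => directSumProj K (A j) (ω j)

variable (K A) in
/-- The inclusion of a tensor product of summands. -/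
noncomputable def tensorSingle (ω : ∀ j, Ω j) :
    (⨂[K] j, A j (ω j)) →ₗ[K] ⨂[K] j, directSumAlg K (A j) :=
  PiTensorProduct.map fun j => directSumSingle K (A j) (ω j)

omit [Fintype J] in
theorem tensorProj_tprod (ω : ∀ j, Ω j) (x : ∀ j, directSumAlg K (A j)) :
    tensorProj K A ω (tprod K x) = tprod K fun j => (x j).1 (ω j) := map_tprod _ _

omit [Fintype J] in
theorem tensorSingle_tprod (ω : ∀ j, Ω j) (x : ∀ j, A j (ω j)) :
    tensorSingle K A ω (tprod K x) = tprod K fun j => directSumSingle K (A j) (ω j) (x j) :=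
  map_tprod _ _

theorem tensorProj_tprod_of_notMem (x : ∀ j, directSumAlg K (A j)) [DecidableEq J] {ω : ∀ j, Ω j}
    (h : ω ∉ Fintype.piFinset fun j => directSumSupport (x j)) : tensorProj K A ω (tprod K x) = 0 := by
  rw [tensorProj_tprod]
  obtain ⟨j, hj⟩ : ∃ j, (x j).1 (ω j) = 0 := by
    simpa [← notMem_directSumSupport] using h
  exact MultilinearMap.map_coord_zero (tprod K) j hj

theorem finite_tensorProj (x : ⨂[K] j, directSumAlg K (A j)) :
    {ω | tensorProj K A ω x ≠ 0}.Finite := by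
  classical
  induction x using PiTensorProduct.induction_on with
  | smul_tprod c x =>
    refine (Finset.finite_toSet (Fintype.piFinset fun j => directSumSupport (x j))).subset
      fun ω hω => ?_
    by_contra h
    refine hω ?_
    rw [LinearMap.map_smul, tensorProj_tprod_of_notMem x h, smul_zero]
  | add x z hx hz =>
    refine (hx.union hz).subset fun ω hω => ?_
    by_contra h
    simp only [Set.mem_union, Set.mem_ofPred_eq, not_or, not_not] at h
    exact hω (by rw [LinearMap.map_add, h.1, h.2, add_zero])

/-- On a pure tensor this is the multilinear expansion over the product of the finite supports. It
shows that the components determine `x` and lets membership in a degree be tested on them. -/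
theorem finsum_tensorSingle_tensorProj (x : ⨂[K] j, directSumAlg K (A j)) :
    ∑ᶠ ω, tensorSingle K A ω (tensorProj K A ω x) = x := by
  classical
  have hfin : ∀ x : ⨂[K] j, directSumAlg K (A j),
      (Function.support fun ω => tensorSingle K A ω (tensorProj K A ω x)).Finite := fun x =>
    (finite_tensorProj x).subset fun ω hω h =>
      hω ((congrArg (tensorSingle K A ω) h).trans (LinearMap.map_zero _))
  induction x using PiTensorProduct.induction_on with
  | smul_tprod c x =>
    simp only [LinearMap.map_smul]
    rw [← smul_finsum' c (hfin _),
      finsum_eq_sum_of_support_subset (s := Fintype.piFinset fun j => directSumSupport (x j))]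
    · simp only [tensorProj_tprod, tensorSingle_tprod]
      rw [← MultilinearMap.map_sum_finset (tprod K)
        (fun j i => directSumSingle K (A j) i ((x j).1 i)) fun j => directSumSupport (x j)]
      simp only [sum_directSumSingle]
    · intro ω hω
      by_contra h
      exact hω ((congrArg (tensorSingle K A ω) (tensorProj_tprod_of_notMem x h)).trans
        (LinearMap.map_zero _))
  | add x z hx hz =>
    simp only [LinearMap.map_add]
    rw [finsum_add_distrib (hfin _) (hfin _), hx, hz]

omit [Fintype J] in
theorem tensorProj_tensorSingle (ω : ∀ j, Ω j) (x : ⨂[K] j, A j (ω j)) :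
    tensorProj K A ω (tensorSingle K A ω x) = x := by
  induction x using PiTensorProduct.induction_on with
  | smul_tprod c x =>
    simp only [LinearMap.map_smul, tensorProj_tprod, tensorSingle_tprod, directSumSingle_val,
      Pi.single_eq_same]
  | add x z hx hz => rw [LinearMap.map_add, LinearMap.map_add, hx, hz]

omit [Fintype J] in
theorem tensorProj_tensorSingle_ne {ω ω' : ∀ j, Ω j} (h : ω' ≠ ω) (x : ⨂[K] j, A j (ω j)) :
    tensorProj K A ω' (tensorSingle K A ω x) = 0 := by
  obtain ⟨j, hj⟩ := Function.ne_iff.1 h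
  induction x using PiTensorProduct.induction_on with
  | smul_tprod c x =>
    simp only [LinearMap.map_smul, tensorProj_tprod, tensorSingle_tprod, directSumSingle_val]
    classical
    rw [MultilinearMap.map_coord_zero (tprod K) j (Pi.single_eq_of_ne hj _), smul_zero]
  | add x z hx hz => rw [LinearMap.map_add, LinearMap.map_add, hx, hz, add_zero]

variable {𝒜 : ∀ j ω, ℤ → Submodule K (A j ω)}

theorem tensorProj_mem {k : ℤ} {x : ⨂[K] j, directSumAlg K (A j)}
    (h : x ∈ tensorGrade K (fun j => directSumGrade K (𝒜 j)) k) (ω : ∀ j, Ω j) :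
    tensorProj K A ω x ∈ tensorGrade K (fun j => 𝒜 j (ω j)) k := by
  induction h using Submodule.span_induction with
  | mem x hx =>
    obtain ⟨m, a, ha, rfl, rfl⟩ := hx
    rw [tensorProj_tprod]
    exact Submodule.subset_span ⟨m, _, fun j => ha j (ω j), rfl, rfl⟩
  | zero => rw [LinearMap.map_zero]; exact Submodule.zero_mem _
  | add x z _ _ h1 h2 => rw [LinearMap.map_add]; exact Submodule.add_mem _ h1 h2
  | smul c x _ h1 => rw [LinearMap.map_smul]; exact Submodule.smul_mem _ _ h1

theorem tensorSingle_mem {k : ℤ} {ω : ∀ j, Ω j} {x : ⨂[K] j, A j (ω j)}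
    (h : x ∈ tensorGrade K (fun j => 𝒜 j (ω j)) k) :
    tensorSingle K A ω x ∈ tensorGrade K (fun j => directSumGrade K (𝒜 j)) k := by
  induction h using Submodule.span_induction with
  | mem x hx =>
    obtain ⟨m, a, ha, rfl, rfl⟩ := hx
    rw [tensorSingle_tprod]
    exact Submodule.subset_span ⟨m, _, fun j => directSumSingle_mem (ha j), rfl, rfl⟩
  | zero => rw [LinearMap.map_zero]; exact Submodule.zero_mem _
  | add x z _ _ h1 h2 => rw [LinearMap.map_add]; exact Submodule.add_mem _ h1 h2
  | smul c x _ h1 => rw [LinearMap.map_smul]; exact Submodule.smul_mem _ _ h1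

variable [∀ j ω, SMulCommClass K (A j ω) (A j ω)] [∀ j ω, IsScalarTower K (A j ω) (A j ω)]

omit [Fintype J] in
theorem tensorProj_mul (ω : ∀ j, Ω j) (x z : ⨂[K] j, directSumAlg K (A j)) :
    tensorProj K A ω (x * z) = tensorProj K A ω x * tensorProj K A ω z := by
  induction x using PiTensorProduct.induction_on with
  | smul_tprod c x =>
    induction z using PiTensorProduct.induction_on with
    | smul_tprod c' z =>
      rw [smul_tprod_mul_smul_tprod, LinearMap.map_smul, LinearMap.map_smul, LinearMap.map_smul, tensorProj_tprod,
        tensorProj_tprod, tensorProj_tprod, smul_tprod_mul_smul_tprod]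
      rfl
    | add z z' h h' => rw [mul_add, LinearMap.map_add, LinearMap.map_add, mul_add, h, h']
  | add x x' h h' => rw [add_mul, LinearMap.map_add, LinearMap.map_add, add_mul, h, h']

variable (𝒜) in
/-- Tensor products distribute over direct sums. -/
theorem GradedIso.tensor_directSum :
    GradedIso K (tensorGrade K fun j => directSumGrade K (𝒜 j))
      (directSumGrade K fun ω : ∀ j, Ω j => tensorGrade K fun j => 𝒜 j (ω j)) := by
  refine ⟨{ toFun := fun x => ⟨fun ω => tensorProj K A ω x, finite_tensorProj x⟩,
            map_smul' := fun c x => ?_, map_zero' := ?_, map_add' := fun x z => ?_,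
            map_mul' := fun x z => ?_ }, ⟨fun x z h => ?_, fun f => ?_⟩, fun k x => ?_⟩
  · exact Subtype.ext (funext fun ω => map_smul (tensorProj K A ω) c x)
  · exact Subtype.ext (funext fun ω => map_zero (tensorProj K A ω))
  · exact Subtype.ext (funext fun ω => map_add (tensorProj K A ω) x z)
  · exact Subtype.ext (funext fun ω => tensorProj_mul ω x z)
  · rw [← finsum_tensorSingle_tensorProj x, ← finsum_tensorSingle_tensorProj z]
    refine finsum_congr fun ω => congrArg _ ?_
    exact congrFun (congrArg Subtype.val h) ω
  · refine ⟨∑ ω ∈ directSumSupport f, tensorSingle K A ω (f.1 ω), Subtype.ext (funext fun ω => ?_)⟩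
    change tensorProj K A ω _ = _
    rw [map_sum, Finset.sum_eq_single ω]
    · exact tensorProj_tensorSingle _ _
    · intro ω' _ h
      exact tensorProj_tensorSingle_ne h.symm _
    · intro h
      rw [notMem_directSumSupport.1 h, map_zero, map_zero]
  · refine ⟨fun h ω => tensorProj_mem h ω, fun h => ?_⟩
    rw [← finsum_tensorSingle_tensorProj x]
    exact finsum_induction (fun x => x ∈ tensorGrade K (fun j => directSumGrade K (𝒜 j)) k)
      (Submodule.zero_mem _) (fun _ _ h1 h2 => Submodule.add_mem _ h1 h2)
      fun ω => tensorSingle_mem (h ω)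

end Tensor

end GradedIso

/-! ### The decomposition -/

section Decomposition

variable {K : Type v} [CommRing K] {I : Type u} {d n : ℕ} {p : I → Fin d}

/-- The blocks are grouped by composition. For a fixed composition the matrix size is the same for
all orbits of words, so the sum over these orbits can be moved inside the matrices and then inside
the tensor product. -/
theorem gradedIso_matSum {A : Orbit I n → Type*} [∀ ω, NonUnitalSemiring (A ω)]
    [∀ ω, Module K (A ω)] {B : ∀ (j : Fin d) (m : ℕ), Orbit (part p j) m → Type*}
    [∀ j m ω, NonUnitalSemiring (B j m ω)] [∀ j m ω, Module K (B j m ω)]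
    [∀ j m ω, SMulCommClass K (B j m ω) (B j m ω)] [∀ j m ω, IsScalarTower K (B j m ω) (B j m ω)]
    {𝒜 : ∀ ω, ℤ → Submodule K (A ω)} {ℬ : ∀ j m ω, ℤ → Submodule K (B j m ω)}
    (h : ∀ x : Σ ν : Comp d n, ∀ j, Orbit (part p j) (ν.1 j),
      GradedIso K (𝒜 (orbitEquiv n p x)) (matrixGrade K (Shuffle n x.1.1)
        (tensorGrade K fun j => ℬ j (x.1.1 j) (x.2 j)))) :
    GradedIso K (directSumGrade K 𝒜)
      (matSumGrade K (fun j m => directSumGrade K (ℬ j m)) n) := by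
  have hsigma := GradedIso.directSum_sigma
    fun (ν : Comp d n) (ω : ∀ j, Orbit (part p j) (ν.1 j)) =>
      matrixGrade K (Shuffle n ν.1) (tensorGrade K fun j => ℬ j (ν.1 j) (ω j))
  refine (GradedIso.directSum_reindex (orbitEquiv n p)).trans
    ((GradedIso.directSum h).trans (hsigma.trans (GradedIso.directSum fun ν => ?_)))
  have e : Shuffle n ν.1 ≃ MatIdx ν :=
    Fintype.equivOfCardEq ((Shuffle.card_eq ν.2).trans (Fintype.card_fin _).symm)
  exact (GradedIso.matrix_directSum _).symm.trans
    ((GradedIso.tensor_directSum fun j => ℬ j (ν.1 j)).symm.matrix e)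

end Decomposition

end QuiverHecke

/-! ### The decomposition theorem -/

theorem corollary2p9 {K : Type*} [CommRing K] {I : Type*} (Γ : Quiver I)
    (hfin : ∀ i j : I, Finite (Γ.Hom i j)) (hloop : ∀ i : I, IsEmpty (Γ.Hom i i))
    (d : ℕ) (hd : 0 < d) (p : I → Fin d)
    (hdisj : ∀ i j : I, p i ≠ p j → IsEmpty (Γ.Hom i j)) (n : ℕ) :
    QuiverHecke.GradedIso K (QuiverHecke.totalGrade K Γ n) (QuiverHecke.decompGrade K Γ p n) ∧
      ∀ Λ : I →₀ ℕ,
        QuiverHecke.GradedIso K (QuiverHecke.cycTotalGrade K Γ Λ n)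
          (QuiverHecke.cycDecompGrade K Γ p Λ n) :=
  ⟨QuiverHecke.gradedIso_matSum fun x =>
      QuiverHecke.gradedIso_grade (QuiverHecke.isShuffleSet_orbitEquiv x) hdisj,
    fun Λ => QuiverHecke.gradedIso_matSum fun x =>
      QuiverHecke.gradedIso_cycGrade (QuiverHecke.isShuffleSet_orbitEquiv x) hdisj Λ⟩
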